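/- **Theorem (Invariance of the recurrent monodromy class).** *Definitions.* Let $F(z)=\sum_{n\ge 0}A_nz^n$ be a holomorphic germ at $0$. We say that (the principal branch of) $F$ has only isolated singularities, contained in $S$, if $S\subset\mathbb C\setminus\{0\}$ is locally finite in $\mathbb C$, $F$ extends holomorphically to the slit plane $\mathbb C\setminus\bigcup_{\alpha\in S}[1,\infty)\alpha$ (the principal branch), and, for each of the two sides from which a point $p\neq 0$ can be approached in small half discs bounded by the line $\mathbb R p$, the principal branch extends holomorphically to a neighbourhood of $p$ if $p\notin S$, and extends to a holomorphic function on the universal cover of a small punctured disc around $p$ if $p\in S$. (If the segment $[0,\alpha)$ does not meet $S$, both sides give the same branch at $\alpha$.) For a branch of $F$ so continued around $\alpha\in S$, let $\Sigma_\alpha F$ be the branch obtained after one positive turn around $\alpha$. * The singularity $\alpha$ is *integrable* if $(z-\alpha)F(z)\to0$ as $z\to\alpha$ with $\arg(z-\alpha)$ bounded (on the universal cover of the punctured disc). * The singularity $\alpha$ has *recurrent monodromy of order $d\ge1$* if there are $a_0,\dots,a_{d-1}\in\mathbb C$ with $\Sigma_\alpha^{m+d}F=\sum_{k=0}^{d-1}a_k\,\Sigma_\alpha^{m+k}F$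 for all $m\ge 0$. The *recurrent monodromy class with integrable singularities* consists of the germs at $0$ having only isolated singularities, all integrable and with recurrent monodromy (of an order that may depend on the singularity and on the side). *Statement.* Let $F=\sum A_nz^n$ and $G=\sum B_nz^n$ belong to this class. Then their Hadamard product $F\odot G=\sum A_nB_nz^n$ belongs to this class. More precisely, let $F$ and $G$ have only isolated singularities, contained in $S$ and $T$ respectively, all integrable; for each side, let the monodromy of $F$ at $\alpha\in S$ be recurrent of order $d_\alpha$ and that of $G$ at $\beta\in T$ recurrent of order $d_\beta$. Then $F\odot G$ has only isolated singularities, contained in the product set $ST=\{\alpha\beta:\alpha\in S,\ \beta\in T\}$. For every $\gamma\in ST$ the set of pairs $(\alpha,\beta)\in S\times T$ with $\alpha\beta=\gamma$ is finite (let $m(\gamma)$ be its cardinality), the singularity $\gamma$ is integrable, and, from each side, its monodromy is recurrent of order $$1+\sum_{\alpha\beta=\gamma}d_\alpha d_\beta$$ (the orders $d_\alpha,d_\beta$ being those for that side); in particular it is recurrent of order $m(\gamma)\max_{\alpha\beta=\gamma}d_\alpha d_\beta+1$. If, moreover, for at least one pair with $\alpha\beta=\gamma$ a recurrence of order $d_\alpha$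 at $\alpha$, or of order $d_\beta$ at $\beta$, can be chosen with coefficients satisfying $\sum_k a_k=1$ (that is, $1$ is a root of the characteristic polynomial $X^d-\sum_k a_kX^k$), then it is recurrent of order $\sum_{\alpha\beta=\gamma}d_\alpha d_\beta$, hence of order $m(\gamma)\max_{\alpha\beta=\gamma} d_\alpha d_\beta$. -/

import Mathlib

open Filter Topology
open scoped Pointwise

namespace HadamardMonodromy

/-- The Hadamard product `∑ Aₙ Bₙ zⁿ` of the power series `∑ Aₙ zⁿ` and `∑ Bₙ zⁿ`. -/
noncomputable def hadamard (A B : PowerSeries ℂ) : PowerSeries ℂ :=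
  PowerSeries.mk fun n => PowerSeries.coeff n A * PowerSeries.coeff n B

/-- The star domain of `S`: the plane slit along the rays `[1, ∞) α`, `α ∈ S`. -/
def starDomain (S : Set ℂ) : Set ℂ :=
  {z | ∀ t ∈ Set.Icc (0 : ℝ) 1, (t : ℂ) * z ∉ S}

/-- The two sides from which a point `p ≠ 0` can be approached inside a slit plane: in the
relative coordinate `w = (z - p) / p`, which turns the ray of `p` into the real line, `left` is
the side `0 < Im w` (larger argument) and `right` the side `Im w < 0`. -/
inductive Side
  | left
  | right

/-- The side as a half plane of the coordinate `w`. -/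
def Side.halfPlane : Side → Set ℂ
  | .left => {w | 0 < w.im}
  | .right => {w | w.im < 0}

/-- The side as a strip of the coordinate `ζ = log w`. -/
def Side.strip : Side → Set ℂ
  | .left => {ζ | 0 < ζ.im ∧ ζ.im < Real.pi}
  | .right => {ζ | Real.pi < ζ.im ∧ ζ.im < 2 * Real.pi}

/-- `f`, considered at `p` from the side `s`, extends holomorphically to a full
neighbourhood of `p`. -/
def RegularAt (f : ℂ → ℂ) (s : Side) (p : ℂ) : Prop :=
  ∃ r > 0, ∃ g : ℂ → ℂ, DifferentiableOn ℂ g (Metric.ball 0 r) ∧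
    ∀ w ∈ Metric.ball (0 : ℂ) r ∩ s.halfPlane, f (p + p * w) = g w

/-- `φ` is the analytic continuation of `f`, starting on the side `s` of `α`, to the universal
cover of a punctured disc around `α`. The cover is the half plane `Re ζ < ρ`, with projection
`ζ ↦ α + α exp ζ`; the positive turn around `α` is the deck transformation `ζ ↦ ζ + 2πi`. -/
def IsContinuationAround (f : ℂ → ℂ) (s : Side) (α : ℂ) (ρ : ℝ) (φ : ℂ → ℂ) : Prop :=
  DifferentiableOn ℂ φ {ζ | ζ.re < ρ} ∧
    ∀ ζ ∈ s.strip, ζ.re < ρ → f (α + α * Complex.exp ζ) = φ ζ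

/-- The monodromy operator `Σ`: the branch reached after one positive turn. -/
noncomputable def monodromy (φ : ℂ → ℂ) : ℂ → ℂ :=
  fun ζ => φ (ζ + 2 * Real.pi * Complex.I)

/-- `f` is (the principal branch of) the germ at `0` with Taylor series `A`, holomorphic on the
star domain of the locally finite set `S ⊆ ℂ \ {0}`, and from either side of the slits the only
singularities it meets are isolated ones, situated at points of `S`. -/
structure IsPrincipalBranch (A : PowerSeries ℂ) (S : Set ℂ) (f : ℂ → ℂ) : Prop where
  locallyFinite : ∀ R : ℝ, (S ∩ Metric.closedBall 0 R).Finite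
  zero_notMem : (0 : ℂ) ∉ S
  hasSum : ∀ᶠ z in 𝓝 (0 : ℂ), HasSum (fun n => PowerSeries.coeff n A * z ^ n) (f z)
  differentiableOn : DifferentiableOn ℂ f (starDomain S)
  regularAt : ∀ p : ℂ, p ≠ 0 → p ∉ S → ∀ s, RegularAt f s p
  isolated : ∀ α ∈ S, ∀ s, ∃ ρ φ, IsContinuationAround f s α ρ φ

/-- The singularity is integrable: `(z - α) F(z) → 0` as `z → α` with `arg (z - α)` bounded,
`F` being continued around `α`. -/
def IntegrableAt (f : ℂ → ℂ) (s : Side) (α : ℂ) : Prop :=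
  ∃ ρ φ, IsContinuationAround f s α ρ φ ∧
    ∀ M : ℝ, Tendsto (fun ζ : ℂ => α * Complex.exp ζ * φ ζ)
      (comap Complex.re atBot ⊓ 𝓟 {ζ | |ζ.im| ≤ M}) (𝓝 0)

/-- The monodromy at `α` satisfies `Σ^(m+d) F = ∑_{k<d} a_k Σ^(m+k) F` for all `m ≥ 0`. -/
def SatisfiesRecurrence (f : ℂ → ℂ) (s : Side) (α : ℂ) {d : ℕ} (a : Fin d → ℂ) : Prop :=
  ∃ ρ φ, IsContinuationAround f s α ρ φ ∧
    ∀ m : ℕ, Set.EqOn (monodromy^[m + d] φ) (∑ k : Fin d, a k • monodromy^[m + (k : ℕ)] φ)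
      {ζ | ζ.re < ρ}

/-- The monodromy at `α` is recurrent of order `d ≥ 1`. -/
def RecurrentOfOrder (f : ℂ → ℂ) (s : Side) (α : ℂ) (d : ℕ) : Prop :=
  1 ≤ d ∧ ∃ a : Fin d → ℂ, SatisfiesRecurrence f s α a

/-- The recurrent monodromy class with integrable singularities: the germs at `0` that have only
isolated singularities, all of them integrable and with recurrent monodromy. -/
def IntegrableRecurrentClass : Set (PowerSeries ℂ) :=
  {A | ∃ S f, IsPrincipalBranch A S f ∧
    ∀ α ∈ S, ∀ s, IntegrableAt f s α ∧ ∃ d, RecurrentOfOrder f s α d}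

/-- The pairs `(α, β)` with `α ∈ S`, `β ∈ T` and `α β = γ`; their number is the multiplicity
`m(γ)`. -/
def factorPairs (S T : Set ℂ) (γ : ℂ) : Set (ℂ × ℂ) :=
  {p | p.1 ∈ S ∧ p.2 ∈ T ∧ p.1 * p.2 = γ}

end HadamardMonodromy

namespace HadamardMonodromy

/-! In logarithmic coordinates `u = exp s`, `z = p exp w`, Cauchy's formula writes the Hadamard
product as `(2πi)⁻¹ ∫ f(exp s) g(p exp(w - s)) ds` over a full turn of angles. The singularities of
`f` sit at `s = log α` with slits running to the right; those of the second factor sit at `s = w +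
log (p/β)` with slits running to the left. If `p` lies in the star domain of `S * T`, every ray has
a radius that separates the two families (`exists_level`), so a path exists and the product
continues across `p`. If `z` approaches `p` from a side, the path has to run between two parallel
rows of singularities at distance `|Im w|`. It is pinched as `w → 0` only where `α = p/β`, that is
where `αβ = p`; all other parts of the path contribute functions holomorphic at `w = 0`.

At a pinch the integral is a local convolution `∫ φ(v) ψ(w - v) dv` along a path between `0` and
`w`. `localConv` expresses it on the universal cover of the punctured `w`-disc, by two arms with a
fixed end and a bridge that scales with `w`. Modulo functions holomorphic at `0` it is bilinear, it
satisfies `Σ(φ * ψ) = Σφ * Σψ` (`localConv_shift_sub_mem_descends`), and it vanishes when either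
factor is holomorphic (`localConv_mem_descends_left`, `localConv_mem_descends_right`). So it factors
through a tensor product on which `Σ` acts as `Σ ⊗ Σ`, and Cayley–Hamilton for the Kronecker product
of two companion matrices yields a monic annihilator of degree `d_α d_β` (`aeval_tensorPoly`).
Integrability is inherited because the path is only logarithmically long in `w`
(`localConv_mem_integ`).

The sum over the pinches is annihilated, modulo holomorphic functions, by the product of these
polynomials, and one further factor `Σ - 1` kills the holomorphic remainder: hence the order `1 + ∑
d_α d_β`. If `1` is a root of the characteristic polynomial at some `α`, write the latter as `(X -
1) Q`. Then `Q(Σ)f` is single valued and integrable, hence holomorphic at `α` by Riemann's theorem,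
so `Q`, of degree `d_α - 1`, already serves modulo holomorphic functions. This lowers the sum by at
least one and absorbs the extra `1`.

Two local-to-global devices carry the geometry: Cousin's lemma (`of_locally_of_trans`), applied
along a ray and around the circle of angles, and `PartialSum`, which identifies the contribution of
an interval of angles by the power series it sums, so that the path can be chosen separately on each
small interval. -/

open Polynomial

/-! ### Segment integrals and holomorphic dependence on parameters. -/

/-- The integral of `Φ` along the straight segment from `a` to `b`. -/
noncomputable def segInt (Φ : ℂ → ℂ) (a b : ℂ) : ℂ :=
  (b - a) * ∫ t in (0 : ℝ)..1, Φ (a + t * (b - a))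

theorem exists_primitive {D : Set ℂ} (hD : Convex ℝ D) (ho : IsOpen D) {Φ : ℂ → ℂ}
    (hΦ : DifferentiableOn ℂ Φ D) : ∃ F : ℂ → ℂ, ∀ z ∈ D, HasDerivAt F (Φ z) z := by
  obtain ⟨F, hF⟩ := hD.exists_forall_hasDerivWithinAt hΦ
  exact ⟨F, fun z hz => (hF z hz).hasDerivAt (ho.mem_nhds hz)⟩

theorem add_mul_sub_mem {D : Set ℂ} (hD : Convex ℝ D) {a b : ℂ} (ha : a ∈ D) (hb : b ∈ D)
    {t : ℝ} (ht : t ∈ Set.Icc (0 : ℝ) 1) : a + t * (b - a) ∈ D := by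
  have := hD.add_smul_sub_mem ha hb ht
  simpa [Complex.real_smul] using this

theorem integral_mul_deriv_eq_sub {D : Set ℂ} {F Φ : ℂ → ℂ}
    (hF : ∀ z ∈ D, HasDerivAt F (Φ z) z) (hc : ContinuousOn Φ D) {γ γ' : ℝ → ℂ} {x y : ℝ}
    (hγ : ∀ t ∈ Set.uIcc x y, HasDerivAt γ (γ' t) t)
    (hγ' : ContinuousOn γ' (Set.uIcc x y)) (hmem : ∀ t ∈ Set.uIcc x y, γ t ∈ D) :
    ∫ t in x..y, Φ (γ t) * γ' t = F (γ y) - F (γ x) := by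
  refine intervalIntegral.integral_eq_sub_of_hasDerivAt (f := fun t => F (γ t)) (fun t ht => ?_) ?_
  · exact (hF _ (hmem t ht)).comp_of_eq t (hγ t ht) rfl
  · refine ContinuousOn.intervalIntegrable (ContinuousOn.mul (hc.comp (fun t ht => ?_) hmem) hγ')
    exact (hγ t ht).continuousAt.continuousWithinAt

theorem hasDerivAt_segment (a b : ℂ) (t : ℝ) :
    HasDerivAt (fun t : ℝ => a + t * (b - a)) (b - a) t := by
  have h : HasDerivAt (fun t : ℝ => (t : ℂ)) 1 t := Complex.ofRealCLM.hasDerivAt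
  simpa using (h.mul_const (b - a)).const_add a

theorem segInt_eq_integral (Φ : ℂ → ℂ) (a b : ℂ) :
    segInt Φ a b = ∫ t in (0 : ℝ)..1, Φ (a + t * (b - a)) * (b - a) := by
  rw [segInt, intervalIntegral.integral_mul_const, mul_comm]

theorem segInt_eq_sub {D : Set ℂ} (hD : Convex ℝ D) {F Φ : ℂ → ℂ}
    (hF : ∀ z ∈ D, HasDerivAt F (Φ z) z) (hc : ContinuousOn Φ D) {a b : ℂ}
    (ha : a ∈ D) (hb : b ∈ D) : segInt Φ a b = F b - F a := by
  have := integral_mul_deriv_eq_sub (γ := fun t : ℝ => a + t * (b - a)) (γ' := fun _ => b - a)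
    (x := 0) (y := 1) hF hc (fun t _ => hasDerivAt_segment a b t) continuousOn_const
    (fun t ht => add_mul_sub_mem hD ha hb (by simpa using ht))
  rw [segInt_eq_integral]
  simpa using this

theorem segInt_add {D : Set ℂ} (hD : Convex ℝ D) (ho : IsOpen D) {Φ : ℂ → ℂ}
    (hΦ : DifferentiableOn ℂ Φ D) {a b c : ℂ} (ha : a ∈ D) (hb : b ∈ D) (hc : c ∈ D) :
    segInt Φ a b + segInt Φ b c = segInt Φ a c := by
  obtain ⟨F, hF⟩ := exists_primitive hD ho hΦ
  rw [segInt_eq_sub hD hF hΦ.continuousOn ha hb, segInt_eq_sub hD hF hΦ.continuousOn hb hc,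
    segInt_eq_sub hD hF hΦ.continuousOn ha hc]
  ring

theorem segInt_congr {Φ Ψ : ℂ → ℂ} {a b : ℂ}
    (h : ∀ t ∈ Set.Ioo (0 : ℝ) 1, Φ (a + t * (b - a)) = Ψ (a + t * (b - a))) :
    segInt Φ a b = segInt Ψ a b := by
  rw [segInt, segInt]
  congr 1
  rw [intervalIntegral.integral_of_le zero_le_one, intervalIntegral.integral_of_le zero_le_one,
    MeasureTheory.integral_Ioc_eq_integral_Ioo, MeasureTheory.integral_Ioc_eq_integral_Ioo]
  exact MeasureTheory.setIntegral_congr_fun measurableSet_Ioo h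

theorem segInt_symm (Φ : ℂ → ℂ) (a b : ℂ) : segInt Φ b a = - segInt Φ a b := by
  have : ∫ t in (0 : ℝ)..1, Φ (b + t * (a - b)) = ∫ t in (0 : ℝ)..1, Φ (a + t * (b - a)) := by
    have h := intervalIntegral.integral_comp_sub_left
      (a := 0) (b := 1) (fun t : ℝ => Φ (a + t * (b - a))) 1
    simp only [sub_self, sub_zero] at h
    rw [← h]
    congr 1
    ext t
    congr 1
    push_cast
    ring
  rw [segInt, segInt, this]
  ring

theorem segInt_self (Φ : ℂ → ℂ) (a : ℂ) : segInt Φ a a = 0 := by simp [segInt]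

theorem segInt_comp_add (Φ : ℂ → ℂ) (a b c : ℂ) :
    segInt (fun z => Φ (z + c)) a b = segInt Φ (a + c) (b + c) := by
  simp only [segInt]
  congr 1
  · ring
  · congr 1
    ext t
    congr 1
    ring

theorem segInt_comp_neg (Φ : ℂ → ℂ) (a b : ℂ) :
    segInt (fun z => Φ (-z)) a b = - segInt Φ (-a) (-b) := by
  simp only [segInt]
  rw [← neg_mul]
  congr 1
  · ring
  · congr 1
    ext t
    congr 1
    ring

theorem segInt_const_mul (k : ℂ) (Φ : ℂ → ℂ) (a b : ℂ) :
    segInt (fun z => k * Φ z) a b = k * segInt Φ a b := by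
  simp only [segInt, intervalIntegral.integral_const_mul]
  ring

/-- Differentiation under the integral sign. Cauchy's estimate on circles of radius `r / 4` bounds
the derivative by the maximum of `K` on a compact set, so no hypothesis on the derivative of `K` is
needed. -/
theorem differentiableOn_integral {U : Set ℂ} (hU : IsOpen U) {K : ℝ → ℂ → ℂ} {x y : ℝ}
    (hxy : x ≤ y)
    (hc : ContinuousOn (Function.uncurry K) (Set.Icc x y ×ˢ U))
    (hd : ∀ t ∈ Set.Icc x y, DifferentiableOn ℂ (K t) U) :
    DifferentiableOn ℂ (fun w => ∫ t in x..y, K t w) U := by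
  intro w₀ hw₀
  obtain ⟨r, hr, hrU⟩ := Metric.isOpen_iff.1 hU w₀ hw₀
  have hsub : Metric.closedBall w₀ (r / 2) ⊆ U :=
    (Metric.closedBall_subset_ball (by linarith)).trans hrU
  obtain ⟨C, hC⟩ := (isCompact_Icc.prod (isCompact_closedBall w₀ (r / 2))).exists_bound_of_continuousOn
    (hc.mono (Set.prod_mono le_rfl hsub))
  have hct : ∀ w ∈ U, ContinuousOn (fun t => K t w) (Set.Icc x y) := fun w hw =>
    hc.comp (f := fun t => (t, w)) (by fun_prop) (fun t ht => ⟨ht, hw⟩)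
  have hmeas : ∀ w ∈ U, MeasureTheory.AEStronglyMeasurable (fun t => K t w)
      (MeasureTheory.volume.restrict (Set.uIoc x y)) := fun w hw => by
    rw [Set.uIoc_of_le hxy]
    exact ((hct w hw).mono Set.Ioc_subset_Icc_self).aestronglyMeasurable measurableSet_Ioc
  have hin : ∀ t ∈ Set.uIoc x y, t ∈ Set.Icc x y := fun t ht => by
    rw [Set.uIoc_of_le hxy] at ht; exact Set.Ioc_subset_Icc_self ht
  have hball : ∀ w ∈ Metric.ball w₀ (r / 4), w ∈ U := fun w hw =>
    hrU (Metric.ball_subset_ball (by linarith) hw)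
  have key := intervalIntegral.hasDerivAt_integral_of_dominated_loc_of_deriv_le
    (F := fun w t => K t w) (F' := fun w t => deriv (K t) w) (x₀ := w₀) (a := x) (b := y)
    (μ := MeasureTheory.volume) (s := Metric.ball w₀ (r / 4)) (bound := fun _ => C / (r / 4))
    (Metric.ball_mem_nhds _ (by linarith))
    (by filter_upwards [hU.mem_nhds hw₀] with w hw using hmeas w hw)
    ((hct w₀ hw₀).intervalIntegrable_of_Icc hxy) ?_ ?_ (by simp) ?_
  · exact key.2.differentiableAt.differentiableWithinAt
  -- The derivative is measurable in `t` as a pointwise limit of difference quotients with steps `(r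
  -- / 4) / (n + 1)`, small enough to stay in `U`.
  · refine aestronglyMeasurable_of_tendsto_ae (u := atTop)
      (f := fun (n : ℕ) t => (K t (w₀ + (r / 4) / (n + 1)) - K t w₀) / ((r / 4) / (n + 1))) 
      (fun n => ?_) ?_
    · have : w₀ + (r / 4) / (n + 1) ∈ U := by
        refine hsub ?_
        rw [Metric.mem_closedBall, dist_eq_norm]
        simp only [add_sub_cancel_left]
        rw [norm_div, norm_div, Complex.norm_real, Real.norm_of_nonneg hr.le]
        have h1 : ‖((n : ℂ) + 1)‖ = n + 1 := by
          exact_mod_cast Complex.norm_natCast (n + 1)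
        rw [h1]
        simp only [Complex.norm_ofNat]
        rw [div_le_iff₀ (by positivity)]
        nlinarith [n.cast_nonneg (α := ℝ)]
      simp only [div_eq_mul_inv _ ((r / 4 : ℂ) / (n + 1))]
      exact ((hmeas _ this).sub (hmeas _ hw₀)).mul_const _
    · rw [MeasureTheory.ae_restrict_iff' measurableSet_uIoc]
      refine Eventually.of_forall fun t ht => ?_
      have hda := ((hd t (hin t ht)).differentiableAt (hU.mem_nhds hw₀)).hasDerivAt
      have := hda.tendsto_slope_zero
      have h2 : Tendsto (fun n : ℕ => ((r / 4 : ℂ) / (n + 1))) atTop (𝓝[≠] 0) := by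
        rw [tendsto_nhdsWithin_iff]
        constructor
        · have := (tendsto_one_div_add_atTop_nhds_zero_nat (𝕜 := ℂ)).const_mul (r / 4 : ℂ)
          simpa [div_eq_mul_inv] using this
        · refine Eventually.of_forall fun n => ?_
          have : ((n : ℂ) + 1) ≠ 0 := by exact_mod_cast n.succ_ne_zero
          have hr' : (r : ℂ) ≠ 0 := by exact_mod_cast hr.ne'
          simp [this, hr']
      have h3 := this.comp h2
      refine h3.congr fun n => ?_
      simp [div_eq_inv_mul]
  · refine Eventually.of_forall fun t ht w hw => ?_
    refine Complex.norm_deriv_le_of_forall_mem_sphere_norm_le (by linarith) ?_ ?_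
    · refine (hd t (hin t ht)).diffContOnCl_ball fun z hz => hsub ?_
      rw [Metric.mem_closedBall] at hz ⊢
      rw [Metric.mem_ball] at hw
      linarith [dist_triangle z w w₀]
    · intro z hz
      refine hC (t, z) ⟨hin t ht, ?_⟩
      rw [Metric.mem_closedBall]
      rw [mem_sphere_iff_norm, ← dist_eq_norm] at hz
      rw [Metric.mem_ball] at hw
      linarith [dist_triangle z w w₀]
  · refine Eventually.of_forall fun t ht w hw => ?_
    exact ((hd t (hin t ht)).differentiableAt (hU.mem_nhds (hball w hw))).hasDerivAt

/-- Holomorphic dependence on a parameter of an integral along a moving segment. -/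
theorem differentiableOn_segInt {U : Set ℂ} (hU : IsOpen U) {Φ : ℂ × ℂ → ℂ} {D : Set (ℂ × ℂ)}
    (hΦ : DifferentiableOn ℂ Φ D) {a b : ℂ → ℂ} (ha : DifferentiableOn ℂ a U)
    (hb : DifferentiableOn ℂ b U)
    (hmem : ∀ w ∈ U, ∀ t ∈ Set.Icc (0 : ℝ) 1, (w, a w + t * (b w - a w)) ∈ D) :
    DifferentiableOn ℂ (fun w => segInt (fun s => Φ (w, s)) (a w) (b w)) U := by
  refine (hb.sub ha).mul (differentiableOn_integral hU zero_le_one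
    (K := fun t w => Φ (w, a w + t * (b w - a w))) ?_ fun t ht => ?_)
  · refine hΦ.continuousOn.comp (f := fun q : ℝ × ℂ => (q.2, a q.2 + q.1 * (b q.2 - a q.2))) ?_
      (fun q hq => hmem q.2 hq.2 q.1 hq.1)
    have h2 : ContinuousOn (fun q : ℝ × ℂ => a q.2) (Set.Icc 0 1 ×ˢ U) :=
      ha.continuousOn.comp continuousOn_snd fun q hq => hq.2
    have h3 : ContinuousOn (fun q : ℝ × ℂ => b q.2) (Set.Icc 0 1 ×ˢ U) :=
      hb.continuousOn.comp continuousOn_snd fun q hq => hq.2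
    have h1 : ContinuousOn (fun q : ℝ × ℂ => (q.1 : ℂ)) (Set.Icc 0 1 ×ˢ U) := by fun_prop
    exact continuousOn_snd.prodMk (h2.add (h1.mul (h3.sub h2)))
  · refine hΦ.comp (f := fun w => (w, a w + t * (b w - a w))) ?_ (fun w hw => hmem w hw t ht)
    exact differentiableOn_id.prodMk (ha.add ((hb.sub ha).const_mul _))

theorem eqOn_of_convex {D : Set ℂ} (hD : Convex ℝ D) (ho : IsOpen D) {f g : ℂ → ℂ}
    (hf : DifferentiableOn ℂ f D) (hg : DifferentiableOn ℂ g D) {z₀ : ℂ} (hz₀ : z₀ ∈ D)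
    (h : f =ᶠ[𝓝 z₀] g) : Set.EqOn f g D :=
  (hf.analyticOnNhd ho).eqOn_of_preconnected_of_eventuallyEq (hg.analyticOnNhd ho)
    hD.isPreconnected hz₀ h

/-! ### The monodromy operator and spaces of functions on the universal cover. -/

/-- The monodromy operator as a linear endomorphism. -/
noncomputable def shift : Module.End ℂ (ℂ → ℂ) where
  toFun := monodromy
  map_add' _ _ := rfl
  map_smul' _ _ := rfl

theorem shift_apply (φ : ℂ → ℂ) (ζ : ℂ) : shift φ ζ = φ (ζ + 2 * Real.pi * Complex.I) := rfl

theorem exp_add_two_pi (ζ : ℂ) : Complex.exp (ζ + 2 * Real.pi * Complex.I) = Complex.exp ζ :=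
  Complex.exp_periodic ζ

theorem two_pi_I_im : (2 * Real.pi * Complex.I : ℂ).im = 2 * Real.pi := by simp

theorem shift_pow_apply (n : ℕ) (φ : ℂ → ℂ) : (shift ^ n) φ = monodromy^[n] φ := by
  rw [Module.End.pow_apply]; rfl

/-- Transports polynomial relations through restriction to a subspace, passage to a quotient,
composition with a lifted coordinate change, and the coordinate map in Cayley–Hamilton. -/
theorem map_aeval_of_semiconj {V V' : Type*} [AddCommGroup V] [Module ℂ V] [AddCommGroup V']
    [Module ℂ V'] {T : Module.End ℂ V} {T' : Module.End ℂ V'} (L : V →ₗ[ℂ] V')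
    (h : ∀ v, L (T v) = T' (L v)) (p : ℂ[X]) (v : V) : L (aeval T p v) = aeval T' p (L v) := by
  induction p using Polynomial.induction_on' with
  | add p q hp hq => simp [hp, hq]
  | monomial n a =>
    have : ∀ n, L ((T ^ n) v) = (T' ^ n) (L v) := fun n => by
      induction n with
      | zero => simp
      | succ n ih => rw [pow_succ', pow_succ', Module.End.mul_apply, h, ih, Module.End.mul_apply]
    simp [aeval_monomial, this, Module.algebraMap_end_apply]

theorem aeval_mem_of_invariant {V : Type*} [AddCommGroup V] [Module ℂ V] {T : Module.End ℂ V}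
    {N : Submodule ℂ V} (h : ∀ v ∈ N, T v ∈ N) (p : ℂ[X]) {v : V} (hv : v ∈ N) :
    aeval T p v ∈ N := by
  induction p using Polynomial.induction_on' with
  | add p q hp hq => simpa using N.add_mem hp hq
  | monomial n a =>
    have : ∀ n, (T ^ n) v ∈ N := fun n => by
      induction n with
      | zero => simpa
      | succ n ih => rw [pow_succ', Module.End.mul_apply]; exact h _ ih
    simpa [aeval_monomial, Module.algebraMap_end_apply] using N.smul_mem a (this n)

/-- The neighbourhoods of the puncture in a sector of bounded opening of the universal cover. -/
def sectorFilter (M : ℝ) : Filter ℂ := comap Complex.re atBot ⊓ 𝓟 {ζ | |ζ.im| ≤ M}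

theorem eventually_sectorFilter {M : ℝ} {p : ℂ → Prop} :
    (∀ᶠ ζ in sectorFilter M, p ζ) ↔ ∃ N : ℝ, ∀ ζ : ℂ, ζ.re < N → |ζ.im| ≤ M → p ζ := by
  rw [sectorFilter, eventually_inf_principal, eventually_comap]
  constructor
  · intro h
    obtain ⟨N, hN⟩ := eventually_atBot.1 h
    exact ⟨N, fun ζ h1 h2 => hN _ h1.le ζ rfl h2⟩
  · rintro ⟨N, hN⟩
    filter_upwards [eventually_lt_atBot N] with x hx ζ hζ h2
    exact hN ζ (hζ ▸ hx) h2

theorem tendsto_sectorFilter {χ : ℂ → ℂ} {M M' A N : ℝ}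
    (hre : ∀ ζ : ℂ, ζ.re < N → |ζ.im| ≤ M → (χ ζ).re ≤ ζ.re + A)
    (him : ∀ ζ : ℂ, ζ.re < N → |ζ.im| ≤ M → |(χ ζ).im| ≤ M') :
    Tendsto χ (sectorFilter M) (sectorFilter M') := by
  intro s hs
  obtain ⟨K, hK⟩ := eventually_sectorFilter.1 (show ∀ᶠ ζ in sectorFilter M', ζ ∈ s from hs)
  refine eventually_sectorFilter.2 ⟨min N (K - A), fun ζ h1 h2 => ?_⟩
  have h3 := hre ζ (h1.trans_le (min_le_left _ _)) h2
  exact hK _ (by linarith [h1.trans_le (min_le_right _ _)])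
    (him ζ (h1.trans_le (min_le_left _ _)) h2)

theorem isOpen_re_lt (ρ : ℝ) : IsOpen {ζ : ℂ | ζ.re < ρ} :=
  isOpen_lt Complex.continuous_re continuous_const

theorem convex_re_lt (ρ : ℝ) : Convex ℝ {ζ : ℂ | ζ.re < ρ} := convex_halfSpace_re_lt ρ

/-- Functions holomorphic on the half plane `Re ζ < ρ`. -/
def holo (ρ : ℝ) : Submodule ℂ (ℂ → ℂ) where
  carrier := {φ | DifferentiableOn ℂ φ {ζ | ζ.re < ρ}}
  add_mem' h1 h2 := h1.add h2
  zero_mem' := differentiableOn_const 0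
  smul_mem' c _ h := h.const_smul c

/-- Functions `φ` on the universal cover with `exp ζ * φ ζ → 0` in sectors. -/
def integ : Submodule ℂ (ℂ → ℂ) where
  carrier := {φ | ∀ M, Tendsto (fun ζ => Complex.exp ζ * φ ζ) (sectorFilter M) (𝓝 0)}
  add_mem' h1 h2 M := by simpa [mul_add] using (h1 M).add (h2 M)
  zero_mem' M := by simpa using tendsto_const_nhds
  smul_mem' c φ h M := by simpa [mul_left_comm] using (h M).const_mul c

/-- Functions on `Re ζ < ρ` that come from a holomorphic function on the unpunctured disc. -/
def descends (ρ : ℝ) : Submodule ℂ (ℂ → ℂ) where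
  carrier := {φ | ∃ H : ℂ → ℂ, DifferentiableOn ℂ H (Metric.ball 0 (Real.exp ρ)) ∧
    ∀ ζ : ℂ, ζ.re < ρ → φ ζ = H (Complex.exp ζ)}
  add_mem' := by
    rintro φ ψ ⟨H, h1, h2⟩ ⟨K, h3, h4⟩
    exact ⟨H + K, h1.add h3, fun ζ hζ => by simp [h2 ζ hζ, h4 ζ hζ]⟩
  zero_mem' := ⟨0, differentiableOn_const 0, fun ζ _ => rfl⟩
  smul_mem' := by
    rintro c φ ⟨H, h1, h2⟩
    exact ⟨c • H, h1.const_smul c, fun ζ hζ => by simp [h2 ζ hζ]⟩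

/-- Functions that vanish on the half plane `Re ζ < ρ`. -/
def vanish (ρ : ℝ) : Submodule ℂ (ℂ → ℂ) where
  carrier := {φ | ∀ ζ : ℂ, ζ.re < ρ → φ ζ = 0}
  add_mem' h1 h2 ζ hζ := by simp [h1 ζ hζ, h2 ζ hζ]
  zero_mem' ζ _ := rfl
  smul_mem' c φ h ζ hζ := by simp [h ζ hζ]

theorem descends_mono {ρ ρ' : ℝ} (h : ρ' ≤ ρ) : descends ρ ≤ descends ρ' := by
  rintro φ ⟨H, h1, h2⟩
  exact ⟨H, h1.mono (Metric.ball_subset_ball (Real.exp_le_exp.2 h)),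
    fun ζ hζ => h2 ζ (hζ.trans_le h)⟩

theorem holo_mono {ρ ρ' : ℝ} (h : ρ' ≤ ρ) : holo ρ ≤ holo ρ' := fun _ hφ =>
  DifferentiableOn.mono hφ fun _ hζ => lt_of_lt_of_le hζ h

/-- Germs at the puncture of functions that come from a holomorphic function at the centre. -/
def descendsGerm : Submodule ℂ (ℂ → ℂ) where
  carrier := {φ | ∃ ρ, φ ∈ descends ρ}
  add_mem' := by
    rintro φ ψ ⟨ρ, h⟩ ⟨ρ', h'⟩
    exact ⟨min ρ ρ', (descends _).add_mem (descends_mono (min_le_left _ _) h)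
      (descends_mono (min_le_right _ _) h')⟩
  zero_mem' := ⟨0, (descends 0).zero_mem⟩
  smul_mem' := by
    rintro c φ ⟨ρ, h⟩
    exact ⟨ρ, (descends ρ).smul_mem c h⟩

theorem norm_exp_lt {ζ : ℂ} {ρ : ℝ} (h : ζ.re < ρ) : ‖Complex.exp ζ‖ < Real.exp ρ := by
  rw [Complex.norm_exp]; exact Real.exp_lt_exp.2 h

theorem exp_mem_ball {ζ : ℂ} {ρ : ℝ} (h : ζ.re < ρ) :
    Complex.exp ζ ∈ Metric.ball (0 : ℂ) (Real.exp ρ) := by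
  rw [mem_ball_zero_iff]; exact norm_exp_lt h

theorem shift_mem_holo {ρ : ℝ} {φ : ℂ → ℂ} (h : φ ∈ holo ρ) : shift φ ∈ holo ρ := by
  refine DifferentiableOn.comp (t := {ζ | ζ.re < ρ}) (f := fun ζ => ζ + 2 * Real.pi * Complex.I) h
    (by fun_prop) (fun ζ hζ => ?_)
  simpa using hζ

theorem shift_mem_integ {φ : ℂ → ℂ} (h : φ ∈ integ) : shift φ ∈ integ := by
  intro M
  have := (h (M + 2 * Real.pi)).comp (tendsto_sectorFilter (M := M) (A := 0) (N := 0)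
    (χ := fun ζ => ζ + 2 * Real.pi * Complex.I) (fun ζ _ _ => by simp) (fun ζ _ h2 => ?_))
  · refine this.congr fun ζ => ?_
    simp [Function.comp, exp_add_two_pi, shift_apply]
  · rw [Complex.add_im, two_pi_I_im]
    refine (abs_add_le _ _).trans ?_
    rw [abs_of_pos Real.two_pi_pos]; linarith

theorem shift_mem_descends {ρ : ℝ} {φ : ℂ → ℂ} (h : φ ∈ descends ρ) : shift φ ∈ descends ρ := by
  obtain ⟨H, h1, h2⟩ := h
  refine ⟨H, h1, fun ζ hζ => ?_⟩
  rw [shift_apply, h2 _ (by simpa using hζ), exp_add_two_pi]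

theorem shift_mem_descendsGerm {φ : ℂ → ℂ} (h : φ ∈ descendsGerm) : shift φ ∈ descendsGerm := by
  obtain ⟨ρ, h⟩ := h
  exact ⟨ρ, shift_mem_descends h⟩

theorem shift_mem_vanish {ρ : ℝ} {φ : ℂ → ℂ} (h : φ ∈ vanish ρ) : shift φ ∈ vanish ρ := by
  intro ζ hζ
  rw [shift_apply]
  exact h _ (by simpa using hζ)

theorem vanish_le_descends (ρ : ℝ) : vanish ρ ≤ descends ρ := fun _ h =>
  ⟨0, differentiableOn_const 0, fun ζ hζ => h ζ hζ⟩

/-- A function of `exp ζ` is `2πi`-periodic. This is the source of the additional `1` in the order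
of the recurrence. -/
theorem shift_sub_mem_vanish {ρ : ℝ} {φ : ℂ → ℂ} (h : φ ∈ descends ρ) :
    shift φ - φ ∈ vanish ρ := by
  obtain ⟨H, h1, h2⟩ := h
  intro ζ hζ
  rw [Pi.sub_apply, shift_apply, h2 _ (by simpa using hζ), exp_add_two_pi, h2 ζ hζ, sub_self]

theorem descends_mem_integ {ρ : ℝ} {φ : ℂ → ℂ} (h : φ ∈ descends ρ) : φ ∈ integ := by
  obtain ⟨H, h1, h2⟩ := h
  intro M
  have hexp : Tendsto Complex.exp (sectorFilter M) (𝓝 0) := by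
    refine Metric.tendsto_nhds.2 fun ε hε => eventually_sectorFilter.2
      ⟨Real.log ε, fun ζ hζ _ => ?_⟩
    rw [dist_zero_right]
    simpa [Real.exp_log hε] using norm_exp_lt hζ
  have hH : ContinuousAt (fun w => w * H w) 0 :=
    continuousAt_id.mul (h1.continuousOn.continuousAt (Metric.ball_mem_nhds _ (Real.exp_pos ρ)))
  rw [ContinuousAt, zero_mul] at hH
  refine (hH.comp hexp).congr' (eventually_sectorFilter.2 ⟨ρ, fun ζ hζ _ => ?_⟩)
  simp [h2 ζ hζ]

theorem descends_mem_holo {ρ : ℝ} {φ : ℂ → ℂ} (h : φ ∈ descends ρ) : φ ∈ holo ρ := by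
  obtain ⟨H, h1, h2⟩ := h
  exact (h1.comp Complex.differentiable_exp.differentiableOn fun ζ hζ => exp_mem_ball hζ).congr h2

theorem exp_mem_halfPlane {s : Side} {ζ : ℂ} (h : ζ ∈ s.strip) : Complex.exp ζ ∈ s.halfPlane := by
  cases s with
  | left =>
    change 0 < (Complex.exp ζ).im
    rw [Complex.exp_im]
    exact mul_pos (Real.exp_pos _) (Real.sin_pos_of_pos_of_lt_pi h.1 h.2)
  | right =>
    change (Complex.exp ζ).im < 0
    rw [Complex.exp_im]
    refine mul_neg_of_pos_of_neg (Real.exp_pos _) ?_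
    rw [← Real.sin_sub_two_pi]
    exact Real.sin_neg_of_neg_of_neg_pi_lt (by linarith [h.2]) (by linarith [h.1])

theorem exists_strip_exp_eq {s : Side} {w : ℂ} (h : w ∈ s.halfPlane) :
    ∃ ζ ∈ s.strip, Complex.exp ζ = w := by
  have hw : w ≠ 0 := by
    rintro rfl
    cases s <;> simp [Side.halfPlane] at h
  cases s with
  | left =>
    have h : 0 < w.im := h
    refine ⟨Complex.log w, ⟨?_, ?_⟩, Complex.exp_log hw⟩
    · rw [Complex.log_im]
      exact lt_of_le_of_ne (Complex.arg_nonneg_iff.2 h.le) fun h0 => by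
        have := (Complex.arg_eq_zero_iff.1 h0.symm).2
        linarith
    · rw [Complex.log_im]
      exact lt_of_le_of_ne (Complex.arg_le_pi w) fun h0 => by
        have := (Complex.arg_eq_pi_iff.1 h0).2
        linarith
  | right =>
    have h : w.im < 0 := h
    refine ⟨Complex.log w + 2 * Real.pi * Complex.I, ⟨?_, ?_⟩, by
      rw [exp_add_two_pi, Complex.exp_log hw]⟩
    · rw [Complex.add_im, two_pi_I_im, Complex.log_im]
      linarith [Complex.neg_pi_lt_arg w]
    · rw [Complex.add_im, two_pi_I_im, Complex.log_im]
      linarith [Complex.arg_neg_iff.2 h]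

theorem re_lt_of_exp_norm_lt {ζ : ℂ} {r : ℝ} (h : ‖Complex.exp ζ‖ < Real.exp r) : ζ.re < r := by
  rwa [Complex.norm_exp, Real.exp_lt_exp] at h

/-! ### Side germs with a monodromy relation modulo holomorphic functions. -/

/-- `k`, given on the half disc `s.halfPlane` at `0`, continues to the universal cover of a
punctured disc, has an integrable singularity at `0`, and `Q(Σ) k` is holomorphic at `0`. -/
def MonodromyClass (k : ℂ → ℂ) (s : Side) (Q : ℂ[X]) : Prop :=
  ∃ ρ φ, φ ∈ holo ρ ∧ (∀ ζ ∈ s.strip, ζ.re < ρ → k (Complex.exp ζ) = φ ζ) ∧ φ ∈ integ ∧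
    aeval shift Q φ ∈ descends ρ

namespace MonodromyClass

theorem of_dvd {k : ℂ → ℂ} {s : Side} {Q Q' : ℂ[X]} (h : MonodromyClass k s Q) (hQ : Q ∣ Q') :
    MonodromyClass k s Q' := by
  obtain ⟨ρ, φ, h1, h2, h3, h4⟩ := h
  obtain ⟨R, rfl⟩ := hQ
  refine ⟨ρ, φ, h1, h2, h3, ?_⟩
  rw [mul_comm, map_mul, Module.End.mul_apply]
  exact aeval_mem_of_invariant (fun _ => shift_mem_descends) R h4

theorem exists_lt {k : ℂ → ℂ} {s : Side} {Q : ℂ[X]} (h : MonodromyClass k s Q) (ρ₀ : ℝ) :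
    ∃ ρ ≤ ρ₀, ∃ φ, φ ∈ holo ρ ∧ (∀ ζ ∈ s.strip, ζ.re < ρ → k (Complex.exp ζ) = φ ζ) ∧
      φ ∈ integ ∧ aeval shift Q φ ∈ descends ρ := by
  obtain ⟨ρ, φ, h1, h2, h3, h4⟩ := h
  exact ⟨min ρ ρ₀, min_le_right _ _, φ, holo_mono (min_le_left _ _) h1,
    fun ζ hζ h => h2 ζ hζ (h.trans_le (min_le_left _ _)), h3, descends_mono (min_le_left _ _) h4⟩

/-- Both summands are annihilated by the common multiple `Q * Q'`; the product over the pinches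
arises in this way. -/
theorem add {k k' : ℂ → ℂ} {s : Side} {Q Q' : ℂ[X]} (h : MonodromyClass k s Q)
    (h' : MonodromyClass k' s Q') : MonodromyClass (fun w => k w + k' w) s (Q * Q') := by
  obtain ⟨ρ, φ, h1, h2, h3, h4⟩ := h.of_dvd (dvd_mul_right Q Q')
  obtain ⟨ρ', hρ, φ', h1', h2', h3', h4'⟩ := (h'.of_dvd (dvd_mul_left Q' Q)).exists_lt ρ
  refine ⟨ρ', φ + φ', (holo _).add_mem (holo_mono hρ h1) h1', fun ζ hζ h => ?_,
    integ.add_mem h3 h3', ?_⟩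
  · beta_reduce
    rw [h2 ζ hζ (h.trans_le hρ), h2' ζ hζ h, Pi.add_apply]
  · rw [map_add]
    exact (descends _).add_mem (descends_mono hρ h4) h4'

theorem const_mul {k : ℂ → ℂ} {s : Side} {Q : ℂ[X]} (h : MonodromyClass k s Q) (c : ℂ) :
    MonodromyClass (fun w => c * k w) s Q := by
  obtain ⟨ρ, φ, h1, h2, h3, h4⟩ := h
  refine ⟨ρ, c • φ, (holo _).smul_mem c h1, fun ζ hζ h => ?_, integ.smul_mem c h3, ?_⟩
  · beta_reduce
    rw [h2 ζ hζ h, Pi.smul_apply, smul_eq_mul]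
  · rw [map_smul]
    exact (descends _).smul_mem c h4

theorem congr {k k' : ℂ → ℂ} {s : Side} {Q : ℂ[X]} (h : MonodromyClass k s Q) {δ : ℝ}
    (hδ : 0 < δ) (hk : ∀ w ∈ s.halfPlane, ‖w‖ < δ → k' w = k w) : MonodromyClass k' s Q := by
  obtain ⟨ρ, hρ, φ, h1, h2, h3, h4⟩ := h.exists_lt (Real.log δ)
  refine ⟨ρ, φ, h1, fun ζ hζ h => ?_, h3, h4⟩
  rw [← h2 ζ hζ h]
  refine hk _ (exp_mem_halfPlane hζ) ?_
  rw [← Real.exp_log hδ]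
  exact norm_exp_lt (h.trans_le hρ)

theorem of_differentiableOn {k H : ℂ → ℂ} {r : ℝ} (hr : 0 < r)
    (hH : DifferentiableOn ℂ H (Metric.ball 0 r)) (s : Side)
    (hk : ∀ w ∈ s.halfPlane, ‖w‖ < r → k w = H w) : MonodromyClass k s 1 := by
  have hmem : (fun ζ => H (Complex.exp ζ)) ∈ descends (Real.log r) :=
    ⟨H, by rwa [Real.exp_log hr], fun ζ _ => rfl⟩
  refine ⟨Real.log r, fun ζ => H (Complex.exp ζ), descends_mem_holo hmem, fun ζ hζ h => ?_,
    descends_mem_integ hmem, by simpa using hmem⟩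
  refine hk _ (exp_mem_halfPlane hζ) ?_
  simpa [Real.exp_log hr] using norm_exp_lt h

theorem exists_differentiableOn {k : ℂ → ℂ} {s : Side} (h : MonodromyClass k s 1) :
    ∃ r > 0, ∃ H : ℂ → ℂ, DifferentiableOn ℂ H (Metric.ball 0 r) ∧
      ∀ w ∈ s.halfPlane, ‖w‖ < r → k w = H w := by
  obtain ⟨ρ, φ, h1, h2, h3, h4⟩ := h
  rw [map_one, Module.End.one_apply] at h4
  obtain ⟨H, h5, h6⟩ := h4
  refine ⟨Real.exp ρ, Real.exp_pos ρ, H, h5, fun w hw hr => ?_⟩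
  obtain ⟨ζ, hζ, rfl⟩ := exists_strip_exp_eq hw
  rw [h2 ζ hζ (re_lt_of_exp_norm_lt hr), h6 ζ (re_lt_of_exp_norm_lt hr)]

end MonodromyClass

/-- Composition with `χ` as a linear map. -/
def compRight (χ : ℂ → ℂ) : (ℂ → ℂ) →ₗ[ℂ] (ℂ → ℂ) where
  toFun φ := φ ∘ χ
  map_add' _ _ := rfl
  map_smul' _ _ := rfl

theorem aeval_shift_comp {χ : ℂ → ℂ}
    (hχ : ∀ ζ, χ (ζ + 2 * Real.pi * Complex.I) = χ ζ + 2 * Real.pi * Complex.I) (Q : ℂ[X])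
    (φ : ℂ → ℂ) : aeval shift Q (φ ∘ χ) = (aeval shift Q φ) ∘ χ :=
  (map_aeval_of_semiconj (T := shift) (T' := shift) (compRight χ) (fun φ => by
    ext ζ
    simp [compRight, shift_apply, hχ]) Q φ).symm

/-- The map `w ↦ -w` lifts to the translation by `c = ±πi`, which commutes with the deck
transformation. The sign is chosen so that one strip is carried onto the other; this reduces the
right side to the left side. -/
theorem MonodromyClass.comp_neg_aux {k : ℂ → ℂ} {s s' : Side} {Q : ℂ[X]}
    (h : MonodromyClass k s Q) (c : ℂ) (hc : c.re = 0) (hexp : Complex.exp c = -1)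
    (hs : ∀ ζ ∈ s'.strip, ζ + c ∈ s.strip) : MonodromyClass (fun w => k (-w)) s' Q := by
  obtain ⟨ρ, φ, h1, h2, h3, h4⟩ := h
  have he : ∀ ζ, Complex.exp (ζ + c) = - Complex.exp ζ := fun ζ => by
    rw [Complex.exp_add, hexp, mul_neg_one]
  have hre : ∀ ζ : ℂ, (ζ + c).re = ζ.re := fun ζ => by simp [hc]
  refine ⟨ρ, φ ∘ (· + c), ?_, fun ζ hζ h => ?_, fun M => ?_, ?_⟩
  · refine DifferentiableOn.comp (t := {ζ | ζ.re < ρ}) h1 (by fun_prop) (fun ζ hζ => ?_)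
    simpa [hc] using hζ
  · beta_reduce
    rw [← he, h2 _ (hs ζ hζ) (by rwa [hre])]; rfl
  · have := (h3 (M + |c.im|)).comp (tendsto_sectorFilter (M := M) (A := 0) (N := 0)
      (χ := fun ζ => ζ + c) (fun ζ _ _ => by simp [hc]) (fun ζ _ h2 => ?_))
    · have h5 := this.neg
      rw [neg_zero] at h5
      refine h5.congr fun ζ => ?_
      simp [Function.comp, he]
    · rw [Complex.add_im]
      exact (abs_add_le _ _).trans (by linarith)
  · rw [aeval_shift_comp (fun ζ => by ring)]
    obtain ⟨H, h5, h6⟩ := h4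
    refine ⟨fun w => H (-w), h5.comp (by fun_prop) (fun w hw => ?_), fun ζ hζ => ?_⟩
    · simpa using hw
    · rw [Function.comp_apply, h6 _ (by rwa [hre]), he]

theorem MonodromyClass.comp_neg_left {k : ℂ → ℂ} {Q : ℂ[X]}
    (h : MonodromyClass k .right Q) : MonodromyClass (fun w => k (-w)) .left Q :=
  h.comp_neg_aux (Real.pi * Complex.I) (by simp) Complex.exp_pi_mul_I fun ζ hζ => by
    constructor <;> simp <;> linarith [hζ.1, hζ.2]

theorem MonodromyClass.comp_neg_right {k : ℂ → ℂ} {Q : ℂ[X]}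
    (h : MonodromyClass k .left Q) : MonodromyClass (fun w => k (-w)) .right Q :=
  h.comp_neg_aux (-(Real.pi * Complex.I)) (by simp)
    (by rw [Complex.exp_neg, Complex.exp_pi_mul_I]; norm_num) fun ζ hζ => by
    constructor <;> simp <;> linarith [hζ.1, hζ.2]

/-- Invariance under a local holomorphic change of coordinates that preserves the half planes. -/
theorem MonodromyClass.comp {k : ℂ → ℂ} {s : Side} {Q : ℂ[X]} (h : MonodromyClass k s Q)
    {E : ℂ → ℂ} {r : ℝ} (hr : 0 < r) (hE : DifferentiableOn ℂ E (Metric.ball 0 r)) (hE0 : E 0 = 0)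
    (hE1 : HasDerivAt E 1 0)
    (hpos : ∀ w ∈ Metric.ball (0 : ℂ) r, 0 < w.im → 0 < (E w).im)
    (hneg : ∀ w ∈ Metric.ball (0 : ℂ) r, w.im < 0 → (E w).im < 0) :
    MonodromyClass (fun w => k (E w)) s Q := by
  have hslope : ∀ᶠ w in 𝓝[≠] (0 : ℂ), ‖E w / w - 1‖ < 1 / 2 := by
    have := hE1.tendsto_slope_zero
    simp only [zero_add, hE0, sub_zero, smul_eq_mul] at this
    filter_upwards [Metric.tendsto_nhds.1 this (1 / 2) (by norm_num)] with w hw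
    rwa [dist_eq_norm, ← div_eq_inv_mul] at hw
  obtain ⟨ε, hε, hεs⟩ := Metric.eventually_nhds_iff.1 (eventually_nhdsWithin_iff.1 hslope)
  obtain ⟨ρ, hρ, φ, h1, h2, h3, h4⟩ := h.exists_lt (min (Real.log ε) (Real.log r))
  have hball : ∀ ζ : ℂ, ζ.re < ρ - 1 → Complex.exp ζ ∈ Metric.ball (0 : ℂ) r := fun ζ hζ => by
    have := norm_exp_lt (hζ.trans (sub_one_lt ρ) |>.trans_le (hρ.trans (min_le_right _ _)))
    rwa [Real.exp_log hr, ← mem_ball_zero_iff] at this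
  have hq : ∀ ζ : ℂ, ζ.re < ρ - 1 → ‖E (Complex.exp ζ) / Complex.exp ζ - 1‖ < 1 / 2 := fun ζ hζ => by
    have := norm_exp_lt (hζ.trans (sub_one_lt ρ) |>.trans_le (hρ.trans (min_le_left _ _)))
    rw [Real.exp_log hε, ← dist_zero_right] at this
    exact hεs this (Complex.exp_ne_zero ζ)
  -- The change of coordinates lifts to `χ ζ = ζ + log (E (exp ζ) / exp ζ)`. The quotient is within
  -- `1/2` of `1`, so the principal logarithm is holomorphic there, and it is periodic, so `χ`
  -- commutes with the deck transformation.
  set q : ℂ → ℂ := fun ζ => E (Complex.exp ζ) / Complex.exp ζ with hqdef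
  set χ : ℂ → ℂ := fun ζ => ζ + Complex.log (q ζ) with hχ
  have hre : ∀ ζ : ℂ, ζ.re < ρ - 1 → 1 / 2 < (q ζ).re := fun ζ hζ => by
    have h5 := (Complex.abs_re_le_norm _).trans_lt (hq ζ hζ)
    rw [abs_lt, Complex.sub_re, Complex.one_re] at h5
    linarith [h5.1]
  have hq0 : ∀ ζ : ℂ, ζ.re < ρ - 1 → q ζ ≠ 0 := fun ζ hζ h0 => by
    have := hre ζ hζ
    rw [h0] at this
    norm_num at this
  have hexp : ∀ ζ : ℂ, ζ.re < ρ - 1 → Complex.exp (χ ζ) = E (Complex.exp ζ) := fun ζ hζ => by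
    rw [hχ, Complex.exp_add, Complex.exp_log (hq0 ζ hζ), hqdef]
    field_simp [Complex.exp_ne_zero]
  have hχre : ∀ ζ : ℂ, ζ.re < ρ - 1 → (χ ζ).re ≤ ζ.re + 1 := fun ζ hζ => by
    rw [hχ, Complex.add_re, Complex.log_re]
    have h5 : ‖q ζ‖ ≤ 2 := by
      have := norm_add_le (q ζ - 1) 1
      rw [sub_add_cancel, norm_one] at this
      linarith [hq ζ hζ]
    have h6 := Real.log_le_sub_one_of_pos (norm_pos_iff.2 (hq0 ζ hζ))
    linarith
  have hχlt : ∀ ζ : ℂ, ζ.re < ρ - 1 → (χ ζ).re < ρ := fun ζ hζ => by linarith [hχre ζ hζ]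
  have him : ∀ ζ : ℂ, ζ.re < ρ - 1 → |(χ ζ).im - ζ.im| < Real.pi / 2 := fun ζ hζ => by
    rw [hχ, Complex.add_im, Complex.log_im, add_sub_cancel_left]
    exact Complex.abs_arg_lt_pi_div_two_iff.2 (Or.inl (by linarith [hre ζ hζ]))
  have hper : ∀ ζ, χ (ζ + 2 * Real.pi * Complex.I) = χ ζ + 2 * Real.pi * Complex.I := fun ζ => by
    simp only [hχ, hqdef, exp_add_two_pi]; ring
  have hqd : DifferentiableOn ℂ q {ζ | ζ.re < ρ - 1} :=
    (hE.comp Complex.differentiable_exp.differentiableOn hball).div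
      Complex.differentiable_exp.differentiableOn fun ζ _ => Complex.exp_ne_zero ζ
  have hχd : DifferentiableOn ℂ χ {ζ | ζ.re < ρ - 1} :=
    differentiableOn_id.add (hqd.clog fun ζ hζ => Or.inl (by linarith [hre ζ hζ]))
  -- The loss of `1` in `ρ` pays for `log ‖q‖ ≤ ‖q‖ - 1 ≤ 1`.
  refine ⟨ρ - 1, φ ∘ χ, DifferentiableOn.comp h1 hχd hχlt, fun ζ hζ hlt => ?_, fun M => ?_, ?_⟩
  -- `χ` moves imaginary parts by less than `π/2`, and `sin (Im χ)` has the sign prescribed by the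
  -- half plane; together these exclude the neighbouring strips.
  · have hmem : χ ζ ∈ s.strip := by
      have h5 := abs_lt.1 (him ζ hlt)
      cases s with
      | left =>
        have h6 := hpos _ (hball ζ hlt) (exp_mem_halfPlane hζ)
        rw [← hexp ζ hlt, Complex.exp_im, mul_pos_iff_of_pos_left (Real.exp_pos _)] at h6
        have hz1 : 0 < ζ.im := hζ.1
        have hz2 : ζ.im < Real.pi := hζ.2
        constructor
        · by_contra! h7
          linarith [Real.sin_nonpos_of_nonpos_of_neg_pi_le h7 (by linarith)]
        · by_contra! h7
          have := Real.sin_nonpos_of_nonpos_of_neg_pi_le (x := (χ ζ).im - 2 * Real.pi)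
            (by linarith [Real.pi_pos]) (by linarith)
          rw [Real.sin_sub_two_pi] at this
          linarith
      | right =>
        have h6 := hneg _ (hball ζ hlt) (exp_mem_halfPlane hζ)
        rw [← hexp ζ hlt, Complex.exp_im] at h6
        have h6 : Real.sin (χ ζ).im < 0 := by
          by_contra! h7
          linarith [mul_nonneg (Real.exp_pos (χ ζ).re).le h7]
        have hz1 : Real.pi < ζ.im := hζ.1
        have hz2 : ζ.im < 2 * Real.pi := hζ.2
        constructor
        · by_contra! h7
          linarith [Real.sin_nonneg_of_nonneg_of_le_pi (x := (χ ζ).im) (by linarith [Real.pi_pos]) h7]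
        · by_contra! h7
          have := Real.sin_nonneg_of_nonneg_of_le_pi (x := (χ ζ).im - 2 * Real.pi)
            (by linarith [Real.pi_pos]) (by linarith [Real.pi_pos])
          rw [Real.sin_sub_two_pi] at this
          linarith
    beta_reduce
    rw [← hexp ζ hlt, h2 _ hmem (hχlt ζ hlt)]; rfl
  · have h5 := (h3 (M + Real.pi / 2)).comp (tendsto_sectorFilter (M := M) (A := 1) (N := ρ - 1)
      (χ := χ) (fun ζ h _ => hχre ζ h) (fun ζ h h2 => ?_))
    · have h6 := (tendsto_zero_iff_norm_tendsto_zero.1 h5).const_mul 2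
      rw [mul_zero] at h6
      refine squeeze_zero_norm' (eventually_sectorFilter.2 ⟨ρ - 1, fun ζ h _ => ?_⟩) h6
      rw [Function.comp_apply, Function.comp_apply, hexp ζ h, norm_mul, norm_mul, ← mul_assoc]
      gcongr
      have h7 : ‖E (Complex.exp ζ)‖ = ‖q ζ‖ * ‖Complex.exp ζ‖ := by
        rw [← norm_mul, hqdef]
        field_simp [Complex.exp_ne_zero]
      rw [h7]
      have h8 : 1 / 2 < ‖q ζ‖ := (hre ζ h).trans_le (Complex.re_le_norm _)
      nlinarith [norm_nonneg (Complex.exp ζ)]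
    · have := abs_sub_abs_le_abs_sub (χ ζ).im ζ.im
      linarith [him ζ h]
  · rw [aeval_shift_comp hper]
    obtain ⟨H, h5, h6⟩ := h4
    refine ⟨fun w => H (E w), h5.comp (hE.mono ?_) (fun w hw => ?_), fun ζ hζ => ?_⟩
    · refine Metric.ball_subset_ball ?_
      rw [← Real.exp_log hr]
      exact Real.exp_le_exp.2 (by linarith [hρ.trans (min_le_right _ _)])
    · rcases eq_or_ne w 0 with rfl | hw0
      · rw [hE0]; exact Metric.mem_ball_self (Real.exp_pos _)
      · have h7 : (Complex.log w).re < ρ - 1 := by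
          rw [Complex.log_re, Real.log_lt_iff_lt_exp (norm_pos_iff.2 hw0)]
          simpa using hw
        have := exp_mem_ball (hχlt _ h7)
        rwa [hexp _ h7, Complex.exp_log hw0] at this
    · rw [Function.comp_apply, h6 _ (hχlt ζ hζ), hexp ζ hζ]

/-! ### Removable singularities and uniqueness of continuation. -/

theorem periodic_int_of_vanish {ρ : ℝ} {ψ : ℂ → ℂ} (h : shift ψ - ψ ∈ vanish ρ) (n : ℤ) {ζ : ℂ}
    (hζ : ζ.re < ρ) : ψ (ζ + n * (2 * Real.pi * Complex.I)) = ψ ζ := by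
  have hnat : ∀ (n : ℕ) (ζ : ℂ), ζ.re < ρ → ψ (ζ + n * (2 * Real.pi * Complex.I)) = ψ ζ := by
    intro n
    induction n with
    | zero => simp
    | succ n ih =>
      intro ζ hζ
      have := h (ζ + n * (2 * Real.pi * Complex.I)) (by simpa using hζ)
      rw [Pi.sub_apply, shift_apply, sub_eq_zero, ih ζ hζ] at this
      rw [← this]
      congr 1
      push_cast
      ring
  obtain ⟨n, rfl | rfl⟩ := n.eq_nat_or_neg
  · exact_mod_cast hnat n ζ hζ
  · rw [← hnat n _ (by simpa using hζ)]
    congr 1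
    push_cast
    ring

theorem eq_of_exp_eq_of_vanish {ρ : ℝ} {ψ : ℂ → ℂ} (h : shift ψ - ψ ∈ vanish ρ) {ζ ζ' : ℂ}
    (hζ : ζ.re < ρ) (he : Complex.exp ζ' = Complex.exp ζ) : ψ ζ' = ψ ζ := by
  obtain ⟨n, rfl⟩ := Complex.exp_eq_exp_iff_exists_int.1 he
  exact periodic_int_of_vanish h n hζ

theorem log_re_lt {w : ℂ} {ρ : ℝ} (hw : w ≠ 0) (h : ‖w‖ < Real.exp ρ) :
    (Complex.log w).re < ρ := by
  rwa [Complex.log_re, Real.log_lt_iff_lt_exp (norm_pos_iff.2 hw)]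

/-- Riemann's removable singularity theorem on the universal cover. -/
theorem mem_descends_of_periodic {ρ : ℝ} {ψ : ℂ → ℂ} (h1 : ψ ∈ holo ρ) (h2 : ψ ∈ integ)
    (h3 : shift ψ - ψ ∈ vanish ρ) : ψ ∈ descends ρ := by
  -- Periodicity makes the cut of the principal logarithm invisible: `g` is holomorphic on the whole
  -- punctured disc.
  set g : ℂ → ℂ := fun w => ψ (Complex.log w) with hg
  have hbd : ∀ w ∈ Metric.ball (0 : ℂ) (Real.exp ρ), w ≠ 0 → DifferentiableAt ℂ g w := by
    intro w hw hw0
    rw [mem_ball_zero_iff] at hw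
    by_cases hs : w ∈ Complex.slitPlane
    · refine DifferentiableAt.comp w ?_ (Complex.differentiableAt_log hs)
      exact h1.differentiableAt ((isOpen_re_lt ρ).mem_nhds (log_re_lt hw0 hw))
    · have hs' : -w ∈ Complex.slitPlane := by
        rcases Complex.mem_slitPlane_or_neg_mem_slitPlane hw0 with h | h
        · exact absurd h hs
        · exact h
      -- Across the negative axis `log (-v) + πi` is another logarithm of `v`, holomorphic there,
      -- and `ψ` does not distinguish the two.
      have hev : g =ᶠ[𝓝 w] fun v => ψ (Complex.log (-v) + Real.pi * Complex.I) := by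
        filter_upwards [isOpen_ne.mem_nhds hw0,
          (isOpen_lt continuous_norm continuous_const).mem_nhds hw] with v hv0 hv
        refine (eq_of_exp_eq_of_vanish h3 (log_re_lt hv0 hv) ?_).symm
        rw [Complex.exp_add, Complex.exp_log (neg_ne_zero.2 hv0), Complex.exp_pi_mul_I,
          Complex.exp_log hv0]
        ring
      refine DifferentiableAt.congr_of_eventuallyEq ?_ hev
      refine DifferentiableAt.comp w (g := ψ) (f := fun v => Complex.log (-v) + Real.pi * Complex.I)
        (h1.differentiableAt ((isOpen_re_lt ρ).mem_nhds ?_)) ?_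
      · have := log_re_lt (neg_ne_zero.2 hw0) (by rwa [norm_neg])
        simpa using this
      · exact (DifferentiableAt.clog (by fun_prop) hs').add_const _
  -- Integrability in the sector `|Im ζ| ≤ π` is precisely the growth condition `o(1/z)` of
  -- Riemann's theorem.
  have ho : (fun z => g z - g 0) =o[𝓝[≠] 0] fun z : ℂ => (z - 0)⁻¹ := by
    rw [Asymptotics.isLittleO_iff_tendsto']
    · have hlog : Tendsto Complex.log (𝓝[≠] (0 : ℂ)) (sectorFilter Real.pi) := by
        intro s hs
        obtain ⟨N, hN⟩ := eventually_sectorFilter.1 (show ∀ᶠ ζ in sectorFilter _, ζ ∈ s from hs)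
        refine eventually_nhdsWithin_iff.2 (Metric.eventually_nhds_iff.2
          ⟨Real.exp N, Real.exp_pos N, fun w hw hw0 => ?_⟩)
        refine hN _ (log_re_lt hw0 (by rwa [← dist_zero_right])) ?_
        rw [Complex.log_im]
        exact Complex.abs_arg_le_pi w
      have h5 := (h2 Real.pi).comp hlog
      have h6 : Tendsto (fun w : ℂ => w * g 0) (𝓝[≠] 0) (𝓝 0) := by
        have : Tendsto (fun w : ℂ => w * g 0) (𝓝 0) (𝓝 (0 * g 0)) :=
          (continuous_id.mul continuous_const).tendsto 0
        rw [zero_mul] at this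
        exact this.mono_left nhdsWithin_le_nhds
      have h7 := h5.sub h6
      rw [sub_zero] at h7
      refine h7.congr' ?_
      filter_upwards [self_mem_nhdsWithin] with w hw
      rw [Function.comp_apply, Complex.exp_log hw, sub_zero, div_inv_eq_mul]
      ring
    · filter_upwards [self_mem_nhdsWithin] with w hw h0
      exact absurd (inv_eq_zero.1 h0) (by simpa using hw)
  refine ⟨_, Complex.differentiableOn_update_limUnder_of_isLittleO
    (Metric.ball_mem_nhds _ (Real.exp_pos ρ))
    (fun w hw => (hbd w hw.1 hw.2).differentiableWithinAt) ho, fun ζ hζ => ?_⟩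
  rw [Function.update_of_ne (Complex.exp_ne_zero ζ)]
  refine eq_of_exp_eq_of_vanish h3 ?_ (Complex.exp_log (Complex.exp_ne_zero ζ)).symm
  exact log_re_lt (Complex.exp_ne_zero ζ) (norm_exp_lt hζ)

theorem strip_nonempty_isOpen (s : Side) (ρ : ℝ) :
    IsOpen (s.strip ∩ {ζ | ζ.re < ρ}) ∧ (s.strip ∩ {ζ | ζ.re < ρ}).Nonempty := by
  constructor
  · refine IsOpen.inter ?_ (isOpen_re_lt ρ)
    cases s with
    | left => exact (isOpen_lt continuous_const Complex.continuous_im).inter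
                (isOpen_lt Complex.continuous_im continuous_const)
    | right => exact (isOpen_lt continuous_const Complex.continuous_im).inter
                (isOpen_lt Complex.continuous_im continuous_const)
  · cases s with
    | left => exact ⟨⟨ρ - 1, Real.pi / 2⟩, ⟨by simp [Real.pi_pos], by simp [Real.pi_pos]⟩, by simp⟩
    | right =>
      refine ⟨⟨ρ - 1, 3 * Real.pi / 2⟩, ⟨?_, ?_⟩, by simp⟩ <;> simp only <;>
        linarith [Real.pi_pos]

/-- Identity theorem: the strip already determines the continuation. Hence the continuations that
witness integrability and recurrence may be identified near the puncture. -/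
theorem IsContinuationAround.eqOn {f : ℂ → ℂ} {s : Side} {α : ℂ} {ρ ρ' : ℝ} {φ φ' : ℂ → ℂ}
    (h : IsContinuationAround f s α ρ φ) (h' : IsContinuationAround f s α ρ' φ') :
    Set.EqOn φ φ' {ζ | ζ.re < min ρ ρ'} := by
  obtain ⟨ho, z₀, hz₀⟩ := strip_nonempty_isOpen s (min ρ ρ')
  refine eqOn_of_convex (convex_re_lt _) (isOpen_re_lt _) (holo_mono (min_le_left _ _) h.1)
    (holo_mono (min_le_right _ _) h'.1) hz₀.2 ?_
  filter_upwards [ho.mem_nhds hz₀] with ζ hζ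
  have h1 : ζ.re < min ρ ρ' := hζ.2
  rw [← h.2 ζ hζ.1 (h1.trans_le (min_le_left _ _)), h'.2 ζ hζ.1 (h1.trans_le (min_le_right _ _))]

/-! ### Translation between recurrences and annihilating polynomials. -/

/-- The characteristic polynomial of a linear recurrence. -/
noncomputable def recPoly {d : ℕ} (a : Fin d → ℂ) : ℂ[X] := X ^ d - ∑ k, C (a k) * X ^ (k : ℕ)

theorem degree_sum_lt {d : ℕ} (a : Fin d → ℂ) : (∑ k, C (a k) * X ^ (k : ℕ) : ℂ[X]).degree < d :=
  (degree_sum_le _ _).trans_lt ((Finset.sup_lt_iff (WithBot.bot_lt_coe d)).2 fun k _ =>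
    (degree_C_mul_X_pow_le _ _).trans_lt (Nat.cast_lt.2 k.2))

theorem recPoly_monic {d : ℕ} (a : Fin d → ℂ) : (recPoly a).Monic :=
  monic_X_pow_sub (degree_sum_lt a)

theorem recPoly_natDegree {d : ℕ} (a : Fin d → ℂ) : (recPoly a).natDegree = d := by
  refine natDegree_eq_of_degree_eq_some ?_
  rw [recPoly, degree_sub_eq_left_of_degree_lt, degree_X_pow]
  rw [degree_X_pow]
  exact degree_sum_lt a

theorem recPoly_eval_one {d : ℕ} (a : Fin d → ℂ) : (recPoly a).eval 1 = 1 - ∑ k, a k := by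
  simp [recPoly, eval_finsetSum]

theorem aeval_recPoly {d : ℕ} (a : Fin d → ℂ) (φ : ℂ → ℂ) :
    aeval shift (recPoly a) φ = monodromy^[d] φ - ∑ k : Fin d, a k • monodromy^[(k : ℕ)] φ := by
  simp [recPoly, LinearMap.sum_apply, Module.End.mul_apply, Module.algebraMap_end_apply,
    shift_pow_apply]

theorem mem_integ_of_mul {α : ℂ} (hα : α ≠ 0) {φ : ℂ → ℂ}
    (h : ∀ M : ℝ, Tendsto (fun ζ : ℂ => α * Complex.exp ζ * φ ζ) (sectorFilter M) (𝓝 0)) :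
    φ ∈ integ := fun M => by
  have := (h M).const_mul α⁻¹
  rw [mul_zero] at this
  refine this.congr fun ζ => ?_
  field_simp

/-- Integrability and recurrence come with continuations of their own. By uniqueness the one of the
recurrence has both properties, and the instance `m = 0` of the recurrence is the relation for the
characteristic polynomial. -/
theorem exists_continuation_of_recurrence {f : ℂ → ℂ} {s : Side} {α : ℂ} (hα : α ≠ 0)
    (hi : IntegrableAt f s α) {d : ℕ} {a : Fin d → ℂ} (hr : SatisfiesRecurrence f s α a) :
    ∃ ρ φ, φ ∈ holo ρ ∧
      (∀ ζ ∈ s.strip, ζ.re < ρ → f (α + α * Complex.exp ζ) = φ ζ) ∧ φ ∈ integ ∧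
      aeval shift (recPoly a) φ ∈ vanish ρ := by
  obtain ⟨ρ, φ, hφ, hint⟩ := hi
  obtain ⟨ρ', φ', hφ', hrec⟩ := hr
  refine ⟨ρ', φ', hφ'.1, hφ'.2, fun M => ?_, fun ζ hζ => ?_⟩
  · refine (mem_integ_of_mul hα hint M).congr' (eventually_sectorFilter.2
      ⟨min ρ ρ', fun ζ hζ _ => ?_⟩)
    rw [hφ.eqOn hφ' hζ]
  · have := hrec 0 hζ
    simp only [zero_add] at this
    rw [aeval_recPoly, Pi.sub_apply, this, sub_self]

theorem monodromyClass_of_recurrence {f : ℂ → ℂ} {s : Side} {α : ℂ} (hα : α ≠ 0)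
    (hi : IntegrableAt f s α) {d : ℕ} {a : Fin d → ℂ} (hr : SatisfiesRecurrence f s α a) :
    MonodromyClass (fun w => f (α + α * w)) s (recPoly a) := by
  obtain ⟨ρ, φ, h1, h2, h3, h4⟩ := exists_continuation_of_recurrence hα hi hr
  exact ⟨ρ, φ, h1, h2, h3, vanish_le_descends ρ h4⟩

/-- Since `1` is a root, the characteristic polynomial is `(X - 1) * Q`, so `Q(Σ)φ` is invariant
under `Σ`. Being integrable it is holomorphic at the centre, and the degree of the relation drops by
one. -/
theorem monodromyClass_of_recurrence_sum_eq_one {f : ℂ → ℂ} {s : Side} {α : ℂ} (hα : α ≠ 0)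
    (hi : IntegrableAt f s α) {d : ℕ} {a : Fin d → ℂ} (hr : SatisfiesRecurrence f s α a)
    (ha : ∑ k, a k = 1) : ∃ Q : ℂ[X], Q.Monic ∧ Q.natDegree + 1 = d ∧
      MonodromyClass (fun w => f (α + α * w)) s Q := by
  obtain ⟨ρ, φ, h1, h2, h3, h4⟩ := exists_continuation_of_recurrence hα hi hr
  obtain ⟨Q, hQ⟩ : X - C 1 ∣ recPoly a := dvd_iff_isRoot.2 (by
    rw [IsRoot, recPoly_eval_one, ha, sub_self])
  have hmon : Q.Monic := (monic_X_sub_C (1 : ℂ)).of_mul_monic_left (hQ ▸ recPoly_monic a)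
  refine ⟨Q, hmon, ?_, ρ, φ, h1, h2, h3, mem_descends_of_periodic
    (aeval_mem_of_invariant (fun _ => shift_mem_holo) Q h1)
    (aeval_mem_of_invariant (fun _ => shift_mem_integ) Q h3) ?_⟩
  · rw [← recPoly_natDegree a, hQ, (monic_X_sub_C (1 : ℂ)).natDegree_mul hmon, natDegree_X_sub_C,
      add_comm]
  · rw [hQ, map_mul, Module.End.mul_apply] at h4
    simpa using h4

theorem monodromyClass_of_regularAt {f : ℂ → ℂ} {s : Side} {p : ℂ} (h : RegularAt f s p) :
    MonodromyClass (fun w => f (p + p * w)) s 1 := by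
  obtain ⟨r, hr, g, hg, hfg⟩ := h
  exact .of_differentiableOn hr hg s fun w hw hw' => hfg w ⟨mem_ball_zero_iff.2 hw', hw⟩

theorem MonodromyClass.regularAt {f : ℂ → ℂ} {s : Side} {p : ℂ}
    (h : MonodromyClass (fun w => f (p + p * w)) s 1) : RegularAt f s p := by
  obtain ⟨r, hr, H, hH, hf⟩ := h.exists_differentiableOn
  exact ⟨r, hr, H, hH, fun w hw => hf w hw.2 (mem_ball_zero_iff.1 hw.1)⟩

/-- Multiplication by `X ^ m` keeps the relation; solving it for the leading term gives the
recurrence started at `m`. -/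
theorem recurrence_of_aeval_mem_vanish {ρ : ℝ} {φ : ℂ → ℂ} {R : ℂ[X]} (hR : R.Monic)
    (h : aeval shift R φ ∈ vanish ρ) (m : ℕ) :
    Set.EqOn (monodromy^[m + R.natDegree] φ)
      (∑ k : Fin R.natDegree, (-R.coeff k) • monodromy^[m + (k : ℕ)] φ) {ζ | ζ.re < ρ} := by
  intro ζ hζ
  have h1 : aeval shift (X ^ m * R) φ ∈ vanish ρ := by
    rw [map_mul, Module.End.mul_apply]
    exact aeval_mem_of_invariant (fun _ => shift_mem_vanish) _ h
  have h2 : aeval shift (X ^ m * R) φ =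
      ∑ i ∈ Finset.range (R.natDegree + 1), R.coeff i • monodromy^[m + i] φ := by
    conv_lhs => rw [R.as_sum_range' (R.natDegree + 1) (Nat.lt_succ_self _)]
    rw [Finset.mul_sum, map_sum, LinearMap.sum_apply]
    refine Finset.sum_congr rfl fun i _ => ?_
    rw [← C_mul_X_pow_eq_monomial, mul_left_comm, ← pow_add]
    simp [Module.End.mul_apply, Module.algebraMap_end_apply, shift_pow_apply]
  have h3 := h1 ζ hζ
  rw [h2, Finset.sum_range_succ, hR.coeff_natDegree, one_smul, Pi.add_apply,
    add_comm, ← eq_neg_iff_add_eq_zero] at h3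
  rw [h3, Finset.sum_range (fun i => R.coeff i • monodromy^[m + i] φ), ← Pi.neg_apply,
    ← Finset.sum_neg_distrib]
  simp only [neg_smul]

theorem MonodromyClass.exists_continuation {f : ℂ → ℂ} {s : Side} {α : ℂ} {Q : ℂ[X]}
    (h : MonodromyClass (fun w => f (α + α * w)) s Q) : ∃ ρ φ, IsContinuationAround f s α ρ φ := by
  obtain ⟨ρ, φ, h1, h2, -⟩ := h
  exact ⟨ρ, φ, h1, h2⟩

theorem MonodromyClass.integrableAt {f : ℂ → ℂ} {s : Side} {α : ℂ} {Q : ℂ[X]}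
    (h : MonodromyClass (fun w => f (α + α * w)) s Q) : IntegrableAt f s α := by
  obtain ⟨ρ, φ, h1, h2, h3, h4⟩ := h
  refine ⟨ρ, φ, ⟨h1, h2⟩, fun M => ?_⟩
  have := (h3 M).const_mul α
  rw [mul_zero] at this
  exact this.congr fun ζ => (mul_assoc _ _ _).symm

/-- The factor `X - 1` removes the holomorphic remainder, and a power of `X` pads the order up to
any larger `n`. -/
theorem MonodromyClass.recurrentOfOrder {f : ℂ → ℂ} {s : Side} {α : ℂ} {Q : ℂ[X]}
    (h : MonodromyClass (fun w => f (α + α * w)) s Q) (hQ : Q.Monic) {n : ℕ}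
    (hn : Q.natDegree + 1 ≤ n) : RecurrentOfOrder f s α n := by
  obtain ⟨ρ, φ, h1, h2, h3, h4⟩ := h
  obtain ⟨j, rfl⟩ := Nat.exists_eq_add_of_le hn
  set R : ℂ[X] := X ^ j * ((X - C 1) * Q) with hRdef
  have hmon : R.Monic := (monic_X_pow j).mul ((monic_X_sub_C 1).mul hQ)
  have hdeg : R.natDegree = Q.natDegree + 1 + j := by
    rw [hRdef, (monic_X_pow j).natDegree_mul ((monic_X_sub_C 1).mul hQ),
      (monic_X_sub_C (1 : ℂ)).natDegree_mul hQ, natDegree_X_pow, natDegree_X_sub_C]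
    ring
  have hv : aeval shift R φ ∈ vanish ρ := by
    rw [hRdef, map_mul, Module.End.mul_apply, map_mul, Module.End.mul_apply]
    refine aeval_mem_of_invariant (fun _ => shift_mem_vanish) _ ?_
    simpa using shift_sub_mem_vanish h4
  refine ⟨by omega, ?_⟩
  rw [← hdeg]
  exact ⟨_, ρ, φ, ⟨h1, h2⟩, recurrence_of_aeval_mem_vanish hmon hv⟩

/-! ### Linear algebra: relations for a product of two recurrences. -/

theorem aeval_charpoly_eq_zero {V ι : Type*} [AddCommGroup V] [Module ℂ V] [Fintype ι]
    [DecidableEq ι] {T : Module.End ℂ V} {x : ι → V} {A : Matrix ι ι ℂ}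
    (h : ∀ i, T (x i) = ∑ j, A i j • x j) (i : ι) : aeval T A.charpoly (x i) = 0 := by
  -- The family `x` need not be independent: Cayley–Hamilton is applied on the coordinate space and
  -- pushed forward by `L`. The transpose appears because `A` acts on rows.
  set L : (ι → ℂ) →ₗ[ℂ] V := Fintype.linearCombination ℂ x with hL
  have hT : ∀ v, L (Matrix.toLinAlgEquiv' A.transpose v) = T (L v) := fun v => by
    simp only [hL, Fintype.linearCombination_apply, map_sum, map_smul, h,
      Matrix.toLinAlgEquiv'_apply, Matrix.mulVec, dotProduct, Matrix.transpose_apply,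
      Finset.sum_smul, Finset.smul_sum, smul_smul]
    rw [Finset.sum_comm]
    simp only [mul_comm]
  have h1 := map_aeval_of_semiconj L hT A.charpoly (Pi.single i 1)
  have h2 : aeval (Matrix.toLinAlgEquiv' A.transpose) A.charpoly = 0 := by
    rw [aeval_algHom_apply, ← Matrix.charpoly_transpose, Matrix.aeval_self_charpoly, map_zero]
  rw [h2] at h1
  simpa [hL, Fintype.linearCombination_apply_single] using h1.symm

/-- The companion matrix of a monic polynomial, acting on rows. -/
noncomputable def companionMatrix (P : ℂ[X]) : Matrix (Fin P.natDegree) (Fin P.natDegree) ℂ :=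
  fun i k => if (i : ℕ) + 1 < P.natDegree then (if (k : ℕ) = i + 1 then 1 else 0) else -P.coeff k

/-- The monic polynomial whose roots are the products of the roots of `P` and of `R`. -/
noncomputable def tensorPoly (P R : ℂ[X]) : ℂ[X] :=
  (Matrix.kroneckerMap (· * ·) (companionMatrix P) (companionMatrix R)).charpoly

theorem tensorPoly_monic (P R : ℂ[X]) : (tensorPoly P R).Monic := Matrix.charpoly_monic _

theorem tensorPoly_natDegree (P R : ℂ[X]) :
    (tensorPoly P R).natDegree = P.natDegree * R.natDegree := by
  rw [tensorPoly, Matrix.charpoly_natDegree_eq_dim]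
  simp

/-- The matrix is empty if one degree is zero: a point where only one factor is singular leaves the
convolution regular. -/
theorem tensorPoly_eq_one {P R : ℂ[X]} (h : P = 1 ∨ R = 1) : tensorPoly P R = 1 := by
  refine (tensorPoly_monic P R).natDegree_eq_zero.1 ?_
  rw [tensorPoly_natDegree]
  rcases h with rfl | rfl <;> simp

theorem map_pow_succ_eq_sum {D V : Type*} [AddCommGroup D] [Module ℂ D] [AddCommGroup V]
    [Module ℂ V] {S : Module.End ℂ D} {P : ℂ[X]} (hP : P.Monic) {x : D} (L : D →ₗ[ℂ] V)
    (h : L (aeval S P x) = 0) (i : Fin P.natDegree) :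
    L ((S ^ ((i : ℕ) + 1)) x) = ∑ k, companionMatrix P i k • L ((S ^ (k : ℕ)) x) := by
  unfold companionMatrix
  split_ifs with hi
  · rw [Finset.sum_eq_single ⟨i + 1, hi⟩]
    · simp
    · intro k _ hk
      rw [if_neg fun h => hk (Fin.ext h), zero_smul]
    · simp
  · have hd : (i : ℕ) + 1 = P.natDegree := by omega
    rw [P.as_sum_range' (P.natDegree + 1) (Nat.lt_succ_self _), Finset.sum_range_succ,
      hP.coeff_natDegree] at h
    simp only [map_add, map_sum, LinearMap.add_apply, LinearMap.sum_apply, aeval_monomial,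
      Module.End.mul_apply, Module.algebraMap_end_apply, map_smul, map_one,
      Module.End.one_apply] at h
    rw [add_comm, ← eq_neg_iff_add_eq_zero] at h
    rw [hd, h, Finset.sum_range (fun k => P.coeff k • L ((S ^ k) x)), ← Finset.sum_neg_distrib]
    simp only [neg_smul]

/-- The vectors `β (Sⁱ x) (S'ʲ y)`, with `i` and `j` below the two degrees, are permuted linearly by
`T` through the Kronecker product of the companion matrices. The relations for `x` and `y` are
required only after application of `β`, because in the application they hold only modulo functions
holomorphic at `0`. -/
theorem aeval_tensorPoly {D D' V : Type*} [AddCommGroup D] [Module ℂ D] [AddCommGroup D']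
    [Module ℂ D'] [AddCommGroup V] [Module ℂ V] {S : Module.End ℂ D} {S' : Module.End ℂ D'}
    {T : Module.End ℂ V} (β : D →ₗ[ℂ] D' →ₗ[ℂ] V) (hβ : ∀ x y, T (β x y) = β (S x) (S' y))
    {P R : ℂ[X]} (hP : P.Monic) (hR : R.Monic) {x : D} {y : D'}
    (hx : ∀ y', β (aeval S P x) y' = 0) (hy : ∀ x', β x' (aeval S' R y) = 0) :
    aeval T (tensorPoly P R) (β x y) = 0 := by
  -- In degree zero there is no index `(0, 0)` at which to read off the result, but the monic
  -- polynomial is then `1` and `β x y` itself vanishes.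
  rcases Nat.eq_zero_or_pos P.natDegree with hP0 | hP0
  · have := hx y
    rw [hP.natDegree_eq_zero.1 hP0] at this
    rw [show β x y = 0 by simpa using this, map_zero]
  rcases Nat.eq_zero_or_pos R.natDegree with hR0 | hR0
  · have := hy x
    rw [hR.natDegree_eq_zero.1 hR0] at this
    rw [show β x y = 0 by simpa using this, map_zero]
  refine aeval_charpoly_eq_zero (T := T)
    (x := fun q : Fin P.natDegree × Fin R.natDegree => β ((S ^ (q.1 : ℕ)) x) ((S' ^ (q.2 : ℕ)) y))
    (A := Matrix.kroneckerMap (· * ·) (companionMatrix P) (companionMatrix R)) (fun q => ?_)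
    (⟨0, hP0⟩, ⟨0, hR0⟩)
  have h1 := map_pow_succ_eq_sum hP (β.flip ((S' ^ ((q.2 : ℕ) + 1)) y))
    (by simpa using hx _) q.1
  simp only [LinearMap.flip_apply] at h1
  rw [hβ, ← Module.End.mul_apply, ← Module.End.mul_apply, ← pow_succ', ← pow_succ', h1,
    Fintype.sum_prod_type]
  refine Finset.sum_congr rfl fun k _ => ?_
  rw [map_pow_succ_eq_sum hR (β ((S ^ (k : ℕ)) x)) (hy _) q.2, Finset.smul_sum]
  refine Finset.sum_congr rfl fun l _ => ?_
  rw [smul_smul, Matrix.kroneckerMap_apply]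

/-! ### The local convolution and the geometry of its path. -/

/-- The logarithm of `w - exp ζ`, `w = exp ω`, in the region where `exp ω` is small compared with
`exp ζ`; here `exp c = -1`. -/
noncomputable def coLog (c ω ζ : ℂ) : ℂ := ζ + c + Complex.log (1 - Complex.exp (ω - ζ))

/-- The integrand of the local convolution on the arms of its path. -/
noncomputable def armKernel (φ ψ : ℂ → ℂ) (c ω ζ : ℂ) : ℂ :=
  φ ζ * ψ (coLog c ω ζ) * Complex.exp ζ

/-- The integral along an arm, from the fixed end point `E` to `ω + ξ`. -/
noncomputable def arm (φ ψ : ℂ → ℂ) (c E ξ ω : ℂ) : ℂ :=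
  segInt (armKernel φ ψ c ω) E (ω + ξ)

/-- The integral along the part of the path between `0` and `w` that scales with `w`. -/
noncomputable def bridge (φ ψ : ℂ → ℂ) (ω : ℂ) : ℂ :=
  ∫ t in (-2 : ℝ)..2, φ (ω + Complex.log (1 / 2 + t * Complex.I)) *
    ψ (ω + Complex.log (1 / 2 - t * Complex.I)) * (Complex.exp ω * Complex.I)

/-- The logarithm of the junction `1/2 + 2i` of arm and bridge. -/
noncomputable def junction : ℂ := Complex.log (1 / 2 + 2 * Complex.I)

/-- The local convolution `∫ φ(log v) ψ(log (w - v)) dv`, `w = exp ω`, along a path from `-l₁` to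
`l₂` that passes between the singularities `0` and `w`, for `ω` in the universal cover. -/
noncomputable def localConv (l₁ l₂ : ℝ) (φ ψ : ℂ → ℂ) (ω : ℂ) : ℂ :=
  arm φ ψ (-(Real.pi * Complex.I)) (Real.log l₁ + Real.pi * Complex.I) junction ω -
    bridge φ ψ ω -
    arm φ ψ (Real.pi * Complex.I) (Real.log l₂) ((starRingEnd ℂ) junction) ω

theorem norm_exp_sub_lt_half {ω ζ : ℂ} (h : ω.re + Real.log 2 < ζ.re) :
    ‖Complex.exp (ω - ζ)‖ < 1 / 2 := by
  rw [Complex.norm_exp, Complex.sub_re, ← Real.exp_log (show (0 : ℝ) < 1 / 2 by norm_num),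
    Real.exp_lt_exp, one_div, Real.log_inv]
  linarith

theorem half_lt_re_one_sub {u : ℂ} (h : ‖u‖ < 1 / 2) : 1 / 2 < (1 - u).re := by
  have := (Complex.re_le_norm u).trans_lt h
  rw [Complex.sub_re, Complex.one_re]; linarith

theorem one_sub_mem_slitPlane {u : ℂ} (h : ‖u‖ < 1 / 2) : 1 - u ∈ Complex.slitPlane :=
  Or.inl (by linarith [half_lt_re_one_sub h])

theorem log_one_sub_re_lt {u : ℂ} (h : ‖u‖ < 1 / 2) : (Complex.log (1 - u)).re < 1 / 2 := by
  have h0 : 0 < ‖1 - u‖ := norm_pos_iff.2 (Complex.slitPlane_ne_zero (one_sub_mem_slitPlane h))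
  rw [Complex.log_re]
  have := norm_sub_le 1 u
  rw [norm_one] at this
  linarith [Real.log_le_sub_one_of_pos h0]

theorem abs_log_one_sub_im_lt {u : ℂ} (h : ‖u‖ < 1 / 2) :
    |(Complex.log (1 - u)).im| < Real.pi / 2 := by
  rw [Complex.log_im]
  exact Complex.abs_arg_lt_pi_div_two_iff.2 (Or.inl (by linarith [half_lt_re_one_sub h]))

theorem coLog_re_lt {c ω ζ : ℂ} (hc : c.re = 0) (h : ω.re + Real.log 2 < ζ.re) :
    (coLog c ω ζ).re < ζ.re + 1 / 2 := by
  rw [coLog, Complex.add_re, Complex.add_re, hc]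
  linarith [log_one_sub_re_lt (norm_exp_sub_lt_half h)]

theorem exp_coLog {c ω ζ : ℂ} (hc : Complex.exp c = -1) (h : ω.re + Real.log 2 < ζ.re) :
    Complex.exp (coLog c ω ζ) = Complex.exp ω - Complex.exp ζ := by
  rw [coLog, Complex.exp_add, Complex.exp_add, hc, Complex.exp_log
    (Complex.slitPlane_ne_zero (one_sub_mem_slitPlane (norm_exp_sub_lt_half h))), Complex.exp_sub]
  field_simp [Complex.exp_ne_zero]
  ring

/-- The modulus `√17 / 2` lies between `2` and `e`. Above `2`, the logarithm of `1 - exp (ω - ζ)` is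
available on the arms; below `e`, the bridge costs less than `1` in the real part. -/
theorem junction_norm_sq : ‖(1 / 2 + 2 * Complex.I : ℂ)‖ ^ 2 = 17 / 4 := by
  rw [← Complex.normSq_eq_norm_sq, Complex.normSq_apply]
  norm_num [Complex.div_re, Complex.div_im]

theorem junction_re_lt : junction.re < 1 := by
  have h0 : 0 < ‖(1 / 2 + 2 * Complex.I : ℂ)‖ := by
    by_contra! h
    nlinarith [junction_norm_sq, norm_nonneg (1 / 2 + 2 * Complex.I : ℂ)]
  rw [junction, Complex.log_re, Real.log_lt_iff_lt_exp h0]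
  have := Real.exp_one_gt_d9
  nlinarith [junction_norm_sq]

theorem log_two_lt_junction_re : Real.log 2 < junction.re := by
  rw [junction, Complex.log_re]
  refine Real.log_lt_log (by norm_num) ?_
  nlinarith [junction_norm_sq, norm_nonneg (1 / 2 + 2 * Complex.I : ℂ)]

theorem log_two_lt_one : Real.log 2 < 1 := by
  linarith [Real.log_two_lt_d9]

theorem junction_conj_re : ((starRingEnd ℂ) junction).re = junction.re := Complex.conj_re _

theorem half_add_mem_slitPlane (t : ℝ) : (1 / 2 + t * Complex.I : ℂ) ∈ Complex.slitPlane := by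
  left
  simp

theorem half_sub_mem_slitPlane (t : ℝ) : (1 / 2 - t * Complex.I : ℂ) ∈ Complex.slitPlane := by
  left
  simp

theorem conj_half_add (t : ℝ) :
    (starRingEnd ℂ) (1 / 2 + t * Complex.I : ℂ) = 1 / 2 - t * Complex.I := by
  apply Complex.ext <;> simp

theorem log_half_sub (t : ℝ) : Complex.log (1 / 2 - t * Complex.I) =
    (starRingEnd ℂ) (Complex.log (1 / 2 + t * Complex.I)) := by
  rw [← conj_half_add, Complex.log_conj]
  intro h
  have := Complex.arg_eq_pi_iff.1 h
  simp at this
  linarith [this.1]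

theorem log_half_sub_two : Complex.log (1 / 2 - 2 * Complex.I) = (starRingEnd ℂ) junction := by
  exact_mod_cast log_half_sub 2

theorem log_half_add_re_lt {t : ℝ} (ht : t ∈ Set.Icc (-2 : ℝ) 2) :
    (Complex.log (1 / 2 + t * Complex.I)).re < 1 := by
  refine lt_of_le_of_lt ?_ junction_re_lt
  rw [junction, Complex.log_re, Complex.log_re]
  refine Real.log_le_log
    (norm_pos_iff.2 (Complex.slitPlane_ne_zero (half_add_mem_slitPlane t))) ?_
  rw [← sq_le_sq₀ (norm_nonneg _) (norm_nonneg _), junction_norm_sq, ← Complex.normSq_eq_norm_sq,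
    Complex.normSq_apply]
  norm_num [Complex.div_re, Complex.div_im]
  nlinarith [ht.1, ht.2]

theorem log_half_sub_re_lt {t : ℝ} (ht : t ∈ Set.Icc (-2 : ℝ) 2) :
    (Complex.log (1 / 2 - t * Complex.I)).re < 1 := by
  rw [log_half_sub, Complex.conj_re]
  exact log_half_add_re_lt ht

/-- The arms meet the bridge: both determinations of `log (w - v)` agree at the junctions. -/
theorem coLog_junction (ω : ℂ) :
    coLog (-(Real.pi * Complex.I)) ω (ω + junction) = ω + (starRingEnd ℂ) junction := by
  have hre : ω.re + Real.log 2 < (ω + junction).re := by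
    rw [Complex.add_re]; linarith [log_two_lt_junction_re]
  have hy : (1 / 2 + 2 * Complex.I : ℂ) ≠ 0 := by
    have := Complex.slitPlane_ne_zero (half_add_mem_slitPlane 2)
    exact_mod_cast this
  have hj : Complex.exp junction = 1 / 2 + 2 * Complex.I := Complex.exp_log hy
  have he : Complex.exp (ω - (ω + junction)) = (1 / 2 + 2 * Complex.I)⁻¹ := by
    rw [sub_add_cancel_left, Complex.exp_neg, hj]
  have hexp : Complex.exp (coLog (-(Real.pi * Complex.I)) ω (ω + junction) - ω) =
      1 / 2 - 2 * Complex.I := by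
    rw [Complex.exp_sub, exp_coLog (by rw [Complex.exp_neg, Complex.exp_pi_mul_I]; norm_num) hre,
      Complex.exp_add, hj]
    field_simp [Complex.exp_ne_zero]
    ring
  have hJ : 0 < junction.im ∧ junction.im ≤ Real.pi / 2 := by
    rw [junction, Complex.log_im]
    constructor
    · refine lt_of_le_of_ne (Complex.arg_nonneg_iff.2 (by simp)) fun h => ?_
      have := (Complex.arg_eq_zero_iff.1 h.symm).2
      simp at this
    · exact (abs_le.1 (Complex.abs_arg_le_pi_div_two_iff.2 (by simp))).2
  have hlog : 0 ≤ (Complex.log (1 - Complex.exp (ω - (ω + junction)))).im := by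
    rw [he, Complex.log_im]
    refine Complex.arg_nonneg_iff.2 ?_
    rw [Complex.sub_im, Complex.inv_im]
    have : (0 : ℝ) ≤ 2 / Complex.normSq (1 / 2 + 2 * Complex.I) :=
      div_nonneg (by norm_num) (Complex.normSq_nonneg _)
    simpa [neg_div] using this
  have hlog2 := (abs_lt.1 (abs_log_one_sub_im_lt (norm_exp_sub_lt_half hre))).2
  -- Both sides, minus `ω`, are logarithms of `1/2 - 2i`. It remains to check that the imaginary
  -- part on the left lies in `(-π, π]`.
  have hkey := Complex.log_exp
    (x := coLog (-(Real.pi * Complex.I)) ω (ω + junction) - ω) ?_ ?_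
  · rw [hexp, log_half_sub_two] at hkey
    rw [hkey]; ring
  · simp only [coLog, Complex.sub_im, Complex.add_im, Complex.neg_im, Complex.mul_I_im,
      Complex.ofReal_re] at hlog hlog2 ⊢
    linarith [hJ.1]
  · simp only [coLog, Complex.sub_im, Complex.add_im, Complex.neg_im, Complex.mul_I_im,
      Complex.ofReal_re] at hlog hlog2 ⊢
    linarith [hJ.2, Real.pi_pos]

theorem conj_coLog {c ω ζ : ℂ} (h : ω.re + Real.log 2 < ζ.re) :
    (starRingEnd ℂ) (coLog c ω ζ) =
      coLog ((starRingEnd ℂ) c) ((starRingEnd ℂ) ω) ((starRingEnd ℂ) ζ) := by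
  rw [coLog, coLog, map_add, map_add, ← Complex.log_conj, map_sub, map_one, ← Complex.exp_conj,
    map_sub]
  exact (Complex.mem_slitPlane_iff_arg.1 (one_sub_mem_slitPlane (norm_exp_sub_lt_half h))).1

/-- The lower junction is the complex conjugate of the upper one. -/
theorem coLog_conj_junction (ω : ℂ) :
    coLog (Real.pi * Complex.I) ω (ω + (starRingEnd ℂ) junction) = ω + junction := by
  have h := congrArg (starRingEnd ℂ) (coLog_junction ((starRingEnd ℂ) ω))
  rw [conj_coLog] at h
  · simpa using h
  · rw [Complex.add_re]; linarith [log_two_lt_junction_re]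

/-! ### Holomorphy of the local convolution. -/

/-- The region in which the kernel of an arm is holomorphic. -/
def armRegion (ρ : ℝ) : Set (ℂ × ℂ) := {q | q.1.re + Real.log 2 < q.2.re ∧ q.2.re < ρ - 1}

theorem differentiableOn_coLog (c : ℂ) (ρ : ℝ) :
    DifferentiableOn ℂ (fun q : ℂ × ℂ => coLog c q.1 q.2) (armRegion ρ) := by
  unfold coLog
  refine DifferentiableOn.add (by fun_prop) (DifferentiableOn.clog (by fun_prop) fun q hq => ?_)
  exact one_sub_mem_slitPlane (norm_exp_sub_lt_half hq.1)

theorem differentiableOn_armKernel {ρ : ℝ} {φ ψ : ℂ → ℂ} (hφ : φ ∈ holo ρ) (hψ : ψ ∈ holo ρ)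
    {c : ℂ} (hc : c.re = 0) :
    DifferentiableOn ℂ (fun q : ℂ × ℂ => armKernel φ ψ c q.1 q.2) (armRegion ρ) := by
  refine (DifferentiableOn.mul ?_ ?_).mul (by fun_prop)
  · exact DifferentiableOn.comp (t := {ζ | ζ.re < ρ}) (f := Prod.snd) hφ (by fun_prop)
      fun q hq => by have := hq.2; simp only [Set.mem_ofPred_eq]; linarith
  · exact DifferentiableOn.comp (t := {ζ | ζ.re < ρ}) (f := fun q : ℂ × ℂ => coLog c q.1 q.2) hψ
      (differentiableOn_coLog c ρ) fun q hq => by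
        have := hq.2
        have := coLog_re_lt hc hq.1
        simp only [Set.mem_ofPred_eq]
        linarith

theorem convex_armStrip (ω : ℂ) (ρ : ℝ) :
    Convex ℝ {ζ : ℂ | ω.re + Real.log 2 < ζ.re ∧ ζ.re < ρ - 1} :=
  (convex_halfSpace_re_gt _).inter (convex_halfSpace_re_lt _)

theorem isOpen_armStrip (ω : ℂ) (ρ : ℝ) :
    IsOpen {ζ : ℂ | ω.re + Real.log 2 < ζ.re ∧ ζ.re < ρ - 1} :=
  (isOpen_lt continuous_const Complex.continuous_re).inter
    (isOpen_lt Complex.continuous_re continuous_const)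

theorem differentiableOn_armKernel_right {ρ : ℝ} {φ ψ : ℂ → ℂ} (hφ : φ ∈ holo ρ)
    (hψ : ψ ∈ holo ρ) {c : ℂ} (hc : c.re = 0) (ω : ℂ) :
    DifferentiableOn ℂ (armKernel φ ψ c ω)
      {ζ : ℂ | ω.re + Real.log 2 < ζ.re ∧ ζ.re < ρ - 1} :=
  (differentiableOn_armKernel hφ hψ hc).comp (f := fun ζ => (ω, ζ)) (by fun_prop) fun _ hζ => hζ

theorem arm_start_mem {ρ : ℝ} {E ω : ℂ} (hE : E.re < ρ - 1) (hω : ω.re < E.re - 1) :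
    E ∈ {ζ : ℂ | ω.re + Real.log 2 < ζ.re ∧ ζ.re < ρ - 1} :=
  ⟨by linarith [log_two_lt_one], hE⟩

theorem arm_end_mem {ρ : ℝ} {E ω ξ : ℂ} (hE : E.re < ρ - 1) (hω : ω.re < E.re - 1)
    (hξ : ξ.re = junction.re) :
    ω + ξ ∈ {ζ : ℂ | ω.re + Real.log 2 < ζ.re ∧ ζ.re < ρ - 1} := by
  constructor <;> rw [Complex.add_re, hξ] <;> linarith [log_two_lt_junction_re, junction_re_lt]

theorem arm_mem_holo {ρ : ℝ} {φ ψ : ℂ → ℂ} (hφ : φ ∈ holo ρ) (hψ : ψ ∈ holo ρ) {c E ξ : ℂ}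
    (hc : c.re = 0) (hE : E.re < ρ - 1) (hξ : ξ.re = junction.re) :
    arm φ ψ c E ξ ∈ holo (E.re - 1) := by
  refine differentiableOn_segInt (isOpen_re_lt _) (differentiableOn_armKernel hφ hψ hc)
    (a := fun _ => E) (b := fun ω => ω + ξ) (by fun_prop) (by fun_prop) fun ω hω t ht => ?_
  exact add_mul_sub_mem (convex_armStrip ω ρ) (arm_start_mem hE hω) (arm_end_mem hE hω hξ) ht

theorem bridge_mem_holo {ρ : ℝ} {φ ψ : ℂ → ℂ} (hφ : φ ∈ holo ρ) (hψ : ψ ∈ holo ρ) :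
    bridge φ ψ ∈ holo (ρ - 1) := by
  have hl1 : ContinuousOn (fun q : ℝ × ℂ => q.2 + Complex.log (1 / 2 + q.1 * Complex.I))
      (Set.Icc (-2) 2 ×ˢ {ζ | ζ.re < ρ - 1}) :=
    continuousOn_snd.add (ContinuousOn.clog (by fun_prop) fun q _ => half_add_mem_slitPlane q.1)
  have hl2 : ContinuousOn (fun q : ℝ × ℂ => q.2 + Complex.log (1 / 2 - q.1 * Complex.I))
      (Set.Icc (-2) 2 ×ˢ {ζ | ζ.re < ρ - 1}) :=
    continuousOn_snd.add (ContinuousOn.clog (by fun_prop) fun q _ => half_sub_mem_slitPlane q.1)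
  have hm1 : ∀ t ∈ Set.Icc (-2 : ℝ) 2, ∀ ω : ℂ, ω.re < ρ - 1 →
      (ω + Complex.log (1 / 2 + t * Complex.I)).re < ρ := fun t ht ω hω => by
    rw [Complex.add_re]; linarith [log_half_add_re_lt ht]
  have hm2 : ∀ t ∈ Set.Icc (-2 : ℝ) 2, ∀ ω : ℂ, ω.re < ρ - 1 →
      (ω + Complex.log (1 / 2 - t * Complex.I)).re < ρ := fun t ht ω hω => by
    rw [Complex.add_re]; linarith [log_half_sub_re_lt ht]
  refine differentiableOn_integral (isOpen_re_lt _) (by norm_num) ?_ fun t ht => ?_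
  · refine ((hφ.continuousOn.comp hl1 fun q hq => hm1 _ hq.1 _ hq.2).mul
      (hψ.continuousOn.comp hl2 fun q hq => hm2 _ hq.1 _ hq.2)).mul ?_
    exact Continuous.continuousOn (by fun_prop)
  · refine DifferentiableOn.mul (DifferentiableOn.mul ?_ ?_) (by fun_prop)
    · exact DifferentiableOn.comp (t := {ζ | ζ.re < ρ})
        (f := fun ω => ω + Complex.log (1 / 2 + t * Complex.I)) hφ (by fun_prop) (hm1 t ht)
    · exact DifferentiableOn.comp (t := {ζ | ζ.re < ρ})
        (f := fun ω => ω + Complex.log (1 / 2 - t * Complex.I)) hψ (by fun_prop) (hm2 t ht)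

theorem ofReal_add_pi_re (x : ℝ) : ((x : ℂ) + Real.pi * Complex.I).re = x := by simp

theorem pi_I_re : (Real.pi * Complex.I : ℂ).re = 0 := by simp

theorem neg_pi_I_re : (-(Real.pi * Complex.I) : ℂ).re = 0 := by simp

theorem exp_neg_pi_I : Complex.exp (-(Real.pi * Complex.I)) = -1 := by
  rw [Complex.exp_neg, Complex.exp_pi_mul_I]; norm_num

theorem localConv_mem_holo {ρ μ l₁ l₂ : ℝ} {φ ψ : ℂ → ℂ} (hφ : φ ∈ holo ρ) (hψ : ψ ∈ holo ρ)
    (h1 : Real.log l₁ < ρ - 1) (h2 : Real.log l₂ < ρ - 1) (hμ1 : μ ≤ Real.log l₁ - 1)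
    (hμ2 : μ ≤ Real.log l₂ - 1) : localConv l₁ l₂ φ ψ ∈ holo μ := by
  have a1 := arm_mem_holo (E := Real.log l₁ + Real.pi * Complex.I) (ξ := junction) hφ hψ
    neg_pi_I_re (by rwa [ofReal_add_pi_re]) rfl
  have a2 := arm_mem_holo (E := Real.log l₂) (ξ := (starRingEnd ℂ) junction) hφ hψ
    pi_I_re (by rwa [Complex.ofReal_re]) junction_conj_re
  rw [ofReal_add_pi_re] at a1
  rw [Complex.ofReal_re] at a2
  exact (holo μ).sub_mem ((holo μ).sub_mem (holo_mono hμ1 a1)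
    (holo_mono (by linarith) (bridge_mem_holo hφ hψ))) (holo_mono hμ2 a2)

/-! ### Monodromy of the local convolution. -/

theorem armKernel_shift (φ ψ : ℂ → ℂ) (c ω ζ : ℂ) :
    armKernel φ ψ c ω (ζ + 2 * Real.pi * Complex.I) =
      armKernel (shift φ) (shift ψ) c ω ζ := by
  have h : Complex.exp (ω - (ζ + 2 * Real.pi * Complex.I)) = Complex.exp (ω - ζ) := by
    rw [← exp_add_two_pi]; congr 1; ring
  simp only [armKernel, coLog, shift_apply, exp_add_two_pi, h]
  congr 3
  ring

theorem armKernel_shift_left (φ ψ : ℂ → ℂ) (c ω ζ : ℂ) :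
    armKernel φ ψ c (ω + 2 * Real.pi * Complex.I) ζ = armKernel φ ψ c ω ζ := by
  have h : Complex.exp (ω + 2 * Real.pi * Complex.I - ζ) = Complex.exp (ω - ζ) := by
    rw [← exp_add_two_pi (ω - ζ)]; congr 1; ring
  simp only [armKernel, coLog, h]

/-- One turn of `ω` leaves the kernel unchanged and moves the free end of the arm by `2πi`. Routing
the new arm through `E + 2πi` splits it into the arm of the shifted functions and the loop from `E`
to `E + 2πi`. On the loop `|exp ζ| = exp (Re E)` is large compared with `w`, so its integral is
holomorphic in `w` at `0`. -/
theorem arm_shift_sub_mem_descends {ρ : ℝ} {φ ψ : ℂ → ℂ} (hφ : φ ∈ holo ρ) (hψ : ψ ∈ holo ρ)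
    {c E ξ : ℂ} (hc : c.re = 0) (hE : E.re < ρ - 1) (hξ : ξ.re = junction.re) :
    shift (arm φ ψ c E ξ) - arm (shift φ) (shift ψ) c E ξ ∈ descends (E.re - 1) := by
  set D : Set (ℂ × ℂ) := {q | ‖q.1 * Complex.exp (-q.2)‖ < 1 / 2 ∧ q.2.re < ρ - 1} with hD
  refine ⟨fun w => segInt (fun ζ => φ ζ * ψ (ζ + c + Complex.log (1 - w * Complex.exp (-ζ))) *
    Complex.exp ζ) E (E + 2 * Real.pi * Complex.I), ?_, fun ω hω => ?_⟩
  · refine differentiableOn_segInt Metric.isOpen_ball (D := D) (Φ := fun q => φ q.2 *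
      ψ (q.2 + c + Complex.log (1 - q.1 * Complex.exp (-q.2))) * Complex.exp q.2) ?_
      (by fun_prop) (by fun_prop) fun w hw t ht => ?_
    · refine (DifferentiableOn.mul ?_ ?_).mul (by fun_prop)
      · exact DifferentiableOn.comp (t := {ζ | ζ.re < ρ}) (f := Prod.snd) hφ (by fun_prop)
          fun q hq => by have := hq.2; simp only [Set.mem_ofPred_eq]; linarith
      · refine DifferentiableOn.comp (t := {ζ | ζ.re < ρ}) (f := fun q : ℂ × ℂ =>
          q.2 + c + Complex.log (1 - q.1 * Complex.exp (-q.2))) hψ ?_ fun q hq => ?_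
        · exact DifferentiableOn.add (by fun_prop) (DifferentiableOn.clog (by fun_prop)
            fun q hq => one_sub_mem_slitPlane hq.1)
        · have h1 := log_one_sub_re_lt hq.1
          have h2 := hq.2
          simp only [Set.mem_ofPred_eq, Complex.add_re, hc]
          linarith
    · have hre : (E + t * (E + 2 * Real.pi * Complex.I - E)).re = E.re := by
        simp
      refine ⟨?_, by simpa only [hre] using hE⟩
      rw [mem_ball_zero_iff] at hw
      simp only
      rw [norm_mul, Complex.norm_exp, Complex.neg_re, hre]
      calc ‖w‖ * Real.exp (-E.re) < Real.exp (E.re - 1) * Real.exp (-E.re) := by gcongr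
        _ = (Real.exp 1)⁻¹ := by rw [← Real.exp_add, ← Real.exp_neg]; congr 1; ring
        _ ≤ 1 / 2 := by
          rw [inv_le_comm₀ (Real.exp_pos 1) (by norm_num)]
          have := Real.exp_one_gt_d9
          norm_num
          linarith
  · have hs := arm_start_mem hE hω
    have he := arm_end_mem hE hω hξ
    rw [Pi.sub_apply, shift_apply, arm, arm, sub_eq_iff_eq_add]
    have h1 : armKernel φ ψ c (ω + 2 * Real.pi * Complex.I) = armKernel φ ψ c ω :=
      funext fun ζ => armKernel_shift_left φ ψ c ω ζ
    have h2 : armKernel (shift φ) (shift ψ) c ω =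
        fun ζ => armKernel φ ψ c ω (ζ + 2 * Real.pi * Complex.I) :=
      funext fun ζ => (armKernel_shift φ ψ c ω ζ).symm
    rw [h1, h2, segInt_comp_add, add_right_comm ω,
      ← segInt_add (convex_armStrip ω ρ) (isOpen_armStrip ω ρ)
      (differentiableOn_armKernel_right hφ hψ hc ω) hs (b := E + 2 * Real.pi * Complex.I)
      (by simpa using hs) (by simpa using he)]
    congr 2
    ext ζ
    simp only [armKernel, coLog]
    rw [← Complex.exp_add, sub_eq_add_neg ω ζ]

/-- The bridge scales with `w`, so a turn of `w` turns both arguments and nothing is left over. -/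
theorem bridge_shift (φ ψ : ℂ → ℂ) : shift (bridge φ ψ) = bridge (shift φ) (shift ψ) := by
  ext ω
  simp only [shift_apply, bridge, exp_add_two_pi]
  congr 1
  ext t
  congr 3 <;> ring

/-- The local convolution intertwines the monodromies, up to functions holomorphic at `0`. -/
theorem localConv_shift_sub_mem_descends {ρ μ l₁ l₂ : ℝ} {φ ψ : ℂ → ℂ} (hφ : φ ∈ holo ρ)
    (hψ : ψ ∈ holo ρ) (h1 : Real.log l₁ < ρ - 1) (h2 : Real.log l₂ < ρ - 1)
    (hμ1 : μ ≤ Real.log l₁ - 1) (hμ2 : μ ≤ Real.log l₂ - 1) :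
    shift (localConv l₁ l₂ φ ψ) - localConv l₁ l₂ (shift φ) (shift ψ) ∈ descends μ := by
  have a1 := arm_shift_sub_mem_descends (E := Real.log l₁ + Real.pi * Complex.I) (ξ := junction)
    hφ hψ neg_pi_I_re (by rwa [ofReal_add_pi_re]) rfl
  have a2 := arm_shift_sub_mem_descends (E := Real.log l₂) (ξ := (starRingEnd ℂ) junction) hφ hψ
    pi_I_re (by rwa [Complex.ofReal_re]) junction_conj_re
  rw [ofReal_add_pi_re] at a1
  rw [Complex.ofReal_re] at a2
  have := (descends μ).sub_mem (descends_mono hμ1 a1) (descends_mono hμ2 a2)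
  convert this using 1
  have hb := bridge_shift φ ψ
  ext ω
  have hbω := congrFun hb ω
  simp only [shift_apply, Pi.sub_apply, localConv] at hbω ⊢
  rw [hbω]
  ring

/-! ### Local convolutions with one holomorphic factor. -/

theorem hasDerivAt_log_half_add (ω : ℂ) (t : ℝ) :
    HasDerivAt (fun t : ℝ => ω + Complex.log (1 / 2 + t * Complex.I))
      (Complex.I / (1 / 2 + t * Complex.I)) t := by
  have h : HasDerivAt (fun t : ℝ => (1 / 2 + t * Complex.I : ℂ)) Complex.I t := by
    have : HasDerivAt (fun t : ℝ => (t : ℂ)) 1 t := Complex.ofRealCLM.hasDerivAt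
    simpa using (this.mul_const Complex.I).const_add (1 / 2 : ℂ)
  exact (h.clog_real (half_add_mem_slitPlane t)).const_add ω

theorem hasDerivAt_log_half_sub (ω : ℂ) (t : ℝ) :
    HasDerivAt (fun t : ℝ => ω + Complex.log (1 / 2 - t * Complex.I))
      (-Complex.I / (1 / 2 - t * Complex.I)) t := by
  have h : HasDerivAt (fun t : ℝ => (1 / 2 - t * Complex.I : ℂ)) (-Complex.I) t := by
    have : HasDerivAt (fun t : ℝ => (t : ℂ)) 1 t := Complex.ofRealCLM.hasDerivAt
    simpa using (this.mul_const Complex.I).const_sub (1 / 2 : ℂ)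
  exact (h.clog_real (half_sub_mem_slitPlane t)).const_add ω

theorem exp_log_half_add (ω : ℂ) (t : ℝ) :
    Complex.exp (ω + Complex.log (1 / 2 + t * Complex.I)) =
      Complex.exp ω * (1 / 2 + t * Complex.I) := by
  rw [Complex.exp_add, Complex.exp_log (Complex.slitPlane_ne_zero (half_add_mem_slitPlane t))]

theorem exp_log_half_sub (ω : ℂ) (t : ℝ) :
    Complex.exp (ω + Complex.log (1 / 2 - t * Complex.I)) =
      Complex.exp ω * (1 / 2 - t * Complex.I) := by
  rw [Complex.exp_add, Complex.exp_log (Complex.slitPlane_ne_zero (half_sub_mem_slitPlane t))]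

/-- Numerically `e⁻² + e^(-1/2) < 1`. It keeps `w - exp ζ` inside the disc of the holomorphic
factor. -/
theorem exp_lt_sum {ρ μ : ℝ} (h : μ ≤ ρ - 2) :
    Real.exp μ + Real.exp (ρ - 1 / 2) < Real.exp ρ := by
  have h1 : Real.exp μ ≤ Real.exp ρ * (Real.exp 1)⁻¹ ^ 2 := by
    rw [← Real.exp_neg, ← Real.exp_nat_mul, ← Real.exp_add]
    exact Real.exp_le_exp.2 (by push_cast; linarith)
  have h2 : Real.exp (ρ - 1 / 2) = Real.exp ρ * Real.exp (-(1 / 2)) := by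
    rw [← Real.exp_add]; congr 1
  have h3 : Real.exp (-(1 / 2)) ^ 2 = (Real.exp 1)⁻¹ := by
    rw [← Real.exp_nat_mul, ← Real.exp_neg]; norm_num
  have h4 : (Real.exp 1)⁻¹ < 0.36788 + 0.00001 := by
    rw [inv_lt_comm₀ (Real.exp_pos 1) (by norm_num)]
    refine lt_trans ?_ Real.exp_one_gt_d9
    norm_num
  have h5 : 0 < (Real.exp 1)⁻¹ := by positivity
  have h6 : Real.exp (-(1 / 2)) < 0.62 := by
    by_contra! h
    nlinarith
  rw [h2]
  have h7 : (Real.exp 1)⁻¹ ^ 2 < 0.2 := by nlinarith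
  nlinarith [Real.exp_pos ρ]

theorem norm_sub_exp_lt {ρ μ : ℝ} (h : μ ≤ ρ - 2) {w ζ : ℂ} (hw : ‖w‖ < Real.exp μ)
    (hζ : ζ.re < ρ - 1 / 2) : w - Complex.exp ζ ∈ Metric.ball (0 : ℂ) (Real.exp ρ) := by
  rw [mem_ball_zero_iff]
  linarith [norm_sub_le w (Complex.exp ζ), norm_exp_lt hζ, exp_lt_sum h]

/-- If the second factor is holomorphic at `0`, so is the local convolution. -/
theorem localConv_mem_descends_right {ρ μ l₁ l₂ : ℝ} {φ ψ : ℂ → ℂ} (hφ : φ ∈ holo ρ)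
    (hψ : ψ ∈ descends ρ) (h1 : Real.log l₁ < ρ - 1) (h2 : Real.log l₂ < ρ - 1)
    (hμ1 : μ ≤ Real.log l₁ - 1) (hμ2 : μ ≤ Real.log l₂ - 1) :
    localConv l₁ l₂ φ ψ ∈ descends μ := by
  obtain ⟨g, hg, hψg⟩ := hψ
  -- With `ψ = g ∘ exp` the integrand has no singularity at `v = w` and does not depend on the
  -- branch of `log (w - v)`. The path may then be replaced by the segment between its fixed ends.
  set Θ : ℂ × ℂ → ℂ := fun q => φ q.2 * g (q.1 - Complex.exp q.2) * Complex.exp q.2 with hΘ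
  have hΘd : DifferentiableOn ℂ Θ {q | ‖q.1‖ < Real.exp μ ∧ q.2.re < ρ - 1 / 2} := by
    refine (DifferentiableOn.mul ?_ ?_).mul (by fun_prop)
    · exact DifferentiableOn.comp (t := {ζ | ζ.re < ρ}) (f := Prod.snd) hφ (by fun_prop)
        fun q hq => by have := hq.2; simp only [Set.mem_ofPred_eq]; linarith
    · exact DifferentiableOn.comp (f := fun q : ℂ × ℂ => q.1 - Complex.exp q.2) hg (by fun_prop)
        fun q hq => norm_sub_exp_lt (by linarith) hq.1 hq.2
  refine ⟨fun w => segInt (fun ζ => Θ (w, ζ)) (Real.log l₁ + Real.pi * Complex.I) (Real.log l₂),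
    differentiableOn_segInt Metric.isOpen_ball hΘd (by fun_prop) (by fun_prop)
    fun w hw t ht => ⟨by simpa using hw, ?_⟩, fun ω hω => ?_⟩
  · refine add_mul_sub_mem (convex_re_lt (ρ - 1 / 2)) ?_ ?_ ht
    · simp only [Set.mem_ofPred_eq, ofReal_add_pi_re]; linarith
    · simp only [Set.mem_ofPred_eq, Complex.ofReal_re]; linarith
  have hd : DifferentiableOn ℂ (fun ζ => Θ (Complex.exp ω, ζ)) {ζ | ζ.re < ρ - 1 / 2} :=
    hΘd.comp (f := fun ζ => (Complex.exp ω, ζ)) (by fun_prop) fun ζ hζ => ⟨norm_exp_lt hω, hζ⟩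
  obtain ⟨F, hF⟩ := exists_primitive (convex_re_lt (ρ - 1 / 2)) (isOpen_re_lt _) hd
  -- Arms and bridge become differences of the single primitive `F`, so that `localConv` telescopes
  -- to its values at the two fixed ends.
  have harm : ∀ {c E ξ : ℂ}, c.re = 0 → Complex.exp c = -1 → E.re < ρ - 1 → ω.re < E.re - 1 →
      ξ.re = junction.re → arm φ ψ c E ξ ω = F (ω + ξ) - F E := by
    intro c E ξ hc hc' hE hωE hξ
    have hs := arm_start_mem hE hωE
    have he := arm_end_mem hE hωE hξ
    rw [← segInt_eq_sub (convex_re_lt (ρ - 1 / 2)) hF hd.continuousOn (a := E) (b := ω + ξ)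
      (by simp only [Set.mem_ofPred_eq]; linarith)
      (by have := he.2; simp only [Set.mem_ofPred_eq]; linarith)]
    refine segInt_congr fun t ht => ?_
    have hm := add_mul_sub_mem (convex_armStrip ω ρ) hs he (Set.Ioo_subset_Icc_self ht)
    simp only [armKernel, hΘ]
    rw [hψg _ ((coLog_re_lt hc hm.1).trans (by linarith [hm.2])), exp_coLog hc' hm.1]
  have hbridge : bridge φ ψ ω = F (ω + junction) - F (ω + (starRingEnd ℂ) junction) := by
    have := integral_mul_deriv_eq_sub (D := {ζ | ζ.re < ρ - 1 / 2}) hF hd.continuousOn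
      (x := -2) (y := 2) (fun t _ => hasDerivAt_log_half_add ω t) (fun t ht => ?_) (fun t ht => ?_)
    · have h3 := log_half_sub_two
      rw [junction] at h3 ⊢
      push_cast at this
      rw [neg_mul, ← sub_eq_add_neg, h3] at this
      rw [← this, bridge]
      refine intervalIntegral.integral_congr fun t ht => ?_
      rw [Set.uIcc_of_le (by norm_num)] at ht
      simp only [hΘ]
      rw [hψg, exp_log_half_add, exp_log_half_sub]
      · have := Complex.slitPlane_ne_zero (half_add_mem_slitPlane t)
        rw [show Complex.exp ω - Complex.exp ω * (1 / 2 + t * Complex.I) =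
          Complex.exp ω * (1 / 2 - t * Complex.I) by ring]
        generalize (1 / 2 + t * Complex.I : ℂ) = y at this ⊢
        field_simp
      · rw [Complex.add_re]; linarith [log_half_sub_re_lt ht]
    · refine ContinuousAt.continuousWithinAt (ContinuousAt.div (by fun_prop) (by fun_prop)
        (Complex.slitPlane_ne_zero (half_add_mem_slitPlane t)))
    · rw [Set.uIcc_of_le (by norm_num)] at ht
      simp only [Set.mem_ofPred_eq, Complex.add_re]
      linarith [log_half_add_re_lt ht]
  beta_reduce
  rw [localConv, harm neg_pi_I_re exp_neg_pi_I (by rwa [ofReal_add_pi_re])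
      (by rw [ofReal_add_pi_re]; linarith) rfl,
    harm pi_I_re Complex.exp_pi_mul_I (by rwa [Complex.ofReal_re])
      (by rw [Complex.ofReal_re]; linarith) junction_conj_re, hbridge,
    segInt_eq_sub (convex_re_lt (ρ - 1 / 2)) hF hd.continuousOn]
  · ring
  · simp only [Set.mem_ofPred_eq, ofReal_add_pi_re]; linarith
  · simp only [Set.mem_ofPred_eq, Complex.ofReal_re]; linarith

theorem hasDerivAt_coLog {c ω ζ : ℂ} (h : ω.re + Real.log 2 < ζ.re) :
    HasDerivAt (coLog c ω) (1 / (1 - Complex.exp (ω - ζ))) ζ := by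
  have hs := one_sub_mem_slitPlane (norm_exp_sub_lt_half h)
  have h1 : HasDerivAt (fun ζ => 1 - Complex.exp (ω - ζ)) (Complex.exp (ω - ζ)) ζ := by
    have := (((hasDerivAt_id ζ).const_sub ω).cexp).const_sub 1
    simpa using this
  have h2 := ((hasDerivAt_id ζ).add_const c).add (h1.clog hs)
  refine h2.congr_deriv ?_
  have := Complex.slitPlane_ne_zero hs
  field_simp
  ring

/-- If the first factor is holomorphic at `0`, so is the local convolution. -/
theorem localConv_mem_descends_left {ρ μ l₁ l₂ : ℝ} {φ ψ : ℂ → ℂ} (hφ : φ ∈ descends ρ)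
    (hψ : ψ ∈ holo ρ) (h1 : Real.log l₁ < ρ - 1) (h2 : Real.log l₂ < ρ - 1)
    (hμ1 : μ ≤ Real.log l₁ - 1) (hμ2 : μ ≤ Real.log l₂ - 1) :
    localConv l₁ l₂ φ ψ ∈ descends μ := by
  obtain ⟨g, hg, hφg⟩ := hφ
  -- After the substitution `v ↦ w - v` the holomorphic factor is the one evaluated at `w - exp ζ`.
  set Ξ : ℂ × ℂ → ℂ := fun q => g (q.1 - Complex.exp q.2) * ψ q.2 * Complex.exp q.2 with hΞ
  have hΞd : DifferentiableOn ℂ Ξ {q | ‖q.1‖ < Real.exp μ ∧ q.2.re < ρ - 1 / 2} := by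
    refine (DifferentiableOn.mul ?_ ?_).mul (by fun_prop)
    · exact DifferentiableOn.comp (f := fun q : ℂ × ℂ => q.1 - Complex.exp q.2) hg (by fun_prop)
        fun q hq => norm_sub_exp_lt (by linarith) hq.1 hq.2
    · exact DifferentiableOn.comp (t := {ζ | ζ.re < ρ}) (f := Prod.snd) hψ (by fun_prop)
        fun q hq => by have := hq.2; simp only [Set.mem_ofPred_eq]; linarith
  -- The substitution makes the fixed ends depend on `w`, but holomorphically: `e c E w` is a
  -- logarithm of `w - exp E` that remains defined at `w = 0`.
  set e : ℂ → ℂ → ℂ → ℂ := fun c E w => E + c + Complex.log (1 - w * Complex.exp (-E)) with he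
  have hhalf : ∀ {E w : ℂ}, μ ≤ E.re - 1 → ‖w‖ < Real.exp μ → ‖w * Complex.exp (-E)‖ < 1 / 2 := by
    intro E w hE hw
    have := norm_exp_sub_lt_half (ω := μ) (ζ := E)
      (by rw [Complex.ofReal_re]; linarith [log_two_lt_one])
    refine lt_of_le_of_lt ?_ this
    rw [sub_eq_add_neg, Complex.exp_add, norm_mul, norm_mul, Complex.norm_exp (μ : ℂ),
      Complex.ofReal_re]
    gcongr
  have hed : ∀ {c E : ℂ}, μ ≤ E.re - 1 →
      DifferentiableOn ℂ (e c E) (Metric.ball 0 (Real.exp μ)) := by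
    intro c E hE
    refine DifferentiableOn.add (by fun_prop) (DifferentiableOn.clog (by fun_prop) fun w hw => ?_)
    exact one_sub_mem_slitPlane (hhalf hE (by simpa using hw))
  have hem : ∀ {c E w : ℂ}, c.re = 0 → E.re < ρ - 1 → μ ≤ E.re - 1 → ‖w‖ < Real.exp μ →
      (e c E w).re < ρ - 1 / 2 := by
    intro c E w hc hE hE' hw
    simp only [he, Complex.add_re, hc]
    linarith [log_one_sub_re_lt (hhalf hE' hw)]
  have r1 : (Real.log l₁ + Real.pi * Complex.I : ℂ).re < ρ - 1 := by rwa [ofReal_add_pi_re]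
  have r2 : (Real.log l₂ : ℂ).re < ρ - 1 := by rwa [Complex.ofReal_re]
  have s1 : μ ≤ (Real.log l₁ + Real.pi * Complex.I : ℂ).re - 1 := by rwa [ofReal_add_pi_re]
  have s2 : μ ≤ (Real.log l₂ : ℂ).re - 1 := by rwa [Complex.ofReal_re]
  refine ⟨fun w => segInt (fun ζ => Ξ (w, ζ)) (e (Real.pi * Complex.I) (Real.log l₂) w)
    (e (-(Real.pi * Complex.I)) (Real.log l₁ + Real.pi * Complex.I) w),
    differentiableOn_segInt Metric.isOpen_ball hΞd (hed s2) (hed s1)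
    fun w hw t ht => ⟨by simpa using hw, ?_⟩, fun ω hω => ?_⟩
  · have hw' : ‖w‖ < Real.exp μ := by simpa using hw
    exact add_mul_sub_mem (convex_re_lt (ρ - 1 / 2)) (hem pi_I_re r2 s2 hw')
      (hem neg_pi_I_re r1 s1 hw') ht
  have hd : DifferentiableOn ℂ (fun ζ => Ξ (Complex.exp ω, ζ)) {ζ | ζ.re < ρ - 1 / 2} :=
    hΞd.comp (f := fun ζ => (Complex.exp ω, ζ)) (by fun_prop) fun ζ hζ => ⟨norm_exp_lt hω, hζ⟩
  obtain ⟨F, hF⟩ := exists_primitive (convex_re_lt (ρ - 1 / 2)) (isOpen_re_lt _) hd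
  have hecoLog : ∀ c E, e c E (Complex.exp ω) = coLog c ω E := fun c E => by
    simp only [he, coLog, sub_eq_add_neg ω E, Complex.exp_add]
  -- The substitution reverses the orientation. The inner ends cancel against those of the bridge
  -- because of `coLog_junction` and `coLog_conj_junction`.
  have harm : ∀ {c E ξ : ℂ}, c.re = 0 → Complex.exp c = -1 → E.re < ρ - 1 → ω.re < E.re - 1 →
      ξ.re = junction.re → arm φ ψ c E ξ ω = F (coLog c ω E) - F (coLog c ω (ω + ξ)) := by
    intro c E ξ hc hc' hE hωE hξ
    have hs := arm_start_mem hE hωE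
    have he := arm_end_mem hE hωE hξ
    have hm : ∀ t ∈ Set.uIcc (0 : ℝ) 1, E + t * (ω + ξ - E) ∈
        {ζ : ℂ | ω.re + Real.log 2 < ζ.re ∧ ζ.re < ρ - 1} := fun t ht =>
      add_mul_sub_mem (convex_armStrip ω ρ) hs he (by simpa using ht)
    have := integral_mul_deriv_eq_sub (D := {ζ | ζ.re < ρ - 1 / 2}) hF hd.continuousOn
      (x := 0) (y := 1) (γ := fun t : ℝ => coLog c ω (E + t * (ω + ξ - E)))
      (γ' := fun t : ℝ => 1 / (1 - Complex.exp (ω - (E + t * (ω + ξ - E)))) * (ω + ξ - E))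
      (fun t ht => (hasDerivAt_coLog (hm t ht).1).comp_of_eq t (hasDerivAt_segment _ _ t) rfl)
      (fun t ht => ?_) (fun t ht => ?_)
    · rw [arm, segInt_eq_integral, ← neg_sub (F _) (F (coLog c ω E))]
      simp only [Complex.ofReal_one, one_mul, Complex.ofReal_zero, zero_mul, add_zero,
        add_sub_cancel] at this
      rw [← this, ← intervalIntegral.integral_neg]
      refine intervalIntegral.integral_congr fun t ht => ?_
      have h3 := hm t ht
      have h4 := Complex.slitPlane_ne_zero (one_sub_mem_slitPlane (norm_exp_sub_lt_half h3.1))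
      simp only [armKernel, hΞ]
      rw [exp_coLog hc' h3.1, hφg _ (by linarith [h3.2])]
      set ζ := E + t * (ω + ξ - E) with hζ
      rw [show Complex.exp ω - (Complex.exp ω - Complex.exp ζ) = Complex.exp ζ by ring]
      have h5 : Complex.exp ω - Complex.exp ζ = -(Complex.exp ζ * (1 - Complex.exp (ω - ζ))) := by
        rw [mul_sub, ← Complex.exp_add]; ring_nf
      rw [h5]
      field_simp
    · refine ContinuousAt.continuousWithinAt (ContinuousAt.mul (ContinuousAt.div (by fun_prop)
        (by fun_prop) ?_) (by fun_prop))
      exact Complex.slitPlane_ne_zero (one_sub_mem_slitPlane (norm_exp_sub_lt_half (hm t ht).1))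
    · have h3 := hm t ht
      simp only [Set.mem_ofPred_eq]
      linarith [coLog_re_lt hc h3.1, h3.2]
  have hbridge : bridge φ ψ ω = F (ω + junction) - F (ω + (starRingEnd ℂ) junction) := by
    have := integral_mul_deriv_eq_sub (D := {ζ | ζ.re < ρ - 1 / 2}) hF hd.continuousOn
      (x := -2) (y := 2) (fun t _ => hasDerivAt_log_half_sub ω t) (fun t ht => ?_) (fun t ht => ?_)
    · have h3 := log_half_sub_two
      rw [junction] at h3 ⊢
      push_cast at this
      rw [neg_mul, sub_neg_eq_add, h3] at this
      rw [← neg_sub (F _) (F (ω + Complex.log _)), ← this, bridge, ← intervalIntegral.integral_neg]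
      refine intervalIntegral.integral_congr fun t ht => ?_
      rw [Set.uIcc_of_le (by norm_num)] at ht
      simp only [hΞ]
      rw [hφg, exp_log_half_add, exp_log_half_sub]
      · have := Complex.slitPlane_ne_zero (half_sub_mem_slitPlane t)
        rw [show Complex.exp ω - Complex.exp ω * (1 / 2 - t * Complex.I) =
          Complex.exp ω * (1 / 2 + t * Complex.I) by ring]
        generalize (1 / 2 - t * Complex.I : ℂ) = y at this ⊢
        field_simp
      · rw [Complex.add_re]; linarith [log_half_add_re_lt ht]
    · refine ContinuousAt.continuousWithinAt (ContinuousAt.div (by fun_prop) (by fun_prop)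
        (Complex.slitPlane_ne_zero (half_sub_mem_slitPlane t)))
    · rw [Set.uIcc_of_le (by norm_num)] at ht
      simp only [Set.mem_ofPred_eq, Complex.add_re]
      linarith [log_half_sub_re_lt ht]
  have hω' := norm_exp_lt hω
  beta_reduce
  rw [localConv, harm neg_pi_I_re exp_neg_pi_I r1 (by linarith) rfl,
    harm pi_I_re Complex.exp_pi_mul_I r2 (by linarith) junction_conj_re, hbridge,
    segInt_eq_sub (convex_re_lt (ρ - 1 / 2)) hF hd.continuousOn (hem pi_I_re r2 s2 hω')
      (hem neg_pi_I_re r1 s1 hω'), coLog_junction, coLog_conj_junction, hecoLog, hecoLog]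
  ring

/-! ### Integrability of the local convolution. -/

theorem exists_norm_exp_mul_lt {φ : ℂ → ℂ} (h : φ ∈ integ) (M : ℝ) {η : ℝ} (hη : 0 < η) :
    ∃ N : ℝ, ∀ ζ : ℂ, ζ.re < N → |ζ.im| ≤ M → ‖Complex.exp ζ * φ ζ‖ < η := by
  have := Metric.tendsto_nhds.1 (h M) η hη
  simp only [dist_zero_right] at this
  exact eventually_sectorFilter.1 this

theorem exists_norm_exp_mul_le {ρ ρ' : ℝ} {φ : ℂ → ℂ} (h1 : φ ∈ holo ρ) (h2 : φ ∈ integ)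
    (hρ : ρ' < ρ) (M : ℝ) :
    ∃ C : ℝ, ∀ ζ : ℂ, ζ.re ≤ ρ' → |ζ.im| ≤ M → ‖Complex.exp ζ * φ ζ‖ ≤ C := by
  obtain ⟨N, hN⟩ := exists_norm_exp_mul_lt h2 M one_pos
  have hK : IsCompact (Set.Icc N ρ' ×ℂ Set.Icc (-M) M) := isCompact_Icc.reProdIm isCompact_Icc
  obtain ⟨C, hC⟩ := hK.exists_bound_of_continuousOn (f := fun ζ => Complex.exp ζ * φ ζ)
    (Complex.continuous_exp.continuousOn.mul (h1.continuousOn.mono fun ζ hζ =>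
      lt_of_le_of_lt hζ.1.2 hρ))
  refine ⟨max C 1, fun ζ hζ him => ?_⟩
  rcases lt_or_ge ζ.re N with hlt | hge
  · exact (hN ζ hlt him).le.trans (le_max_right _ _)
  · exact (hC ζ ⟨⟨hge, hζ⟩, abs_le.1 him⟩).trans (le_max_left _ _)

theorem integral_exp_le {a : ℝ} (ha : 0 < a) :
    ∫ t in (0 : ℝ)..1, Real.exp (-((1 - t) * a)) ≤ 1 / a := by
  have : ∫ t in (0 : ℝ)..1, Real.exp (-((1 - t) * a)) =
      Real.exp (-((1 - 1) * a)) / a - Real.exp (-((1 - 0) * a)) / a := by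
    refine intervalIntegral.integral_eq_sub_of_hasDerivAt
      (f := fun t => Real.exp (-((1 - t) * a)) / a) (fun t _ => ?_)
      (Continuous.intervalIntegrable (by fun_prop) _ _)
    have := ((((hasDerivAt_id t).const_sub 1).mul_const a).neg.exp).div_const a
    refine this.congr_deriv ?_
    simp only [id, Pi.neg_apply]
    field_simp
  rw [this, sub_self, zero_mul, neg_zero, Real.exp_zero]
  have : 0 ≤ Real.exp (-((1 - 0) * a)) / a := by positivity
  linarith

/-- The product splits into the two quantities controlled by integrability and the quotient `exp ω /
exp (coLog c ω ζ)`, whose denominator has modulus at least `|exp ζ| / 2`. -/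
theorem norm_exp_mul_armKernel_le {φ ψ : ℂ → ℂ} {c ω ζ : ℂ} (hc : Complex.exp c = -1)
    (h : ω.re + Real.log 2 < ζ.re) :
    ‖Complex.exp ω * armKernel φ ψ c ω ζ‖ ≤ ‖Complex.exp ζ * φ ζ‖ *
      ‖Complex.exp (coLog c ω ζ) * ψ (coLog c ω ζ)‖ * (2 * Real.exp (ω.re - ζ.re)) := by
  have h1 : Complex.exp ω * armKernel φ ψ c ω ζ = (Complex.exp ζ * φ ζ) *
      (Complex.exp (coLog c ω ζ) * ψ (coLog c ω ζ)) *
      (Complex.exp ω / Complex.exp (coLog c ω ζ)) := by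
    rw [armKernel]
    field_simp [Complex.exp_ne_zero]
  rw [h1, norm_mul, norm_mul]
  gcongr
  have h2 := norm_exp_sub_lt_half h
  have h3 : Complex.exp (coLog c ω ζ) = -(Complex.exp ζ * (1 - Complex.exp (ω - ζ))) := by
    rw [exp_coLog hc h, mul_sub, ← Complex.exp_add]; ring_nf
  have h4 : 1 / 2 < ‖1 - Complex.exp (ω - ζ)‖ :=
    (half_lt_re_one_sub h2).trans_le (Complex.re_le_norm _)
  rw [h3, norm_div, norm_neg, norm_mul, Complex.norm_exp, Complex.norm_exp, ← div_div,
    ← Real.exp_sub, div_le_iff₀ (by linarith)]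
  nlinarith [Real.exp_pos (ω.re - ζ.re)]

/-- The arm has length of order `D = Re E - Re ω`, and the kernel times `exp ω` carries the factor
`exp (Re ω - Re ζ)`. Where `Re ζ < N` the factor `exp ζ * φ ζ` is at most `η`, and the exponential
integrates to at most `1/a`, which compensates the length. Where `Re ζ ≥ N` the kernel is `O(exp
(-D))`, and `D exp (-D) → 0`. -/
theorem arm_mem_integ {ρ : ℝ} {φ ψ : ℂ → ℂ} (hφ : φ ∈ holo ρ) (hψ : ψ ∈ holo ρ)
    (iφ : φ ∈ integ) (iψ : ψ ∈ integ) {c E ξ : ℂ} (hc : c.re = 0) (hc' : Complex.exp c = -1)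
    (hE : E.re < ρ - 1) (hξ : ξ.re = junction.re) : arm φ ψ c E ξ ∈ integ := by
  intro M
  set M₁ := |M| + |E.im| + |ξ.im| with hM₁
  set M₂ := M₁ + |c.im| + Real.pi / 2 with hM₂
  obtain ⟨C₁, hC₁⟩ := exists_norm_exp_mul_le hφ iφ (show E.re < ρ by linarith) M₁
  obtain ⟨C₂, hC₂⟩ := exists_norm_exp_mul_le hψ iψ (show E.re + 1 / 2 < ρ by linarith) M₂
  set C := max (max C₁ C₂) 1 with hCdef
  have hC0 : 0 < C := lt_of_lt_of_le one_pos (le_max_right _ _)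
  set L₀ := M₁ + 1 with hL₀
  refine Metric.tendsto_nhds.2 fun ε hε => eventually_sectorFilter.2 ?_
  simp only [dist_zero_right]
  -- The main term will be at most `4 C η · 2 = ε / 2`.
  set η := ε / (16 * C) with hη
  obtain ⟨N, hN⟩ := exists_norm_exp_mul_lt iφ M₁ (show 0 < η by positivity)
  have hlim := (Real.tendsto_pow_mul_exp_neg_atTop_nhds_zero 1).const_mul
    (4 * C ^ 2 * Real.exp (E.re - N))
  rw [mul_zero] at hlim
  obtain ⟨K, hK⟩ := eventually_atTop.1 (Metric.tendsto_nhds.1 hlim (ε / 4) (by positivity))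
  -- The three thresholds ensure `D > 3`, smallness of `D exp (-D)`, and that the length of the arm
  -- is at most `2 D`.
  refine ⟨min (E.re - 3) (min (E.re - K) (E.re - L₀)), fun ω hω him => ?_⟩
  have hω1 : ω.re < E.re - 3 := hω.trans_le (min_le_left _ _)
  have hω2 : ω.re < E.re - K := hω.trans_le ((min_le_right _ _).trans (min_le_left _ _))
  have hω3 : ω.re < E.re - L₀ := hω.trans_le ((min_le_right _ _).trans (min_le_right _ _))
  set D := E.re - ω.re with hD
  have hξ0 : 0 < ξ.re := by
    rw [hξ]; exact (Real.log_pos (by norm_num)).trans log_two_lt_junction_re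
  have hξ1 : ξ.re < 1 := by rw [hξ]; exact junction_re_lt
  set a := D - ξ.re with ha
  have ha0 : D / 2 ≤ a := by linarith
  have hD0 : 3 < D := by linarith
  have him' : |ω.im| ≤ |M| := him.trans (le_abs_self M)
  have hL : ‖ω + ξ - E‖ ≤ 2 * D := by
    refine (Complex.norm_le_abs_re_add_abs_im _).trans ?_
    simp only [Complex.sub_re, Complex.add_re, Complex.sub_im, Complex.add_im]
    have h1 : |ω.re + ξ.re - E.re| ≤ D := abs_le.2 ⟨by linarith, by linarith⟩
    have h2 := abs_sub (ω.im + ξ.im) E.im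
    have h3 := abs_add_le ω.im ξ.im
    linarith
  have hs := arm_start_mem hE (show ω.re < E.re - 1 by linarith)
  have he := arm_end_mem hE (show ω.re < E.re - 1 by linarith) hξ
  have hbound : ∀ t ∈ Set.Ioc (0 : ℝ) 1,
      ‖Complex.exp ω * armKernel φ ψ c ω (E + t * (ω + ξ - E))‖ ≤
        2 * C * η * Real.exp (-((1 - t) * a)) + 2 * C ^ 2 * Real.exp (ω.re - N) := by
    intro t ht
    have htI := Set.Ioc_subset_Icc_self ht
    have hm := add_mul_sub_mem (convex_armStrip ω ρ) hs he htI
    set ζ := E + t * (ω + ξ - E) with hζ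
    have hre : ζ.re = E.re - t * a := by
      simp only [hζ, Complex.add_re, Complex.re_ofReal_mul, Complex.sub_re, ha, hD]; ring
    have himζ : |ζ.im| ≤ M₁ := by
      have : ζ.im = (1 - t) * E.im + t * (ω.im + ξ.im) := by
        simp only [hζ, Complex.add_im, Complex.im_ofReal_mul, Complex.sub_im]; ring
      rw [this]
      refine (abs_add_le _ _).trans ?_
      rw [abs_mul, abs_mul, abs_of_nonneg htI.1, abs_of_nonneg (sub_nonneg.2 htI.2)]
      have h3 := abs_add_le ω.im ξ.im
      nlinarith [abs_nonneg E.im, abs_nonneg ξ.im, abs_nonneg M, htI.1, htI.2,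
        abs_nonneg (ω.im + ξ.im)]
    have hreE : ζ.re ≤ E.re := by
      rw [hre]; nlinarith [htI.1]
    have himc : |(coLog c ω ζ).im| ≤ M₂ := by
      rw [coLog, Complex.add_im, Complex.add_im]
      have h1 := abs_log_one_sub_im_lt (norm_exp_sub_lt_half hm.1)
      have h2 := abs_add_le (ζ.im + c.im) (Complex.log (1 - Complex.exp (ω - ζ))).im
      have h3 := abs_add_le ζ.im c.im
      linarith
    have hψC := hC₂ (coLog c ω ζ) (by linarith [coLog_re_lt hc hm.1]) himc
    have hψC' : ‖Complex.exp (coLog c ω ζ) * ψ (coLog c ω ζ)‖ ≤ C :=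
      hψC.trans ((le_max_right _ _).trans (le_max_left _ _))
    refine (norm_exp_mul_armKernel_le hc' hm.1).trans ?_
    rcases lt_or_ge ζ.re N with hlt | hge
    · have h1 := (hN ζ hlt himζ).le
      have h2 : Real.exp (ω.re - ζ.re) ≤ Real.exp (-((1 - t) * a)) := by
        refine Real.exp_le_exp.2 ?_
        rw [hre]
        have : ω.re = E.re - D := by rw [hD]; ring
        rw [this, show D = a + ξ.re by rw [ha]; ring]
        linarith
      calc _ ≤ η * C * (2 * Real.exp (-((1 - t) * a))) := by gcongr
        _ ≤ _ := by
          have : 0 ≤ 2 * C ^ 2 * Real.exp (ω.re - N) := by positivity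
          linarith
    · have h1 : ‖Complex.exp ζ * φ ζ‖ ≤ C :=
        (hC₁ ζ hreE himζ).trans ((le_max_left _ _).trans (le_max_left _ _))
      calc _ ≤ C * C * (2 * Real.exp (ω.re - N)) := by gcongr
        _ ≤ _ := by
          have : 0 ≤ 2 * C * η * Real.exp (-((1 - t) * a)) := by positivity
          linarith
  have hint : ‖∫ t in (0 : ℝ)..1, Complex.exp ω * armKernel φ ψ c ω (E + t * (ω + ξ - E))‖ ≤
      2 * C * η * (1 / a) + 2 * C ^ 2 * Real.exp (ω.re - N) := by
    refine (intervalIntegral.norm_integral_le_of_norm_le zero_le_one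
      (Eventually.of_forall fun t ht => hbound t ht)
      (Continuous.intervalIntegrable (by fun_prop) _ _)).trans ?_
    rw [intervalIntegral.integral_add (Continuous.intervalIntegrable (by fun_prop) _ _)
      (Continuous.intervalIntegrable (by fun_prop) _ _), intervalIntegral.integral_const_mul,
      intervalIntegral.integral_const, sub_zero, one_smul]
    have := integral_exp_le (a := a) (by linarith)
    gcongr
  have heq : Complex.exp ω * arm φ ψ c E ξ ω = (ω + ξ - E) *
      ∫ t in (0 : ℝ)..1, Complex.exp ω * armKernel φ ψ c ω (E + t * (ω + ξ - E)) := by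
    rw [intervalIntegral.integral_const_mul, arm, segInt]; ring
  rw [heq, norm_mul]
  have h5 := hK D (by linarith)
  rw [Real.dist_eq, sub_zero, pow_one] at h5
  have h6 := (le_abs_self _).trans_lt h5
  have h7 : Real.exp (ω.re - N) = Real.exp (E.re - N) * Real.exp (-D) := by
    rw [← Real.exp_add]; congr 1; rw [hD]; ring
  calc _ ≤ 2 * D * (2 * C * η * (1 / a) + 2 * C ^ 2 * Real.exp (ω.re - N)) := by gcongr
    _ = 4 * C * η * (D / a) + 4 * C ^ 2 * Real.exp (E.re - N) * (D * Real.exp (-D)) := by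
      rw [h7]; ring
    _ ≤ 4 * C * η * 2 + 4 * C ^ 2 * Real.exp (E.re - N) * (D * Real.exp (-D)) := by
      gcongr
      rw [div_le_iff₀ (by linarith)]; linarith
    _ < ε := by
      have : 4 * C * η * 2 = ε / 2 := by rw [hη]; field_simp; ring
      linarith

theorem half_le_norm_half_add (t : ℝ) : 1 / 2 ≤ ‖(1 / 2 + t * Complex.I : ℂ)‖ := by
  have := Complex.re_le_norm (1 / 2 + t * Complex.I : ℂ)
  simpa using this

theorem half_le_norm_half_sub (t : ℝ) : 1 / 2 ≤ ‖(1 / 2 - t * Complex.I : ℂ)‖ := by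
  have := Complex.re_le_norm (1 / 2 - t * Complex.I : ℂ)
  simpa using this

/-- The points of the bridge have modulus at least `|w| / 2`, so `w φ` and `w ψ` are both at most `2
η` along it. Since `dv = w i dt`, multiplying by `w` supplies exactly these two factors. -/
theorem bridge_mem_integ {φ ψ : ℂ → ℂ} (iφ : φ ∈ integ) (iψ : ψ ∈ integ) :
    bridge φ ψ ∈ integ := by
  intro M
  refine Metric.tendsto_nhds.2 fun ε hε => eventually_sectorFilter.2 ?_
  simp only [dist_zero_right]
  set η := min 1 (ε / 32) with hη
  have hη0 : 0 < η := lt_min one_pos (by positivity)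
  obtain ⟨N₁, hN₁⟩ := exists_norm_exp_mul_lt iφ (M + Real.pi) hη0
  obtain ⟨N₂, hN₂⟩ := exists_norm_exp_mul_lt iψ (M + Real.pi) hη0
  refine ⟨min N₁ N₂ - 1, fun ω hω him => ?_⟩
  rw [bridge, ← intervalIntegral.integral_const_mul]
  have hb : ∀ t ∈ Set.uIoc (-2 : ℝ) 2, ‖Complex.exp ω *
      (φ (ω + Complex.log (1 / 2 + t * Complex.I)) * ψ (ω + Complex.log (1 / 2 - t * Complex.I)) *
        (Complex.exp ω * Complex.I))‖ ≤ 4 * η ^ 2 := by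
    intro t ht
    rw [Set.uIoc_of_le (by norm_num)] at ht
    have ht' := Set.Ioc_subset_Icc_self ht
    have him1 : ∀ u : ℂ, |(ω + Complex.log u).im| ≤ M + Real.pi := fun u => by
      rw [Complex.add_im, Complex.log_im]
      exact (abs_add_le _ _).trans (add_le_add him (Complex.abs_arg_le_pi u))
    have h1 := hN₁ (ω + Complex.log (1 / 2 + t * Complex.I)) (by
      rw [Complex.add_re]; linarith [log_half_add_re_lt ht', min_le_left N₁ N₂]) (him1 _)
    have h2 := hN₂ (ω + Complex.log (1 / 2 - t * Complex.I)) (by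
      rw [Complex.add_re]; linarith [log_half_sub_re_lt ht', min_le_right N₁ N₂]) (him1 _)
    rw [exp_log_half_add, mul_right_comm, norm_mul] at h1
    rw [exp_log_half_sub, mul_right_comm, norm_mul] at h2
    have h3 := half_le_norm_half_add t
    have h4 := half_le_norm_half_sub t
    have e1 : Complex.exp ω * (φ (ω + Complex.log (1 / 2 + t * Complex.I)) *
        ψ (ω + Complex.log (1 / 2 - t * Complex.I)) * (Complex.exp ω * Complex.I)) =
        (Complex.exp ω * φ (ω + Complex.log (1 / 2 + t * Complex.I))) *
        (Complex.exp ω * ψ (ω + Complex.log (1 / 2 - t * Complex.I))) * Complex.I := by ring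
    rw [e1, norm_mul, norm_mul _ (Complex.exp ω * _), Complex.norm_I, mul_one]
    have h5 : ‖Complex.exp ω * φ (ω + Complex.log (1 / 2 + t * Complex.I))‖ ≤ 2 * η := by
      nlinarith [norm_nonneg (Complex.exp ω * φ (ω + Complex.log (1 / 2 + t * Complex.I)))]
    have h6 : ‖Complex.exp ω * ψ (ω + Complex.log (1 / 2 - t * Complex.I))‖ ≤ 2 * η := by
      nlinarith [norm_nonneg (Complex.exp ω * ψ (ω + Complex.log (1 / 2 - t * Complex.I)))]
    calc _ ≤ (2 * η) * (2 * η) := by gcongr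
      _ = _ := by ring
  refine (intervalIntegral.norm_integral_le_of_norm_le_const hb).trans_lt ?_
  have h1 : η ≤ 1 := min_le_left _ _
  have h2 : η ≤ ε / 32 := min_le_right _ _
  norm_num
  nlinarith

theorem localConv_mem_integ {ρ l₁ l₂ : ℝ} {φ ψ : ℂ → ℂ} (hφ : φ ∈ holo ρ) (hψ : ψ ∈ holo ρ)
    (iφ : φ ∈ integ) (iψ : ψ ∈ integ) (h1 : Real.log l₁ < ρ - 1) (h2 : Real.log l₂ < ρ - 1) :
    localConv l₁ l₂ φ ψ ∈ integ :=
  integ.sub_mem (integ.sub_mem (arm_mem_integ hφ hψ iφ iψ neg_pi_I_re exp_neg_pi_I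
    (by rwa [ofReal_add_pi_re]) rfl) (bridge_mem_integ iφ iψ))
    (arm_mem_integ hφ hψ iφ iψ pi_I_re Complex.exp_pi_mul_I (by rwa [Complex.ofReal_re])
      junction_conj_re)

/-! ### Bilinearity and the resulting monodromy relation. -/

theorem segInt_add_fun {D : Set ℂ} (hD : Convex ℝ D) {Φ Ψ : ℂ → ℂ} (hΦ : ContinuousOn Φ D)
    (hΨ : ContinuousOn Ψ D) {a b : ℂ} (ha : a ∈ D) (hb : b ∈ D) :
    segInt (fun z => Φ z + Ψ z) a b = segInt Φ a b + segInt Ψ a b := by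
  have hc : ∀ {Φ : ℂ → ℂ}, ContinuousOn Φ D →
      IntervalIntegrable (fun t : ℝ => Φ (a + t * (b - a))) MeasureTheory.volume 0 1 := by
    intro Φ hΦ
    refine ContinuousOn.intervalIntegrable (hΦ.comp (by fun_prop) fun t ht => ?_)
    exact add_mul_sub_mem hD ha hb (by simpa using ht)
  rw [segInt, intervalIntegral.integral_add (hc hΦ) (hc hΨ), mul_add]
  rfl

section Bilinear

variable {ρ : ℝ}

theorem continuous_bridge_aux {φ ψ : ℂ → ℂ} (hφ : φ ∈ holo ρ) (hψ : ψ ∈ holo ρ) {ω : ℂ}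
    (hω : ω.re < ρ - 1) : IntervalIntegrable (fun t : ℝ =>
      φ (ω + Complex.log (1 / 2 + t * Complex.I)) *
        ψ (ω + Complex.log (1 / 2 - t * Complex.I)) * (Complex.exp ω * Complex.I))
      MeasureTheory.volume (-2) 2 := by
  refine ContinuousOn.intervalIntegrable (ContinuousOn.mul (ContinuousOn.mul ?_ ?_)
    continuousOn_const)
  · refine hφ.continuousOn.comp (fun t _ =>
      (hasDerivAt_log_half_add ω t).continuousAt.continuousWithinAt) fun t ht => ?_
    rw [Set.uIcc_of_le (by norm_num)] at ht
    simp only [Set.mem_ofPred_eq, Complex.add_re]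
    linarith [log_half_add_re_lt ht]
  · refine hψ.continuousOn.comp (fun t _ =>
      (hasDerivAt_log_half_sub ω t).continuousAt.continuousWithinAt) fun t ht => ?_
    rw [Set.uIcc_of_le (by norm_num)] at ht
    simp only [Set.mem_ofPred_eq, Complex.add_re]
    linarith [log_half_sub_re_lt ht]

/-- Additivity needs integrable kernels, so it is asserted only where the path lies in their region
of holomorphy; hence the formulation modulo `vanish`. Homogeneity holds everywhere. -/
theorem localConv_add_left {l₁ l₂ : ℝ} (h1 : Real.log l₁ < ρ - 1)
    (h2 : Real.log l₂ < ρ - 1) {φ φ' ψ : ℂ → ℂ} (hφ : φ ∈ holo ρ) (hφ' : φ' ∈ holo ρ)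
    (hψ : ψ ∈ holo ρ) : localConv l₁ l₂ (φ + φ') ψ - (localConv l₁ l₂ φ ψ +
      localConv l₁ l₂ φ' ψ) ∈ vanish (min (Real.log l₁) (Real.log l₂) - 1) := by
  intro ω hω
  have hω1 : ω.re < Real.log l₁ - 1 := by linarith [min_le_left (Real.log l₁) (Real.log l₂)]
  have hω2 : ω.re < Real.log l₂ - 1 := by linarith [min_le_right (Real.log l₁) (Real.log l₂)]
  have harm : ∀ {c E ξ : ℂ}, c.re = 0 → E.re < ρ - 1 → ω.re < E.re - 1 → ξ.re = junction.re →
      arm (φ + φ') ψ c E ξ ω = arm φ ψ c E ξ ω + arm φ' ψ c E ξ ω := fun hc hE hωE hξ => by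
    rw [arm, arm, arm, ← segInt_add_fun (convex_armStrip ω ρ)
      (differentiableOn_armKernel_right hφ hψ hc ω).continuousOn
      (differentiableOn_armKernel_right hφ' hψ hc ω).continuousOn (arm_start_mem hE hωE)
      (arm_end_mem hE hωE hξ)]
    congr 1
    ext ζ
    simp only [armKernel, Pi.add_apply]
    ring
  have hb : bridge (φ + φ') ψ ω = bridge φ ψ ω + bridge φ' ψ ω := by
    rw [bridge, bridge, bridge, ← intervalIntegral.integral_add
      (continuous_bridge_aux hφ hψ (by linarith)) (continuous_bridge_aux hφ' hψ (by linarith))]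
    congr 1
    ext t
    simp only [Pi.add_apply]
    ring
  simp only [Pi.sub_apply, Pi.add_apply, localConv]
  rw [hb, harm neg_pi_I_re (by rwa [ofReal_add_pi_re]) (by rwa [ofReal_add_pi_re]) rfl,
    harm pi_I_re (by rwa [Complex.ofReal_re]) (by rwa [Complex.ofReal_re]) junction_conj_re]
  ring

theorem localConv_add_right {l₁ l₂ : ℝ} (h1 : Real.log l₁ < ρ - 1)
    (h2 : Real.log l₂ < ρ - 1) {φ ψ ψ' : ℂ → ℂ} (hφ : φ ∈ holo ρ) (hψ : ψ ∈ holo ρ)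
    (hψ' : ψ' ∈ holo ρ) : localConv l₁ l₂ φ (ψ + ψ') - (localConv l₁ l₂ φ ψ +
      localConv l₁ l₂ φ ψ') ∈ vanish (min (Real.log l₁) (Real.log l₂) - 1) := by
  intro ω hω
  have hω1 : ω.re < Real.log l₁ - 1 := by linarith [min_le_left (Real.log l₁) (Real.log l₂)]
  have hω2 : ω.re < Real.log l₂ - 1 := by linarith [min_le_right (Real.log l₁) (Real.log l₂)]
  have harm : ∀ {c E ξ : ℂ}, c.re = 0 → E.re < ρ - 1 → ω.re < E.re - 1 → ξ.re = junction.re →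
      arm φ (ψ + ψ') c E ξ ω = arm φ ψ c E ξ ω + arm φ ψ' c E ξ ω := fun hc hE hωE hξ => by
    rw [arm, arm, arm, ← segInt_add_fun (convex_armStrip ω ρ)
      (differentiableOn_armKernel_right hφ hψ hc ω).continuousOn
      (differentiableOn_armKernel_right hφ hψ' hc ω).continuousOn (arm_start_mem hE hωE)
      (arm_end_mem hE hωE hξ)]
    congr 1
    ext ζ
    simp only [armKernel, Pi.add_apply]
    ring
  have hb : bridge φ (ψ + ψ') ω = bridge φ ψ ω + bridge φ ψ' ω := by
    rw [bridge, bridge, bridge, ← intervalIntegral.integral_add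
      (continuous_bridge_aux hφ hψ (by linarith)) (continuous_bridge_aux hφ hψ' (by linarith))]
    congr 1
    ext t
    simp only [Pi.add_apply]
    ring
  simp only [Pi.sub_apply, Pi.add_apply, localConv]
  rw [hb, harm neg_pi_I_re (by rwa [ofReal_add_pi_re]) (by rwa [ofReal_add_pi_re]) rfl,
    harm pi_I_re (by rwa [Complex.ofReal_re]) (by rwa [Complex.ofReal_re]) junction_conj_re]
  ring

end Bilinear

theorem localConv_smul_left (l₁ l₂ : ℝ) (k : ℂ) (φ ψ : ℂ → ℂ) :
    localConv l₁ l₂ (k • φ) ψ = k • localConv l₁ l₂ φ ψ := by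
  have hK : ∀ c ω, armKernel (k • φ) ψ c ω = fun ζ => k * armKernel φ ψ c ω ζ := fun c ω => by
    ext ζ
    simp only [armKernel, Pi.smul_apply, smul_eq_mul]
    ring
  ext ω
  simp only [localConv, arm, hK, segInt_const_mul, Pi.smul_apply, smul_eq_mul, bridge, mul_sub]
  congr 2
  rw [← intervalIntegral.integral_const_mul]
  congr 1
  ext t
  ring

theorem localConv_smul_right (l₁ l₂ : ℝ) (k : ℂ) (φ ψ : ℂ → ℂ) :
    localConv l₁ l₂ φ (k • ψ) = k • localConv l₁ l₂ φ ψ := by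
  have hK : ∀ c ω, armKernel φ (k • ψ) c ω = fun ζ => k * armKernel φ ψ c ω ζ := fun c ω => by
    ext ζ
    simp only [armKernel, Pi.smul_apply, smul_eq_mul]
    ring
  ext ω
  simp only [localConv, arm, hK, segInt_const_mul, Pi.smul_apply, smul_eq_mul, bridge, mul_sub]
  congr 2
  rw [← intervalIntegral.integral_const_mul]
  congr 1
  ext t
  ring

theorem mk_eq_zero_of_vanish {ρ : ℝ} {φ : ℂ → ℂ} (h : φ ∈ vanish ρ) :
    descendsGerm.mkQ φ = 0 := by
  rw [Submodule.mkQ_apply, Submodule.Quotient.mk_eq_zero]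
  exact ⟨ρ, vanish_le_descends ρ h⟩

theorem mk_eq_zero_of_descends {ρ : ℝ} {φ : ℂ → ℂ} (h : φ ∈ descends ρ) :
    descendsGerm.mkQ φ = 0 := by
  rw [Submodule.mkQ_apply, Submodule.Quotient.mk_eq_zero]
  exact ⟨ρ, h⟩

/-- The monodromy relation satisfied by a local convolution. -/
theorem aeval_localConv_mem_descendsGerm {ρ l₁ l₂ : ℝ} {φ ψ : ℂ → ℂ} (hφ : φ ∈ holo ρ)
    (hψ : ψ ∈ holo ρ) (h1 : Real.log l₁ < ρ - 1) (h2 : Real.log l₂ < ρ - 1) {P R : ℂ[X]}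
    (hP : P.Monic) (hR : R.Monic) (kφ : aeval shift P φ ∈ descends ρ)
    (kψ : aeval shift R ψ ∈ descends ρ) :
    aeval shift (tensorPoly P R) (localConv l₁ l₂ φ ψ) ∈ descendsGerm := by
  set μ := min (Real.log l₁) (Real.log l₂) - 1 with hμ
  have hμ1 : μ ≤ Real.log l₁ - 1 := by linarith [min_le_left (Real.log l₁) (Real.log l₂)]
  have hμ2 : μ ≤ Real.log l₂ - 1 := by linarith [min_le_right (Real.log l₁) (Real.log l₂)]
  have hadd : ∀ {a b : ℂ → ℂ}, a - b ∈ vanish μ → descendsGerm.mkQ a = descendsGerm.mkQ b :=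
    fun h => sub_eq_zero.1 (by rw [← map_sub]; exact mk_eq_zero_of_vanish h)
  -- In the quotient by `descendsGerm` the local convolution is bilinear, intertwines the shifts,
  -- and is zero when a factor descends: the hypotheses of `aeval_tensorPoly`.
  let S : Module.End ℂ (holo ρ) := shift.restrict fun _ h => shift_mem_holo h
  let T : Module.End ℂ ((ℂ → ℂ) ⧸ descendsGerm) :=
    descendsGerm.mapQ descendsGerm shift fun _ h => shift_mem_descendsGerm h
  let β : holo ρ →ₗ[ℂ] holo ρ →ₗ[ℂ] (ℂ → ℂ) ⧸ descendsGerm :=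
    LinearMap.mk₂ ℂ (fun x y => descendsGerm.mkQ (localConv l₁ l₂ x y))
      (fun x x' y => by
        rw [← map_add]
        exact hadd (localConv_add_left h1 h2 x.2 x'.2 y.2))
      (fun k x y => by
        rw [← map_smul, ← localConv_smul_left]; rfl)
      (fun x y y' => by
        rw [← map_add]
        exact hadd (localConv_add_right h1 h2 x.2 y.2 y'.2))
      (fun k x y => by
        rw [← map_smul, ← localConv_smul_right]; rfl)
  have hβ : ∀ x y, T (β x y) = β (S x) (S y) := fun x y => by
    have := mk_eq_zero_of_descends
      (localConv_shift_sub_mem_descends x.2 y.2 h1 h2 hμ1 hμ2)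
    rw [map_sub, sub_eq_zero] at this
    exact this
  have hS : ∀ (Q : ℂ[X]) (x : holo ρ), ((aeval S Q x : holo ρ) : ℂ → ℂ) = aeval shift Q x :=
    fun Q x => map_aeval_of_semiconj (holo ρ).subtype (fun _ => rfl) Q x
  have key := aeval_tensorPoly (T := T) β hβ hP hR (x := ⟨φ, hφ⟩) (y := ⟨ψ, hψ⟩)
    (fun y' => mk_eq_zero_of_descends (localConv_mem_descends_left (by rw [hS]; exact kφ) y'.2
      h1 h2 hμ1 hμ2))
    (fun x' => mk_eq_zero_of_descends (localConv_mem_descends_right x'.2 (by rw [hS]; exact kψ)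
      h1 h2 hμ1 hμ2))
  have h3 := map_aeval_of_semiconj (T := shift) (T' := T) descendsGerm.mkQ (fun _ => rfl)
    (tensorPoly P R) (localConv l₁ l₂ φ ψ)
  rw [show descendsGerm.mkQ (localConv l₁ l₂ φ ψ) = β ⟨φ, hφ⟩ ⟨ψ, hψ⟩ from rfl, key,
    Submodule.mkQ_apply, Submodule.Quotient.mk_eq_zero] at h3
  exact h3

/-! ### The local convolution as a polygonal integral over one side. -/

/-- The integral from `a` to `b` along the polygon `a, a + h, b + h, b`. -/
noncomputable def detour (Φ : ℂ → ℂ) (a b h : ℂ) : ℂ :=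
  segInt Φ a (a + h) + segInt Φ (a + h) (b + h) + segInt Φ (b + h) b

theorem detour_swap (Φ : ℂ → ℂ) (a b h : ℂ) : detour Φ b a h = -detour Φ a b h := by
  rw [detour, detour, segInt_symm Φ a, segInt_symm Φ (a + h), segInt_symm Φ (b + h)]
  ring

theorem detour_comp_neg (Φ : ℂ → ℂ) (a b h : ℂ) :
    detour (fun z => Φ (-z)) a b h = -detour Φ (-a) (-b) (-h) := by
  simp only [detour, segInt_comp_neg, neg_add]

theorem detour_comp_add (Φ : ℂ → ℂ) (a b h c : ℂ) :
    detour (fun z => Φ (z + c)) a b h = detour Φ (a + c) (b + c) h := by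
  simp only [detour, segInt_comp_add, add_right_comm]

/-- In the range `(-π, 2π)` a positive sine forces the imaginary part into `(0, π)`, where the
principal branch applies. -/
theorem log_eq_of_exp_eq {x V : ℂ} (h : Complex.exp x = V) (hV : 0 < V.im) (h1 : -Real.pi < x.im)
    (h2 : x.im < 2 * Real.pi) : Complex.log V = x := by
  rw [← h]
  refine Complex.log_exp h1 ?_
  by_contra! h3
  rw [← h, Complex.exp_im] at hV
  have := Real.sin_nonpos_of_nonpos_of_neg_pi_le (x := x.im - 2 * Real.pi)
    (by linarith) (by linarith)
  rw [Real.sin_sub_two_pi] at this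
  nlinarith [Real.exp_pos x.re]

theorem log_mem_strip {v : ℂ} (hv : 0 < v.im) : Complex.log v ∈ Side.left.strip := by
  rw [Side.strip]
  simp only [Set.mem_ofPred_eq, Complex.log_im]
  exact ⟨lt_of_le_of_ne (Complex.arg_nonneg_iff.2 hv.le) fun h0 => by
      have := (Complex.arg_eq_zero_iff.1 h0.symm).2
      linarith,
    lt_of_le_of_ne (Complex.arg_le_pi v) fun h0 => by
      have := (Complex.arg_eq_pi_iff.1 h0).2
      linarith⟩

theorem ne_zero_of_im_pos {v : ℂ} (hv : 0 < v.im) : v ≠ 0 := by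
  rintro rfl; simp at hv

/-- The branch of the logarithm with its cut along the negative imaginary axis. -/
noncomputable def upLog (v : ℂ) : ℂ := Complex.log (-Complex.I * v) + Real.pi / 2 * Complex.I

theorem upLog_re (v : ℂ) : (upLog v).re = Real.log ‖v‖ := by
  simp [upLog, Complex.log_re]

theorem exp_upLog {v : ℂ} (hv : v ≠ 0) : Complex.exp (upLog v) = v := by
  rw [upLog, Complex.exp_add, Complex.exp_log (by simp [hv]), Complex.exp_pi_div_two_mul_I]
  linear_combination (-v) * Complex.I_mul_I

theorem upLog_im_mem (v : ℂ) :
    -(Real.pi / 2) < (upLog v).im ∧ (upLog v).im ≤ 3 * Real.pi / 2 := by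
  have h1 := Complex.neg_pi_lt_arg (-Complex.I * v)
  have h2 := Complex.arg_le_pi (-Complex.I * v)
  have : (upLog v).im = Complex.arg (-Complex.I * v) + Real.pi / 2 := by
    simp [upLog, Complex.log_im]
  rw [this]
  constructor <;> linarith

theorem upLog_eq_log {v : ℂ} (hv : 0 < v.im) : upLog v = Complex.log v := by
  have h := upLog_im_mem v
  exact (log_eq_of_exp_eq (exp_upLog (ne_zero_of_im_pos hv)) hv (by linarith [Real.pi_pos])
    (by linarith [Real.pi_pos])).symm

theorem differentiableAt_upLog {v : ℂ} (hv : 0 < v.im ∨ v.re ≠ 0) :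
    HasDerivAt upLog v⁻¹ v := by
  have hs : -Complex.I * v ∈ Complex.slitPlane := by
    rcases hv with h | h
    · left; simpa using h
    · right; simpa using h
  have h1 : HasDerivAt (fun v : ℂ => -Complex.I * v) (-Complex.I) v := by
    simpa using (hasDerivAt_id v).const_mul (-Complex.I)
  refine ((h1.clog hs).add_const _).congr_deriv ?_
  have : v ≠ 0 := by
    rintro rfl; simp at hv
  field_simp [Complex.I_ne_zero]

theorem upLog_neg_ofReal {l : ℝ} (hl : 0 < l) :
    upLog (-(l : ℂ)) = Real.log l + Real.pi * Complex.I := by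
  have : -Complex.I * -(l : ℂ) = (l : ℝ) * Complex.I := by ring
  rw [upLog, this, Complex.log_ofReal_mul hl Complex.I_ne_zero, Complex.log_I]
  ring

theorem upLog_ofReal {l : ℝ} (hl : 0 < l) : upLog (l : ℂ) = Real.log l := by
  have : -Complex.I * (l : ℂ) = (l : ℝ) * -Complex.I := by ring
  rw [upLog, this, Complex.log_ofReal_mul hl (neg_ne_zero.2 Complex.I_ne_zero), Complex.log_neg_I]
  ring

/-- The integrand of the local convolution for `w` in the upper half plane. -/
noncomputable def upKernel (φ ψ : ℂ → ℂ) (q : ℂ × ℂ) : ℂ :=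
  φ (upLog q.2) * ψ (Complex.log (q.1 - q.2))

/-- A region on which `upKernel` is holomorphic. -/
def upRegion (ρ : ℝ) : Set (ℂ × ℂ) :=
  {q | (0 < q.2.im ∨ q.2.re ≠ 0) ∧ ‖q.2‖ < Real.exp ρ ∧ 0 < (q.1 - q.2).im ∧
    ‖q.1 - q.2‖ < Real.exp ρ}

theorem differentiableOn_upKernel {ρ : ℝ} {φ ψ : ℂ → ℂ} (hφ : φ ∈ holo ρ) (hψ : ψ ∈ holo ρ) :
    DifferentiableOn ℂ (upKernel φ ψ) (upRegion ρ) := by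
  refine DifferentiableOn.mul ?_ ?_
  · refine DifferentiableOn.comp (t := {ζ | ζ.re < ρ}) (f := fun q : ℂ × ℂ => upLog q.2) hφ ?_
      fun q hq => ?_
    · refine fun q hq => DifferentiableAt.differentiableWithinAt ?_
      exact (differentiableAt_upLog hq.1).differentiableAt.comp q differentiableAt_snd
    · have h0 : q.2 ≠ 0 := by
        intro h0; have := hq.1; simp [h0] at this
      simp only [Set.mem_ofPred_eq]
      rw [upLog_re, Real.log_lt_iff_lt_exp (norm_pos_iff.2 h0)]
      exact hq.2.1
  · refine DifferentiableOn.comp (t := {ζ | ζ.re < ρ})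
      (f := fun q : ℂ × ℂ => Complex.log (q.1 - q.2)) hψ ?_ fun q hq => ?_
    · exact DifferentiableOn.clog (by fun_prop) fun q hq => Or.inr hq.2.2.1.ne'
    · exact log_re_lt (ne_zero_of_im_pos hq.2.2.1) hq.2.2.2

theorem differentiableOn_upKernel_right {ρ : ℝ} {φ ψ : ℂ → ℂ} (hφ : φ ∈ holo ρ)
    (hψ : ψ ∈ holo ρ) (w : ℂ) :
    DifferentiableOn ℂ (fun v => upKernel φ ψ (w, v)) {v | (w, v) ∈ upRegion ρ} :=
  (differentiableOn_upKernel hφ hψ).comp (f := fun v => (w, v)) (by fun_prop) fun _ hv => hv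

theorem log_I_mul {τ : ℝ} (hτ : 0 < τ) :
    Complex.exp (Complex.log (τ * Complex.I)) = τ * Complex.I ∧
    (Complex.log (τ * Complex.I)).re = Real.log τ ∧
    (Complex.log (τ * Complex.I)).im = Real.pi / 2 := by
  refine ⟨Complex.exp_log (by simp [hτ.ne']), ?_, ?_⟩
  · rw [Complex.log_re]; simp [abs_of_pos hτ]
  · rw [Complex.log_im, Complex.arg_real_mul _ hτ, Complex.arg_I]

section Vertical

variable {ρ τ : ℝ} {φ ψ : ℂ → ℂ}

theorem log_I_mul_half_add (hτ : 0 < τ) (t : ℝ) :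
    Complex.log (τ * Complex.I * (1 / 2 + t * Complex.I)) =
      Complex.log (τ * Complex.I) + Complex.log (1 / 2 + t * Complex.I) := by
  obtain ⟨h1, h2, h3⟩ := log_I_mul hτ
  have harg := abs_lt.1 (Complex.abs_arg_lt_pi_div_two_iff (z := 1 / 2 + t * Complex.I).2
    (Or.inl (by simp)))
  refine log_eq_of_exp_eq ?_ (by simp [hτ]) ?_ ?_
  · rw [exp_log_half_add, h1]
  · rw [Complex.add_im, h3, Complex.log_im]; linarith [Real.pi_pos]
  · rw [Complex.add_im, h3, Complex.log_im]; linarith [Real.pi_pos]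

theorem upKernel_bridge (hτ : 0 < τ) (t : ℝ) :
    upKernel φ ψ (τ * Complex.I, τ * Complex.I * (1 / 2 + t * Complex.I)) =
      φ (Complex.log (τ * Complex.I) + Complex.log (1 / 2 + t * Complex.I)) *
        ψ (Complex.log (τ * Complex.I) + Complex.log (1 / 2 - t * Complex.I)) := by
  have hsub : (τ * Complex.I - τ * Complex.I * (1 / 2 + t * Complex.I) : ℂ) =
      τ * Complex.I * (1 / 2 + ((-t : ℝ) : ℂ) * Complex.I) := by
    push_cast; ring
  rw [upKernel, upLog_eq_log (by simp [hτ]), log_I_mul_half_add hτ, hsub,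
    log_I_mul_half_add hτ]
  push_cast
  rw [neg_mul, ← sub_eq_add_neg]

/-- For `w = iτ` the bridge is the horizontal segment at height `τ / 2` between `-2τ` and `2τ`,
traversed backwards. -/
theorem segInt_upKernel_bridge (hτ : 0 < τ) :
    segInt (fun v => upKernel φ ψ (τ * Complex.I, v))
      (τ * Complex.I * (1 / 2 + 2 * Complex.I)) (τ * Complex.I * (1 / 2 - 2 * Complex.I)) =
      -bridge φ ψ (Complex.log (τ * Complex.I)) := by
  -- The substitution `t = 2 - 4u`.
  have h := intervalIntegral.integral_comp_sub_mul (a := 0) (b := 1) (fun t : ℝ =>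
    φ (Complex.log (τ * Complex.I) + Complex.log (1 / 2 + t * Complex.I)) *
      ψ (Complex.log (τ * Complex.I) + Complex.log (1 / 2 - t * Complex.I)) *
      (Complex.exp (Complex.log (τ * Complex.I)) * Complex.I)) (c := 4) (by norm_num) 2
  norm_num at h
  rw [bridge]
  have hk : ∀ u : ℝ, (τ * Complex.I * (1 / 2 + 2 * Complex.I) + u *
      (τ * Complex.I * (1 / 2 - 2 * Complex.I) - τ * Complex.I * (1 / 2 + 2 * Complex.I)) : ℂ) =
      τ * Complex.I * (1 / 2 + ((2 - 4 * u : ℝ) : ℂ) * Complex.I) := fun u => by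
    push_cast; ring
  simp only [segInt, hk, upKernel_bridge hτ]
  norm_num
  rw [← sub_eq_zero]
  rw [(log_I_mul hτ).1] at h ⊢
  linear_combination (-4) * h

/-- A convex region around an arm. -/
def armSector (ε τ ρ : ℝ) : Set ℂ :=
  {v | 0 < ε * v.re ∧ 4.2 * τ < 2 * (ε * v.re) + v.im / 2 ∧ ‖v‖ < Real.exp (ρ - 1)}

theorem convex_armSector (ε τ ρ : ℝ) : Convex ℝ (armSector ε τ ρ) := by
  have hb : Convex ℝ {v : ℂ | ‖v‖ < Real.exp (ρ - 1)} := by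
    simpa [Metric.ball, dist_eq_norm] using convex_ball (0 : ℂ) (Real.exp (ρ - 1))
  have h1 : Convex ℝ {v : ℂ | 0 < ε * v.re} :=
    convex_halfSpace_gt (f := fun v : ℂ => ε * v.re) ⟨fun _ _ => by simp; ring,
      fun _ _ => by simp; ring⟩ 0
  have h2 : Convex ℝ {v : ℂ | 4.2 * τ < 2 * (ε * v.re) + v.im / 2} :=
    convex_halfSpace_gt (f := fun v : ℂ => 2 * (ε * v.re) + v.im / 2)
      ⟨fun _ _ => by simp; ring, fun _ _ => by simp; ring⟩ (4.2 * τ)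
  exact h1.inter (h2.inter hb)

/-- The constant `4.2` lies between `√17` and `4.25`. By Cauchy–Schwarz the half plane `2|x| + y/2 >
4.2 τ` misses the disc of radius `2τ`, while it still contains the junctions `±2τ + iτ/2`. -/
theorem mem_armStrip_of_mem_armSector {ε : ℝ} (hε : ε = 1 ∨ ε = -1) (hτ : 0 < τ) {v : ℂ}
    (hv : v ∈ armSector ε τ ρ) :
    upLog v ∈ {ζ : ℂ | (Complex.log (τ * Complex.I)).re + Real.log 2 < ζ.re ∧ ζ.re < ρ - 1} := by
  obtain ⟨h1, h2, h3⟩ := hv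
  have h0 : 0 < ‖v‖ := norm_pos_iff.2 (by rintro rfl; simp at h1)
  refine ⟨?_, by rwa [upLog_re, Real.log_lt_iff_lt_exp h0]⟩
  rw [(log_I_mul hτ).2.1, ← Real.log_mul hτ.ne' (by norm_num), upLog_re]
  refine Real.log_lt_log (by positivity) (lt_of_pow_lt_pow_left₀ 2 h0.le ?_)
  rw [← Complex.normSq_eq_norm_sq, Complex.normSq_apply]
  have hε2 : ε * ε = 1 := by rcases hε with rfl | rfl <;> norm_num
  have : v.re * v.re = (ε * v.re) * (ε * v.re) := by linear_combination (-(v.re * v.re)) * hε2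
  rw [this]
  generalize ε * v.re = x at *
  nlinarith [sq_nonneg (x - 4 * v.im), sq_nonneg (2 * x + v.im / 2 - 4.2 * τ)]

/-- Both are logarithms of a point of the upper half plane, so a rough bound on the imaginary part
decides. On the left arm `arg v > π/2` makes up for `c = -πi`; on the right arm `arg v < π/2` makes
room for `c = πi`. -/
theorem log_sub_eq_coLog {ε : ℝ} (hε : ε = 1 ∨ ε = -1) (hτ : 0 < τ) {v : ℂ}
    (hv : v ∈ armSector ε τ ρ) (h0 : 0 < v.im) (h1 : v.im < τ) :
    Complex.log (τ * Complex.I - v) =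
      coLog (ε * (Real.pi * Complex.I)) (Complex.log (τ * Complex.I)) (upLog v) := by
  have hs := mem_armStrip_of_mem_armSector hε hτ hv
  have him := abs_lt.1 (abs_log_one_sub_im_lt (norm_exp_sub_lt_half hs.1))
  have hexp := exp_coLog (c := ε * (Real.pi * Complex.I)) (by
    rcases hε with rfl | rfl
    · simp
    · simp) hs.1
  rw [exp_upLog (ne_zero_of_im_pos h0), (log_I_mul hτ).1] at hexp
  have hst := log_mem_strip h0
  rw [← upLog_eq_log h0] at hst
  have h0' := hst.1
  have h1' := hst.2
  have hlog : (upLog v).im = v.arg := by rw [upLog_eq_log h0, Complex.log_im]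
  refine log_eq_of_exp_eq hexp (by simp [h1]) ?_ ?_
  · rcases hε with rfl | rfl
    · simp only [coLog, Complex.add_im]
      simp
      linarith [Real.pi_pos]
    · have : Real.pi / 2 < (upLog v).im := by
        by_contra! hc
        rw [hlog] at hc h0'
        have := (Complex.abs_arg_le_pi_div_two_iff (z := v)).1 (abs_le.2 ⟨by linarith, hc⟩)
        have := hv.1
        linarith
      simp only [coLog, Complex.add_im]
      simp
      linarith [Real.pi_pos]
  · rcases hε with rfl | rfl
    · have : (upLog v).im < Real.pi / 2 := by
        rw [hlog]
        exact (abs_lt.1 (Complex.abs_arg_lt_pi_div_two_iff.2 (Or.inl (by simpa using hv.1)))).2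
      simp only [coLog, Complex.add_im]
      simp
      linarith [Real.pi_pos]
    · simp only [coLog, Complex.add_im]
      simp
      linarith [Real.pi_pos]

/-- Under `v = exp ζ` the arm kernel is the pullback of `upKernel`. With a primitive `F` of the
former, `F ∘ upLog` is a primitive on the convex sector, so the polygon in the `v`-plane and the
segment in the `ζ`-plane give the same difference. -/
theorem segInt_upKernel_arm (hφ : φ ∈ holo ρ) (hψ : ψ ∈ holo ρ) {ε l η : ℝ}
    (hε : ε = 1 ∨ ε = -1) (hτ : 0 < τ) (hl : 2.5 * τ < l) (hlρ : 2 * l < Real.exp (ρ - 1))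
    (hη : 0 < η) (hητ : η < τ) :
    segInt (fun v => upKernel φ ψ (τ * Complex.I, v)) (ε * l) (ε * l + η * Complex.I) +
      segInt (fun v => upKernel φ ψ (τ * Complex.I, v)) (ε * l + η * Complex.I)
        (τ * (2 * ε + Complex.I / 2)) =
    segInt (armKernel φ ψ (ε * (Real.pi * Complex.I)) (Complex.log (τ * Complex.I)))
      (upLog (ε * l)) (upLog (τ * (2 * ε + Complex.I / 2))) := by
  set ω := Complex.log (τ * Complex.I) with hω
  set c : ℂ := ε * (Real.pi * Complex.I) with hc
  have hd := differentiableOn_armKernel_right hφ hψ (c := c) (by simp [hc]) ω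
  obtain ⟨F, hF⟩ := exists_primitive (convex_armStrip ω ρ) (isOpen_armStrip ω ρ) hd
  have hε2 : ε * ε = 1 := by rcases hε with rfl | rfl <;> norm_num
  have hεn : |ε| = 1 := by rcases hε with rfl | rfl <;> norm_num
  have ha : (ε * l : ℂ) ∈ armSector ε τ ρ := by
    refine ⟨?_, ?_, ?_⟩
    · simp; nlinarith
    · simp; nlinarith
    · simp [hεn]; rw [abs_of_pos (by linarith)]; linarith
  have hb : (ε * l + η * Complex.I : ℂ) ∈ armSector ε τ ρ := by
    refine ⟨?_, ?_, ?_⟩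
    · simp; nlinarith
    · simp; nlinarith
    · refine (norm_add_le _ _).trans_lt ?_
      simp [hεn]; rw [abs_of_pos (by linarith), abs_of_pos hη]; linarith
  have hv : (τ * (2 * ε + Complex.I / 2) : ℂ) ∈ armSector ε τ ρ := by
    refine ⟨?_, ?_, ?_⟩
    · simp; nlinarith
    · simp; nlinarith
    · have : ‖(2 * ε + Complex.I / 2 : ℂ)‖ ≤ 2.5 := by
        refine (norm_add_le _ _).trans ?_
        simp [hεn]; norm_num
      rw [norm_mul, Complex.norm_real, Real.norm_of_nonneg hτ.le]
      nlinarith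
  have hne : ∀ v ∈ armSector ε τ ρ, v.re ≠ 0 := fun v hv h => by
    have := hv.1; simp [h] at this
  have hF' : ∀ v ∈ armSector ε τ ρ, HasDerivAt (fun v => F (upLog v))
      (φ (upLog v) * ψ (coLog c ω (upLog v))) v := fun v hv => by
    refine ((hF _ (mem_armStrip_of_mem_armSector hε hτ hv)).comp v
      (differentiableAt_upLog (Or.inr (hne v hv)))).congr_deriv ?_
    have h0 : v ≠ 0 := by
      rintro rfl; exact hne 0 hv rfl
    rw [armKernel, exp_upLog h0]
    field_simp
  have hc' : ContinuousOn (fun v => φ (upLog v) * ψ (coLog c ω (upLog v))) (armSector ε τ ρ) := by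
    have : ContinuousOn (fun v => armKernel φ ψ c ω (upLog v) * v⁻¹) (armSector ε τ ρ) := by
      refine (hd.continuousOn.comp (fun v hv => (differentiableAt_upLog
        (Or.inr (hne v hv))).continuousAt.continuousWithinAt)
        fun v hv => mem_armStrip_of_mem_armSector hε hτ hv).mul
        (continuousOn_id.inv₀ fun v hv => ?_)
      rintro rfl; exact hne 0 hv rfl
    refine this.congr fun v hv => ?_
    have h0 : v ≠ 0 := by
      rintro rfl; exact hne 0 hv rfl
    simp only [armKernel]
    rw [exp_upLog h0]
    field_simp
  have hcv := convex_armSector ε τ ρ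
  have hkey : ∀ a b : ℂ, a ∈ armSector ε τ ρ → b ∈ armSector ε τ ρ → 0 ≤ a.im → a.im < τ →
      0 < b.im → b.im < τ → segInt (fun v => upKernel φ ψ (τ * Complex.I, v)) a b =
        F (upLog b) - F (upLog a) := fun a b ha hb ha0 ha1 hb0 hb1 => by
    rw [← segInt_eq_sub hcv hF' hc' ha hb]
    refine segInt_congr fun t ht => ?_
    have hm := add_mul_sub_mem hcv ha hb (Set.Ioo_subset_Icc_self ht)
    have him : (a + t * (b - a)).im = (1 - t) * a.im + t * b.im := by simp; ring
    rw [upKernel, log_sub_eq_coLog hε hτ hm]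
    · rw [him]; nlinarith [ht.1, ht.2, mul_pos ht.1 hb0]
    · rw [him]; nlinarith [ht.1, ht.2]
  have hvim : (τ * (2 * ε + Complex.I / 2) : ℂ).im = τ / 2 := by simp; ring
  rw [hkey _ _ ha hb (by simp) (by simpa) (by simpa) (by simpa),
    hkey _ _ hb hv (by simpa using hη.le) (by simpa) (by rw [hvim]; linarith)
      (by rw [hvim]; linarith),
    segInt_eq_sub (convex_armStrip ω ρ) hF hd.continuousOn
      (mem_armStrip_of_mem_armSector hε hτ ha) (mem_armStrip_of_mem_armSector hε hτ hv)]
  ring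

/-- For `w` on the imaginary axis, the polygon can be deformed into the path that defines the
local convolution. -/
theorem detour_upKernel_I (hφ : φ ∈ holo ρ) (hψ : ψ ∈ holo ρ) {l₁ l₂ η : ℝ} (hτ : 0 < τ)
    (hl₁ : 2.5 * τ < l₁) (hl₁ρ : 2 * l₁ < Real.exp (ρ - 1))
    (hl₂ : 2.5 * τ < l₂) (hl₂ρ : 2 * l₂ < Real.exp (ρ - 1)) (hη : 0 < η) (hητ : η < τ) :
    detour (fun v => upKernel φ ψ (τ * Complex.I, v)) (-l₁) l₂ (η * Complex.I) =
      localConv l₁ l₂ φ ψ (Complex.log (τ * Complex.I)) := by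
  have hA := segInt_upKernel_arm hφ hψ (Or.inr rfl) hτ hl₁ hl₁ρ hη hητ
  have hB := segInt_upKernel_arm hφ hψ (Or.inl rfl) hτ hl₂ hl₂ρ hη hητ
  have hC := segInt_upKernel_bridge (φ := φ) (ψ := ψ) hτ
  have e1 : (τ * Complex.I * (1 / 2 + 2 * Complex.I) : ℂ) = τ * (2 * ((-1 : ℝ) : ℂ) +
      Complex.I / 2) := by
    push_cast; linear_combination (2 * τ : ℂ) * Complex.I_mul_I
  have e2 : (τ * Complex.I * (1 / 2 - 2 * Complex.I) : ℂ) = τ * (2 * ((1 : ℝ) : ℂ) +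
      Complex.I / 2) := by
    push_cast; linear_combination (-2 * τ : ℂ) * Complex.I_mul_I
  have u1 : upLog (τ * (2 * ((-1 : ℝ) : ℂ) + Complex.I / 2)) =
      Complex.log (τ * Complex.I) + junction := by
    rw [← e1, upLog_eq_log (by simp [hτ])]
    exact_mod_cast log_I_mul_half_add hτ 2
  have u2 : upLog (τ * (2 * ((1 : ℝ) : ℂ) + Complex.I / 2)) =
      Complex.log (τ * Complex.I) + (starRingEnd ℂ) junction := by
    rw [← e2, upLog_eq_log (by simp [hτ]), ← log_half_sub_two]
    have := log_I_mul_half_add hτ (-2)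
    push_cast at this
    rwa [neg_mul, ← sub_eq_add_neg] at this
  rw [u1] at hA
  rw [u2] at hB
  rw [e1, e2] at hC
  -- Between the two horizontal lines through `0` and `w` the kernel is holomorphic, so the edge at
  -- height `η` can be routed through both junctions at height `τ / 2`.
  set D : Set ℂ := {v | (0 < v.im ∧ v.im < τ) ∧ ‖v‖ < Real.exp (ρ - 1)} with hD
  have hDc : Convex ℝ D := by
    have hb : Convex ℝ {v : ℂ | ‖v‖ < Real.exp (ρ - 1)} := by
      simpa [Metric.ball, dist_eq_norm] using convex_ball (0 : ℂ) (Real.exp (ρ - 1))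
    exact ((convex_halfSpace_im_gt 0).inter (convex_halfSpace_im_lt τ)).inter hb
  have hDo : IsOpen D := ((isOpen_lt continuous_const Complex.continuous_im).inter
    (isOpen_lt Complex.continuous_im continuous_const)).inter
    (isOpen_lt continuous_norm continuous_const)
  have hexp : τ + Real.exp (ρ - 1) < Real.exp ρ := by
    have : Real.exp ρ = Real.exp (ρ - 1) * Real.exp 1 := by rw [← Real.exp_add]; congr 1; ring
    have := Real.exp_one_gt_d9
    nlinarith
  have hDd : DifferentiableOn ℂ (fun v => upKernel φ ψ (τ * Complex.I, v)) D := by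
    refine (differentiableOn_upKernel_right hφ hψ _).mono fun v hv => ?_
    refine ⟨Or.inl hv.1.1, ?_, by simpa using hv.1.2, ?_⟩
    · have := hv.2
      simp only
      linarith
    · refine (norm_sub_le _ _).trans_lt ?_
      have := hv.2
      simp [abs_of_pos hτ]
      linarith
  have hmem : ∀ x y : ℝ, 0 < y → y < τ → |x| + y < Real.exp (ρ - 1) → (x + y * Complex.I) ∈ D :=
    fun x y h0 h1 h2 => by
      refine ⟨⟨by simpa, by simpa⟩, (norm_add_le _ _).trans_lt ?_⟩
      simpa [abs_of_pos h0] using h2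
  have m1 : (-l₁ + η * Complex.I : ℂ) ∈ D := by
    have := hmem (-l₁) η hη hητ (by rw [abs_neg, abs_of_pos (by linarith)]; linarith)
    push_cast at this
    exact this
  have m2 : (l₂ + η * Complex.I : ℂ) ∈ D :=
    hmem l₂ η hη hητ (by rw [abs_of_pos (by linarith)]; linarith)
  have m3 : (τ * (2 * ((-1 : ℝ) : ℂ) + Complex.I / 2) : ℂ) ∈ D := by
    have := hmem (-(2 * τ)) (τ / 2) (by linarith) (by linarith)
      (by rw [abs_neg, abs_of_pos (by linarith)]; linarith)
    convert this using 1
    push_cast; ring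
  have m4 : (τ * (2 * ((1 : ℝ) : ℂ) + Complex.I / 2) : ℂ) ∈ D := by
    have := hmem (2 * τ) (τ / 2) (by linarith) (by linarith)
      (by rw [abs_of_pos (by linarith)]; linarith)
    convert this using 1
    push_cast; ring
  have hm := segInt_add hDc hDo hDd m1 m3 m2
  have hm' := segInt_add hDc hDo hDd m3 m4 m2
  rw [localConv, detour, arm, arm]
  have v1 : upLog (((-1 : ℝ) : ℂ) * l₁) = Real.log l₁ + Real.pi * Complex.I := by
    rw [← upLog_neg_ofReal (by linarith)]; push_cast; ring_nf
  have v2 : upLog (((1 : ℝ) : ℂ) * l₂) = Real.log l₂ := by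
    rw [← upLog_ofReal (by linarith)]; push_cast; ring_nf
  rw [v1] at hA
  rw [v2] at hB
  rw [segInt_symm _ l₂, ← hm, ← hm', segInt_symm _ (l₂ + η * Complex.I), hC]
  push_cast at hA hB ⊢
  simp only [neg_mul, one_mul] at hA hB
  rw [← hA, ← hB]
  ring

end Vertical

/-- Both sides are holomorphic in `w` on the part of the disc above height `η` and agree on the
imaginary axis; the identity theorem extends the equality. -/
theorem detour_upKernel {ρ μ l₁ l₂ η : ℝ} {φ ψ : ℂ → ℂ} (hφ : φ ∈ holo ρ) (hψ : ψ ∈ holo ρ)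
    (hl₁ : 0 < l₁) (hl₂ : 0 < l₂) (hl₁ρ : 2 * l₁ < Real.exp (ρ - 1))
    (hl₂ρ : 2 * l₂ < Real.exp (ρ - 1)) (hμ1 : μ ≤ Real.log l₁ - 1) (hμ2 : μ ≤ Real.log l₂ - 1)
    {w : ℂ} (hw : ‖w‖ < Real.exp μ) (hη : 0 < η) (hηw : η < w.im) :
    detour (fun v => upKernel φ ψ (w, v)) (-l₁) l₂ (η * Complex.I) =
      localConv l₁ l₂ φ ψ (Complex.log w) := by
  -- The margin `1` in the logarithm is worth a factor `e > 2.5`, the separation required on the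
  -- imaginary axis.
  have hexp : ∀ {l : ℝ}, 0 < l → μ ≤ Real.log l - 1 → 2.5 * Real.exp μ < l := fun {l} hl h => by
    have h1 : Real.exp μ ≤ Real.exp (Real.log l - 1) := Real.exp_le_exp.2 h
    have h2 : Real.exp (Real.log l - 1) * Real.exp 1 = l := by
      rw [← Real.exp_add, sub_add_cancel, Real.exp_log hl]
    have := Real.exp_one_gt_d9
    nlinarith [Real.exp_pos μ, Real.exp_pos (Real.log l - 1)]
  have hL : ∀ {l : ℝ}, 0 < l → 2 * l < Real.exp (ρ - 1) → Real.log l < ρ - 1 := fun hl h => by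
    rw [Real.log_lt_iff_lt_exp hl]; linarith
  have h1 := hexp hl₁ hμ1
  have h2 := hexp hl₂ hμ2
  have hρ : Real.exp (ρ - 1) < Real.exp ρ := Real.exp_lt_exp.2 (by linarith)
  have hR : ∀ R : ℝ, Convex ℝ {v : ℂ | ‖v‖ < R} := fun R => by
    simpa [Metric.ball, dist_eq_norm] using convex_ball (0 : ℂ) R
  set U : Set ℂ := {w | η < w.im ∧ ‖w‖ < Real.exp μ} with hU
  have hUc : Convex ℝ U := (convex_halfSpace_im_gt η).inter (hR _)
  have hUo : IsOpen U := (isOpen_lt continuous_const Complex.continuous_im).inter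
    (isOpen_lt continuous_norm continuous_const)
  have hημ : η < Real.exp μ := (hηw.trans_le (Complex.im_le_norm w)).trans hw
  have hreg : ∀ w ∈ U, ∀ v : ℂ, (0 < v.im ∨ v.re ≠ 0) → v.im ≤ η → ‖v‖ < max l₁ l₂ + η →
      (w, v) ∈ upRegion ρ := fun w hw v hv him hn => by
    have hmax : 2 * max l₁ l₂ < Real.exp (ρ - 1) := by
      rcases max_cases l₁ l₂ with h | h <;> linarith
    have hmax' := le_max_left l₁ l₂
    refine ⟨hv, ?_, ?_, ?_⟩
    · simp only; linarith
    · have := hw.1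
      simp only [Complex.sub_im]; linarith
    · have := norm_sub_le w v
      have := hw.2
      simp only; linarith
  have hd := differentiableOn_upKernel hφ hψ
  have hpt : ∀ x y : ℝ, 0 ≤ y → y ≤ η → |x| ≤ max l₁ l₂ → 0 < |x| →
      (x + y * Complex.I : ℂ).im ≤ η ∧ ‖(x + y * Complex.I : ℂ)‖ < max l₁ l₂ + η :=
    fun x y h0 h1 h2 h3 => by
      refine ⟨by simpa, lt_of_pow_lt_pow_left₀ 2 (by linarith [le_max_left l₁ l₂]) ?_⟩
      rw [← Complex.normSq_eq_norm_sq, Complex.normSq_apply]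
      simp
      nlinarith [sq_abs x, le_max_left l₁ l₂]
  have hDc : Convex ℝ {v : ℂ | v.im ≤ η ∧ ‖v‖ < max l₁ l₂ + η} :=
    (convex_halfSpace_im_le η).inter (hR _)
  have a0 := hpt (-l₁) 0 le_rfl hη.le (by rw [abs_neg, abs_of_pos hl₁]; exact le_max_left _ _)
    (by simp [hl₁.ne'])
  have a1 := hpt (-l₁) η hη.le le_rfl (by rw [abs_neg, abs_of_pos hl₁]; exact le_max_left _ _)
    (by simp [hl₁.ne'])
  have b0 := hpt l₂ 0 le_rfl hη.le (by rw [abs_of_pos hl₂]; exact le_max_right _ _)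
    (by simp [hl₂.ne'])
  have b1 := hpt l₂ η hη.le le_rfl (by rw [abs_of_pos hl₂]; exact le_max_right _ _)
    (by simp [hl₂.ne'])
  push_cast at a0 a1 b0 b1
  simp only [zero_mul, add_zero] at a0 b0
  have hlhs : DifferentiableOn ℂ (fun w => detour (fun v => upKernel φ ψ (w, v)) (-l₁) l₂
      (η * Complex.I)) U := by
    refine DifferentiableOn.add (DifferentiableOn.add
      (differentiableOn_segInt hUo hd (by fun_prop) (by fun_prop) fun w hw t ht => ?_)
      (differentiableOn_segInt hUo hd (by fun_prop) (by fun_prop) fun w hw t ht => ?_))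
      (differentiableOn_segInt hUo hd (by fun_prop) (by fun_prop) fun w hw t ht => ?_)
    · have := add_mul_sub_mem hDc a0 a1 ht
      refine hreg w hw _ (Or.inr ?_) this.1 this.2
      simp [hl₁.ne']
    · have := add_mul_sub_mem hDc a1 b1 ht
      refine hreg w hw _ (Or.inl ?_) this.1 this.2
      simp [hη]
    · have := add_mul_sub_mem hDc b1 b0 ht
      refine hreg w hw _ (Or.inr ?_) this.1 this.2
      simp [hl₂.ne']
  have hrhs : DifferentiableOn ℂ (fun w => localConv l₁ l₂ φ ψ (Complex.log w)) U := by
    have : DifferentiableOn ℂ (localConv l₁ l₂ φ ψ) {ζ | ζ.re < μ} :=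
      localConv_mem_holo hφ hψ (hL hl₁ hl₁ρ) (hL hl₂ hl₂ρ) hμ1 hμ2
    refine DifferentiableOn.comp (t := {ζ | ζ.re < μ}) this
      (f := Complex.log) (differentiableOn_id.clog fun w (hw : w ∈ U) =>
        Or.inr (hη.trans hw.1).ne') fun w hw => ?_
    exact log_re_lt (ne_zero_of_im_pos (hη.trans hw.1)) hw.2
  have hbase : ∀ τ : ℝ, η < τ → τ < Real.exp μ →
      detour (fun v => upKernel φ ψ (τ * Complex.I, v)) (-l₁) l₂ (η * Complex.I) =
        localConv l₁ l₂ φ ψ (Complex.log (τ * Complex.I)) := fun τ h3 h4 =>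
    detour_upKernel_I hφ hψ (hη.trans h3) (by linarith) hl₁ρ (by linarith) hl₂ρ hη h3
  have hτ : w.im < Real.exp μ := (Complex.im_le_norm w).trans_lt hw
  have hτU : (w.im * Complex.I : ℂ) ∈ U := by
    refine ⟨by simpa, ?_⟩
    simpa [abs_of_pos (hη.trans hηw)] using hτ
  -- The vertical segment around `i Im w` accumulates at an interior point of `U`, which suffices.
  refine (hlhs.analyticOnNhd hUo).eqOn_of_preconnected_of_frequently_eq (hrhs.analyticOnNhd hUo)
    hUc.isPreconnected hτU ?_ ⟨hηw, hw⟩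
  have ht : Tendsto (fun τ : ℝ => (τ * Complex.I : ℂ)) (𝓝[≠] w.im) (𝓝[≠] (w.im * Complex.I)) := by
    refine tendsto_nhdsWithin_of_tendsto_nhds_of_eventually_within _
      ((Continuous.tendsto (by fun_prop) w.im).mono_left nhdsWithin_le_nhds) ?_
    filter_upwards [self_mem_nhdsWithin] with τ hτ h
    have := congrArg Complex.im h
    simp at this
    exact hτ this
  refine ht.frequently (Eventually.frequently ?_)
  filter_upwards [nhdsWithin_le_nhds (Ioo_mem_nhds hηw hτ)] with τ hτ
  exact hbase τ hτ.1 hτ.2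

/-- The sign of the imaginary part on the side. -/
def Side.sgn : Side → ℝ
  | .left => 1
  | .right => -1

theorem Side.mem_halfPlane {s : Side} {w : ℂ} : w ∈ s.halfPlane ↔ 0 < s.sgn * w.im := by
  cases s <;> simp [Side.halfPlane, Side.sgn]

theorem detour_congr {Φ Ψ : ℂ → ℂ} {a b h : ℂ}
    (h1 : ∀ t ∈ Set.Ioo (0 : ℝ) 1, Φ (a + t * h) = Ψ (a + t * h))
    (h2 : ∀ t ∈ Set.Ioo (0 : ℝ) 1, Φ (a + h + t * (b - a)) = Ψ (a + h + t * (b - a)))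
    (h3 : ∀ t ∈ Set.Ioo (0 : ℝ) 1, Φ (b + t * h) = Ψ (b + t * h)) :
    detour Φ a b h = detour Ψ a b h := by
  have e1 : segInt Φ a (a + h) = segInt Ψ a (a + h) :=
    segInt_congr fun t ht => by rw [add_sub_cancel_left]; exact h1 t ht
  have e2 : segInt Φ (a + h) (b + h) = segInt Ψ (a + h) (b + h) :=
    segInt_congr fun t ht => by rw [add_sub_add_right_eq_sub]; exact h2 t ht
  have e3 : segInt Φ b (b + h) = segInt Ψ b (b + h) :=
    segInt_congr fun t ht => by rw [add_sub_cancel_left]; exact h3 t ht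
  rw [detour, detour, e1, e2, segInt_symm Φ b, e3, segInt_symm Ψ b]

/-- A local integral along a path that is pinched between a singularity of `kF` at `0` and one of
`v ↦ kG (w - v)` at `w`, as a function of `w` on the left side. -/
theorem MonodromyClass.exists_detour_left {kF kG : ℂ → ℂ} {P R : ℂ[X]}
    (hF : MonodromyClass kF .left P) (hG : MonodromyClass kG .left R) (hP : P.Monic)
    (hR : R.Monic) : ∃ ε > 0, ∀ l₁ l₂ : ℝ, 0 < l₁ → l₁ < ε → 0 < l₂ → l₂ < ε → ∃ δ > 0,
      ∃ k : ℂ → ℂ, MonodromyClass k .left (tensorPoly P R) ∧ ∀ w : ℂ, ‖w‖ < δ → ∀ η : ℝ, 0 < η →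
        η < w.im → detour (fun v => kF v * kG (w - v)) (-l₁) l₂ (η * Complex.I) = k w := by
  obtain ⟨ρ₀, φ, f1, f2, f3, f4⟩ := hF
  obtain ⟨ρ, hρ, ψ, g1, g2, g3, g4⟩ := hG.exists_lt ρ₀
  replace f1 := holo_mono hρ f1
  replace f4 := descends_mono hρ f4
  replace f2 : ∀ ζ ∈ Side.left.strip, ζ.re < ρ → kF (Complex.exp ζ) = φ ζ :=
    fun ζ h h' => f2 ζ h (h'.trans_le hρ)
  have hval : ∀ {k φ : ℂ → ℂ}, (∀ ζ ∈ Side.left.strip, ζ.re < ρ → k (Complex.exp ζ) = φ ζ) →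
      ∀ v : ℂ, 0 < v.im → ‖v‖ < Real.exp ρ → k v = φ (Complex.log v) := fun hk v hv hn => by
    have h0 := ne_zero_of_im_pos hv
    rw [← hk _ (log_mem_strip hv) (log_re_lt h0 hn), Complex.exp_log h0]
  refine ⟨Real.exp (ρ - 1) / 2, by positivity, fun l₁ l₂ h1 h1' h2 h2' => ?_⟩
  have hρ' : Real.exp (ρ - 1) < Real.exp ρ := Real.exp_lt_exp.2 (by linarith)
  have hL : ∀ {l : ℝ}, 0 < l → l < Real.exp (ρ - 1) / 2 → Real.log l < ρ - 1 := fun hl h => by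
    rw [Real.log_lt_iff_lt_exp hl]; linarith [Real.exp_pos (ρ - 1)]
  obtain ⟨ρ₁, h3⟩ := aeval_localConv_mem_descendsGerm f1 g1 (hL h1 h1') (hL h2 h2') hP hR f4 g4
  set μ := min (Real.log l₁) (Real.log l₂) - 1 with hμ
  have hμ1 : μ ≤ Real.log l₁ - 1 := by linarith [min_le_left (Real.log l₁) (Real.log l₂)]
  have hμ2 : μ ≤ Real.log l₂ - 1 := by linarith [min_le_right (Real.log l₁) (Real.log l₂)]
  refine ⟨Real.exp μ, Real.exp_pos μ, fun w => localConv l₁ l₂ φ ψ (Complex.log w),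
    ⟨min μ ρ₁, localConv l₁ l₂ φ ψ, holo_mono (min_le_left _ _) (localConv_mem_holo f1 g1
      (hL h1 h1') (hL h2 h2') hμ1 hμ2), fun ζ hζ _ => ?_, localConv_mem_integ f1 g1 f3 g3
      (hL h1 h1') (hL h2 h2'), descends_mono (min_le_right _ _) h3⟩, fun w hw η hη hηw => ?_⟩
  · beta_reduce
    rw [Complex.log_exp (by linarith [hζ.1, Real.pi_pos]) hζ.2.le]
  beta_reduce
  rw [← detour_upKernel f1 g1 h1 h2 (by linarith) (by linarith) hμ1 hμ2 hw hη hηw]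
  have hexp : ∀ {l : ℝ}, 0 < l → μ ≤ Real.log l - 1 → Real.exp μ < l := fun {l} hl h => by
    rw [← Real.lt_log_iff_exp_lt hl]; linarith
  have hl1 := hexp h1 hμ1
  have hl2 := hexp h2 hμ2
  have hημ : η < Real.exp μ := (hηw.trans_le (Complex.im_le_norm w)).trans hw
  have hfin : ∀ v : ℂ, 0 < v.im → v.im ≤ η → |v.re| ≤ max l₁ l₂ →
      kF v * kG (w - v) = upKernel φ ψ (w, v) := fun v hv hvη hn => by
    have hmax : max l₁ l₂ < Real.exp (ρ - 1) / 2 := max_lt h1' h2'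
    have hmax' := le_max_left l₁ l₂
    have hv2 := Complex.norm_le_abs_re_add_abs_im v
    rw [abs_of_pos hv] at hv2
    have hexp2 : Real.exp (ρ - 1) * 2 ≤ Real.exp ρ := by
      have : Real.exp ρ = Real.exp (ρ - 1) * Real.exp 1 := by rw [← Real.exp_add]; congr 1; ring
      have := Real.exp_one_gt_d9
      nlinarith [Real.exp_pos (ρ - 1)]
    have := norm_sub_le w v
    rw [upKernel, hval f2 v hv (by linarith), upLog_eq_log hv, hval g2 (w - v)
      (by simp only [Complex.sub_im]; linarith) (by linarith)]
  have hm1 := le_max_left l₁ l₂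
  have hm2 := le_max_right l₁ l₂
  refine detour_congr (fun t ht => hfin _ ?_ ?_ ?_) (fun t ht => hfin _ ?_ ?_ ?_)
    (fun t ht => hfin _ ?_ ?_ ?_)
  · simp; exact mul_pos ht.1 hη
  · simp; nlinarith [ht.2]
  · simp [abs_of_pos h1]
  · simp [hη]
  · simp
  · simp only [Complex.add_re, Complex.neg_re, Complex.ofReal_re, Complex.mul_I_re,
      Complex.ofReal_im, Complex.re_ofReal_mul, Complex.sub_re]
    rw [abs_le]
    constructor <;> nlinarith [ht.1, ht.2]
  · simp; exact mul_pos ht.1 hη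
  · simp; nlinarith [ht.2]
  · simp [abs_of_pos h2]

/-- A local integral along a path that is pinched between a singularity of `kF` at `0` and one of
`v ↦ kG (w - v)` at `w`, as a function of `w`. -/
theorem MonodromyClass.exists_detour {kF kG : ℂ → ℂ} {s : Side} {P R : ℂ[X]}
    (hF : MonodromyClass kF s P) (hG : MonodromyClass kG s R) (hP : P.Monic) (hR : R.Monic) :
    ∃ ε > 0, ∀ l₁ l₂ : ℝ, 0 < l₁ → l₁ < ε → 0 < l₂ → l₂ < ε → ∃ δ > 0,
      ∃ k : ℂ → ℂ, MonodromyClass k s (tensorPoly P R) ∧ ∀ w : ℂ, ‖w‖ < δ → ∀ η : ℝ, 0 < η →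
        η < s.sgn * w.im →
        detour (fun v => kF v * kG (w - v)) (-l₁) l₂ (s.sgn * η * Complex.I) = k w := by
  cases s with
  | left => simpa [Side.sgn] using hF.exists_detour_left hG hP hR
  | right =>
    -- The reflection `v ↦ -v` exchanges the sides and the two ends of the path; hence the swap of
    -- `l₁` and `l₂`.
    obtain ⟨ε, hε, h⟩ := hF.comp_neg_left.exists_detour_left hG.comp_neg_left hP hR
    refine ⟨ε, hε, fun l₁ l₂ h1 h1' h2 h2' => ?_⟩
    obtain ⟨δ, hδ, k, hk, hkw⟩ := h l₂ l₁ h2 h2' h1 h1'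
    refine ⟨δ, hδ, fun w => k (-w), hk.comp_neg_right, fun w hw η hη hηw => ?_⟩
    have := hkw (-w) (by rwa [norm_neg]) η hη (by simpa [Side.sgn] using hηw)
    beta_reduce
    rw [← this, show (fun v => kF (-v) * kG (-(-w - v))) =
      fun v => (fun v => kF v * kG (w - v)) (-v) by ext v; simp only []; ring_nf,
      detour_comp_neg (fun v => kF v * kG (w - v)), ← detour_swap]
    simp [Side.sgn]

/-! ### Cousin's lemma. -/

/-- Cousin's lemma for an additive property of intervals with end points in a set of good points
whose complement is discrete. -/
theorem of_locally_of_trans {Q : ℝ → ℝ → Prop} {G : ℝ → Prop} {a b : ℝ}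
    (htrans : ∀ u v w, a ≤ u → w ≤ b → u < v → v < w → G u → G v → G w → Q u v → Q v w → Q u w)
    (hG : ∀ x ∈ Set.Icc a b, ∀ᶠ y in 𝓝[≠] x, G y)
    (hloc : ∀ x ∈ Set.Icc a b, ∃ δ > 0, ∀ u v, G u → G v → x - δ < u → u ≤ x → x ≤ v →
      v < x + δ → u < v → Q u v)
    (ha : G a) (hb : G b) (hab : a < b) : Q a b := by
  set E : Set ℝ := {x | (a < x ∧ x ≤ b) ∧ G x ∧ Q a x} with hE
  have hpick : ∀ x ∈ Set.Icc a b, x < b → ∀ δ > 0, ∃ v, x < v ∧ v < x + δ ∧ v < b ∧ G v :=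
    fun x hx hxb δ hδ => by
      have h1 : ∀ᶠ y in 𝓝[>] x, G y := (hG x hx).filter_mono (nhdsWithin_mono x fun y hy => hy.ne')
      have h2 : ∀ᶠ y in 𝓝[>] x, y < min (x + δ) b :=
        nhdsWithin_le_nhds (Iio_mem_nhds (lt_min (by linarith) hxb))
      obtain ⟨v, hv1, hv2, hv3⟩ := (h1.and (h2.and self_mem_nhdsWithin)).exists
      exact ⟨v, hv3, hv2.trans_le (min_le_left _ _), hv2.trans_le (min_le_right _ _), hv1⟩
  have hne : E.Nonempty := by
    have haI : a ∈ Set.Icc a b := ⟨le_rfl, hab.le⟩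
    obtain ⟨δ, hδ, h⟩ := hloc a haI
    obtain ⟨v, h1, h2, h3, h4⟩ := hpick a haI hab δ hδ
    exact ⟨v, ⟨h1, h3.le⟩, h4, h a v ha h4 (by linarith) le_rfl h1.le h2 h1⟩
  have hbdd : BddAbove E := ⟨b, fun x hx => hx.1.2⟩
  have hc : sSup E ∈ Set.Icc a b := by
    obtain ⟨x, hx⟩ := hne
    exact ⟨hx.1.1.le.trans (le_csSup hbdd hx), csSup_le ⟨x, hx⟩ fun y hy => hy.1.2⟩
  obtain ⟨δ, hδ, h⟩ := hloc _ hc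
  obtain ⟨u, hu, hcu⟩ := exists_lt_of_lt_csSup hne (show sSup E - δ < sSup E by linarith)
  have huc := le_csSup hbdd hu
  -- The supremum itself need not be a good point. It is bridged by one local interval from a good
  -- `u` below it to a good `v` above it, or to `b`.
  rcases hc.2.lt_or_eq with hlt | heq
  · obtain ⟨v, h1, h2, h3, h4⟩ := hpick _ hc hlt δ hδ
    have huv := huc.trans_lt h1
    have hv : v ∈ E := ⟨⟨hu.1.1.trans huv, h3.le⟩, h4, htrans a u v le_rfl h3.le hu.1.1 huv ha hu.2.1 h4 hu.2.2
      (h u v hu.2.1 h4 hcu huc h1.le h2 huv)⟩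
    exact absurd (le_csSup hbdd hv) (not_le.2 h1)
  · rcases hu.1.2.lt_or_eq with h5 | h5
    · exact htrans a u b le_rfl le_rfl hu.1.1 h5 ha hu.2.1 hb hu.2.2
        (h u b hu.2.1 hb hcu huc heq.le (by linarith) h5)
    · rw [← h5]; exact hu.2.2

/-! ### Sectors inside star domains of locally finite sets. -/

section Star

variable {S : Set ℂ}

theorem smul_mem_starDomain {z : ℂ} (hz : z ∈ starDomain S) {t : ℝ} (ht : t ∈ Set.Icc (0 : ℝ) 1) :
    (t : ℂ) * z ∈ starDomain S := fun u hu => by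
  have := hz (u * t) ⟨mul_nonneg hu.1 ht.1, mul_le_one₀ hu.2 ht.1 ht.2⟩
  rwa [Complex.ofReal_mul, mul_assoc] at this

theorem notMem_of_mem_starDomain {z : ℂ} (hz : z ∈ starDomain S) : z ∉ S := by
  simpa using hz 1 ⟨zero_le_one, le_rfl⟩

/-- `starDomain` is closed under decreasing the real part of the logarithm. -/
theorem mul_exp_mem_starDomain {q a b : ℂ} (h : q * Complex.exp a ∈ starDomain S)
    (hre : b.re ≤ a.re) (him : b.im = a.im) : q * Complex.exp b ∈ starDomain S := by
  have : q * Complex.exp b = (Real.exp (b.re - a.re) : ℝ) * (q * Complex.exp a) := by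
    have : b = ((b.re - a.re : ℝ) : ℂ) + a := by
      apply Complex.ext <;> simp [him]
    rw [this, Complex.exp_add]
    push_cast
    simp
    ring
  rw [this]
  exact smul_mem_starDomain h ⟨(Real.exp_pos _).le, Real.exp_le_one_iff.2 (by linarith)⟩

theorem exp_mem_starDomain {a b : ℂ} (h : Complex.exp a ∈ starDomain S)
    (hre : b.re ≤ a.re) (him : b.im = a.im) : Complex.exp b ∈ starDomain S := by
  simpa using mul_exp_mem_starDomain (q := 1) (by simpa using h) hre him

theorem isClosed_of_locallyFinite (hS : ∀ R : ℝ, (S ∩ Metric.closedBall 0 R).Finite) :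
    IsClosed S := by
  rw [← isOpen_compl_iff, isOpen_iff_mem_nhds]
  intro x hx
  have h1 : (S ∩ Metric.closedBall 0 (‖x‖ + 1))ᶜ ∈ 𝓝 x :=
    (hS _).isClosed.isOpen_compl.mem_nhds fun h => hx h.1
  filter_upwards [h1, Metric.ball_mem_nhds x one_pos] with y hy hyx hyS
  refine hy ⟨hyS, ?_⟩
  rw [mem_closedBall_zero_iff]
  have := norm_sub_norm_le y x
  rw [Metric.mem_ball, dist_eq_norm] at hyx
  linarith

theorem isOpen_starDomain (hS : ∀ R : ℝ, (S ∩ Metric.closedBall 0 R).Finite) :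
    IsOpen (starDomain S) := by
  rw [isOpen_iff_mem_nhds]
  intro z hz
  refine (isCompact_Icc (a := (0 : ℝ)) (b := 1)).eventually_forall_of_forall_eventually
    (P := fun z (t : ℝ) => (t : ℂ) * z ∉ S) fun t ht => ?_
  have : Continuous fun q : ℂ × ℝ => (q.2 : ℂ) * q.1 := by fun_prop
  exact (this.tendsto (z, t)).eventually
    ((isClosed_of_locallyFinite hS).isOpen_compl.mem_nhds (hz t ht))

theorem exists_ball_subset_starDomain (hS : ∀ R : ℝ, (S ∩ Metric.closedBall 0 R).Finite)
    (h0 : (0 : ℂ) ∉ S) : ∃ r > 0, ∀ z : ℂ, ‖z‖ < r → z ∈ starDomain S := by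
  have h : starDomain S ∈ 𝓝 (0 : ℂ) := (isOpen_starDomain hS).mem_nhds fun t _ => by simpa
  obtain ⟨r, hr, h⟩ := Metric.mem_nhds_iff.1 h
  exact ⟨r, hr, fun z hz => h (by simpa using hz)⟩

/-- Two distinct solutions differ by at least `2π`, so within distance `1` there is no second one.
-/
theorem eventually_exp_mul_I_ne (c : ℂ) (θ : ℝ) :
    ∀ᶠ y : ℝ in 𝓝[≠] θ, Complex.exp (y * Complex.I) ≠ c := by
  by_cases h : Complex.exp (θ * Complex.I) = c
  · filter_upwards [self_mem_nhdsWithin,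
      nhdsWithin_le_nhds (Ioo_mem_nhds (show θ - 1 < θ by linarith) (show θ < θ + 1 by linarith))]
      with y hy hy2 h1
    rw [← h, Complex.exp_eq_exp_iff_exists_int] at h1
    obtain ⟨n, hn⟩ := h1
    have := congrArg Complex.im hn
    simp at this
    have hn0 : n ≠ 0 := by
      rintro rfl
      exact hy (by simpa using this)
    have h2 : (1 : ℝ) ≤ |(n : ℝ)| := by exact_mod_cast Int.one_le_abs hn0
    have h3 : |(n : ℝ) * (2 * Real.pi)| < 1 := by
      rw [abs_lt]; constructor <;> linarith [hy2.1, hy2.2]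
    rw [abs_mul, abs_of_pos Real.two_pi_pos] at h3
    nlinarith [Real.pi_gt_three]
  · exact nhdsWithin_le_nhds ((Continuous.continuousAt (by fun_prop)).eventually_ne h)

/-- A ray is isolated among the rays that meet a locally finite set at bounded distance. -/
theorem exists_punctured_sector (hS : ∀ R : ℝ, (S ∩ Metric.closedBall 0 R).Finite)
    (h0 : (0 : ℂ) ∉ S) (θ X : ℝ) : ∃ κ > 0, ∀ s : ℂ, s.re ≤ X → 0 < |s.im - θ| →
      |s.im - θ| < κ → Complex.exp s ∈ starDomain S := by
  have h := (Filter.eventually_all_finite (hS (Real.exp X))).2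
    fun α _ => eventually_exp_mul_I_ne (α / ‖α‖) θ
  obtain ⟨κ, hκ, h⟩ := Metric.eventually_nhds_iff.1 (eventually_nhdsWithin_iff.1 h)
  refine ⟨κ, hκ, fun s hs h1 h2 t ht htS => ?_⟩
  have hne : s.im ≠ θ := fun h => by simp [h] at h1
  have ht0 : 0 < t := lt_of_le_of_ne ht.1 fun h => h0 (by simpa [← h] using htS)
  have hn : ‖(t : ℂ) * Complex.exp s‖ = t * Real.exp s.re := by
    rw [norm_mul, Complex.norm_real, Real.norm_of_nonneg ht.1, Complex.norm_exp]
  refine h (y := s.im) (by rwa [Real.dist_eq]) hne _ ⟨htS, ?_⟩ ?_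
  · rw [mem_closedBall_zero_iff, hn]
    calc t * Real.exp s.re ≤ 1 * Real.exp s.re := by gcongr; exact ht.2
      _ ≤ Real.exp X := by rw [one_mul]; exact Real.exp_le_exp.2 hs
  · rw [hn, eq_div_iff (by
      exact_mod_cast (mul_pos ht0 (Real.exp_pos _)).ne')]
    conv_rhs => rw [← Complex.re_add_im s, Complex.exp_add]
    push_cast
    ring

/-- The same around `q exp s`. -/
theorem exists_punctured_sector_mul (hS : ∀ R : ℝ, (S ∩ Metric.closedBall 0 R).Finite)
    (h0 : (0 : ℂ) ∉ S) {q : ℂ} (hq : q ≠ 0) (X : ℝ) : ∃ κ > 0, ∀ s : ℂ, s.re ≤ X → s.im ≠ 0 →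
      |s.im| < κ → q * Complex.exp s ∈ starDomain S := by
  obtain ⟨κ, hκ, h⟩ := exists_punctured_sector hS h0 (Complex.log q).im (X + (Complex.log q).re)
  refine ⟨κ, hκ, fun s h1 h2 h3 => ?_⟩
  have := h (Complex.log q + s) (by rw [Complex.add_re]; linarith)
    (by simpa using h2) (by simpa using h3)
  rwa [Complex.exp_add, Complex.exp_log hq] at this

/-- A compact piece of a circle inside `starDomain` has a sectorial neighbourhood inside it. -/
theorem exists_sector (hS : ∀ R : ℝ, (S ∩ Metric.closedBall 0 R).Finite) (q : ℂ) {a b y : ℝ}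
    (h : ∀ t ∈ Set.uIcc a b, q * Complex.exp (y + t * Complex.I) ∈ starDomain S) :
    ∃ κ > 0, ∀ s : ℂ, s.re < y + κ → min a b - κ < s.im → s.im < max a b + κ →
      q * Complex.exp s ∈ starDomain S := by
  have ho : IsOpen {s : ℂ | q * Complex.exp s ∈ starDomain S} :=
    (isOpen_starDomain hS).preimage (by fun_prop)
  have hc : IsCompact ((fun t : ℝ => (y + t * Complex.I : ℂ)) '' Set.uIcc a b) :=
    isCompact_uIcc.image (by fun_prop)
  obtain ⟨κ, hκ, hsub⟩ := hc.exists_thickening_subset_open ho (by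
    rintro _ ⟨t, ht, rfl⟩
    exact h t ht)
  refine ⟨κ / 2, by positivity, fun s h1 h2 h3 => ?_⟩
  -- Clamp the angle of `s` to the interval, raise the real part to `y + κ / 2` inside the
  -- thickening, then return to `s` along the ray.
  set t : ℝ := max (min a b) (min s.im (max a b)) with ht
  have htm : t ∈ Set.uIcc a b := by
    rw [Set.uIcc, Set.mem_Icc]
    exact ⟨le_max_left _ _, max_le (min_le_max) (min_le_right _ _)⟩
  have hts : |s.im - t| < κ / 2 := by
    have : min a b ≤ max a b := min_le_max
    rw [ht, abs_lt]
    constructor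
    · have : max (min a b) (min s.im (max a b)) < s.im + κ / 2 :=
        max_lt (by linarith) (by linarith [min_le_left s.im (max a b)])
      linarith
    · have : min s.im (max a b) > s.im - κ / 2 := lt_min (by linarith) (by linarith)
      linarith [le_max_right (min a b) (min s.im (max a b))]
  have hm : (((y + κ / 2 : ℝ) : ℂ) + s.im * Complex.I) ∈ Metric.thickening κ
      ((fun t : ℝ => (y + t * Complex.I : ℂ)) '' Set.uIcc a b) := by
    rw [Metric.mem_thickening_iff]
    refine ⟨_, ⟨t, htm, rfl⟩, ?_⟩
    rw [dist_eq_norm]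
    have : (((y + κ / 2 : ℝ) : ℂ) + s.im * Complex.I - (y + t * Complex.I)) =
        ((κ / 2 : ℝ) : ℂ) + ((s.im - t : ℝ) : ℂ) * Complex.I := by push_cast; ring
    rw [this]
    refine (norm_add_le _ _).trans_lt ?_
    rw [norm_mul, Complex.norm_I, mul_one, Complex.norm_real, Complex.norm_real, Real.norm_eq_abs,
      Real.norm_eq_abs, abs_of_pos (by positivity : 0 < κ / 2)]
    linarith
  exact mul_exp_mem_starDomain (hsub hm) (by simp; linarith) (by simp)

end Star

/-! ### Side germs in logarithmic coordinates. -/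

/-- Passage to a logarithmic coordinate. -/
theorem MonodromyClass.to_exp {f : ℂ → ℂ} {s : Side} {α : ℂ} {P : ℂ[X]}
    (h : MonodromyClass (fun w => f (α + α * w)) s P) :
    MonodromyClass (fun w => f (α * Complex.exp w)) s P := by
  have him : ∀ w : ℂ, (Complex.exp w - 1).im = Real.exp w.re * Real.sin w.im := fun w => by
    rw [Complex.sub_im, Complex.exp_im, Complex.one_im, sub_zero]
  have hb : ∀ w ∈ Metric.ball (0 : ℂ) 1, |w.im| < 1 := fun w hw =>
    (Complex.abs_im_le_norm w).trans_lt (by simpa using hw)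
  -- The coordinate change `exp w - 1` respects the half planes: the sign of its imaginary part is
  -- that of `sin (Im w)`.
  have := h.comp (E := fun w => Complex.exp w - 1) one_pos (by fun_prop) (by simp)
    (by simpa using (Complex.hasDerivAt_exp 0).sub_const 1) (fun w hw h => by
      rw [him]
      exact mul_pos (Real.exp_pos _) (Real.sin_pos_of_pos_of_lt_pi h
        (by linarith [(abs_lt.1 (hb w hw)).2, Real.pi_gt_three]))) (fun w hw h => by
      rw [him]
      exact mul_neg_of_pos_of_neg (Real.exp_pos _) (Real.sin_neg_of_neg_of_neg_pi_lt h
        (by linarith [(abs_lt.1 (hb w hw)).1, Real.pi_gt_three])))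
  convert this using 3
  ring

/-- Return from a logarithmic coordinate. -/
theorem MonodromyClass.of_exp {f : ℂ → ℂ} {s : Side} {α : ℂ} {P : ℂ[X]}
    (h : MonodromyClass (fun w => f (α * Complex.exp w)) s P) :
    MonodromyClass (fun w => f (α + α * w)) s P := by
  have hsl : ∀ w ∈ Metric.ball (0 : ℂ) 1, 1 + w ∈ Complex.slitPlane := fun w hw =>
    Complex.mem_slitPlane_of_norm_lt_one (by simpa using hw)
  have := h.comp (E := fun w => Complex.log (1 + w)) one_pos
    (DifferentiableOn.clog (by fun_prop) hsl) (by simp)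
    (by simpa using ((hasDerivAt_id (0 : ℂ)).const_add 1).clog (by simp)) (fun w hw h => by
      rw [Complex.log_im]
      refine lt_of_le_of_ne (Complex.arg_nonneg_iff.2 (by simpa using h.le)) fun h0 => ?_
      have := (Complex.arg_eq_zero_iff.1 h0.symm).2
      simp at this
      linarith) (fun w hw h => by
      rw [Complex.log_im]
      exact Complex.arg_neg_iff.2 (by simpa using h))
  refine this.congr one_pos fun w _ hw => ?_
  rw [Complex.exp_log (Complex.slitPlane_ne_zero (hsl w (by simpa using hw)))]
  ring_nf

/-! ### Hooks, termwise integration and Taylor coefficients. -/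

/-- Termwise integration of a power series along a segment. -/
theorem hasSum_segInt {a b : ℂ} {Φ u : ℂ → ℂ} (hΦ : ContinuousOn Φ (segment ℝ a b))
    (hu : ContinuousOn u (segment ℝ a b)) {R : ℝ} (huR : ∀ s ∈ segment ℝ a b, ‖u s‖ ≤ R)
    {C : ℕ → ℂ} (hC : Summable fun n => ‖C n‖ * R ^ n) {V : ℂ → ℂ}
    (hV : ∀ s ∈ segment ℝ a b, HasSum (fun n => C n * u s ^ n) (V s)) :
    HasSum (fun n => C n * segInt (fun s => Φ s * u s ^ n) a b)
      (segInt (fun s => Φ s * V s) a b) := by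
  have hγ : ∀ t ∈ Set.Icc (0 : ℝ) 1, a + t * (b - a) ∈ segment ℝ a b := fun t ht =>
    add_mul_sub_mem (convex_segment a b) (left_mem_segment ℝ a b) (right_mem_segment ℝ a b) ht
  have hsub : Set.uIoc (0 : ℝ) 1 ⊆ Set.Icc 0 1 := by
    rw [Set.uIoc_of_le zero_le_one]; exact Set.Ioc_subset_Icc_self
  have hcont : ContinuousOn (fun t : ℝ => a + t * (b - a)) (Set.Icc 0 1) := by fun_prop
  have hcpt : IsCompact (segment ℝ a b) := by
    rw [segment_eq_image']; exact isCompact_Icc.image (by fun_prop)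
  obtain ⟨M, hM⟩ := hcpt.exists_bound_of_continuousOn hΦ
  have key := intervalIntegral.hasSum_integral_of_dominated_convergence
    (μ := MeasureTheory.volume) (a := 0) (b := 1)
    (F := fun n (t : ℝ) => Φ (a + t * (b - a)) * (C n * u (a + t * (b - a)) ^ n))
    (f := fun t : ℝ => Φ (a + t * (b - a)) * V (a + t * (b - a)))
    (fun n _ => M * (‖C n‖ * R ^ n)) (fun n => ?_) (fun n => MeasureTheory.ae_of_all _ fun t ht => ?_)
    (MeasureTheory.ae_of_all _ fun t ht => hC.mul_left M) intervalIntegrable_const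
    (MeasureTheory.ae_of_all _ fun t ht => (hV _ (hγ t (hsub ht))).mul_left _)
  · have := key.mul_left (b - a)
    refine this.congr_fun fun n => ?_
    rw [segInt]
    rw [show C n * ((b - a) * ∫ t in (0 : ℝ)..1, Φ (a + t * (b - a)) * u (a + t * (b - a)) ^ n) =
      (b - a) * (C n * ∫ t in (0 : ℝ)..1, Φ (a + t * (b - a)) * u (a + t * (b - a)) ^ n) by ring,
      ← intervalIntegral.integral_const_mul]
    congr 2
    ext t
    ring
  · refine ContinuousOn.aestronglyMeasurable ?_ measurableSet_uIoc
    exact ((hΦ.comp hcont hγ).mul (continuousOn_const.mul ((hu.comp hcont hγ).pow n))).mono hsub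
  · have hm := hγ t (hsub ht)
    have h1 := huR _ hm
    rw [norm_mul, norm_mul, norm_pow]
    gcongr
    · exact (norm_nonneg _).trans (hM _ hm)
    · exact hM _ hm

theorem summable_norm_mul_pow {C : ℕ → ℂ} {g : ℂ → ℂ} {r : ℝ}
    (hg : ∀ z : ℂ, ‖z‖ < r → HasSum (fun n => C n * z ^ n) (g z)) {R : ℝ} (h0 : 0 ≤ R)
    (hR : R < r) : Summable fun n => ‖C n‖ * R ^ n := by
  have := (hg R (by rwa [Complex.norm_real, Real.norm_of_nonneg h0])).summable.norm
  simpa [abs_of_nonneg h0] using this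

/-- The integral along the path `x + ia → y + ia → y + ib → x + ib`. -/
noncomputable def hook (Φ : ℂ → ℂ) (x y a b : ℝ) : ℂ :=
  segInt Φ (x + a * Complex.I) (y + a * Complex.I) +
    segInt Φ (y + a * Complex.I) (y + b * Complex.I) +
    segInt Φ (y + b * Complex.I) (x + b * Complex.I)

theorem hook_symm (Φ : ℂ → ℂ) (x y a b : ℝ) : hook Φ x y b a = -hook Φ x y a b := by
  rw [hook, hook, segInt_symm Φ (x + a * Complex.I), segInt_symm Φ (y + a * Complex.I),
    segInt_symm Φ (y + b * Complex.I)]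
  ring

theorem re_im_of_mem_segment {a b s : ℂ} (hs : s ∈ segment ℝ a b) :
    (min a.re b.re ≤ s.re ∧ s.re ≤ max a.re b.re) ∧ s.im ∈ Set.uIcc a.im b.im := by
  obtain ⟨u, v, hu, hv, huv, rfl⟩ := hs
  have h1 := convex_uIcc a.re b.re (Set.left_mem_uIcc) (Set.right_mem_uIcc) hu hv huv
  have h2 := convex_uIcc a.im b.im (Set.left_mem_uIcc) (Set.right_mem_uIcc) hu hv huv
  have e1 : (u • a + v • b).re = u • a.re + v • b.re := by simp
  have e2 : (u • a + v • b).im = u • a.im + v • b.im := by simp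
  rw [e1, e2]
  exact ⟨h1, h2⟩

/-- The integrand of the Hadamard product in logarithmic coordinates. -/
noncomputable def convKernel (f g : ℂ → ℂ) (p : ℂ) (q : ℂ × ℂ) : ℂ :=
  f (Complex.exp q.2) * g (p * Complex.exp (q.1 - q.2))

/-- The region in which `convKernel` is holomorphic. -/
def kernelRegion (S T : Set ℂ) (p : ℂ) : Set (ℂ × ℂ) :=
  {q | Complex.exp q.2 ∈ starDomain S ∧ p * Complex.exp (q.1 - q.2) ∈ starDomain T}

section Hook

variable {S T : Set ℂ} {f g : ℂ → ℂ}

theorem differentiableOn_convKernel (hf : DifferentiableOn ℂ f (starDomain S))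
    (hg : DifferentiableOn ℂ g (starDomain T)) (p : ℂ) :
    DifferentiableOn ℂ (convKernel f g p) (kernelRegion S T p) :=
  (hf.comp (f := fun q : ℂ × ℂ => Complex.exp q.2) (by fun_prop) fun _ hq => hq.1).mul
    (hg.comp (f := fun q : ℂ × ℂ => p * Complex.exp (q.1 - q.2)) (by fun_prop) fun _ hq => hq.2)

/-- The hook stays inside the star domain of the first factor. -/
def HookIn (S : Set ℂ) (x y a b : ℝ) : Prop :=
  y ≤ x ∧ Complex.exp (x + a * Complex.I) ∈ starDomain S ∧
    Complex.exp (x + b * Complex.I) ∈ starDomain S ∧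
    ∀ t ∈ Set.uIcc a b, Complex.exp (y + t * Complex.I) ∈ starDomain S

/-- The reflected hook stays inside the star domain of the second factor. -/
def HookCoIn (T : Set ℂ) (p : ℂ) (y a b : ℝ) (w : ℂ) : Prop :=
  ∀ t ∈ Set.uIcc a b, p * Complex.exp (w - (y + t * Complex.I)) ∈ starDomain T

theorem HookIn.exp_mem {x y a b : ℝ} (h : HookIn S x y a b) {s : ℂ}
    (hs : s ∈ segment ℝ (x + a * Complex.I : ℂ) (y + a * Complex.I) ∨
      s ∈ segment ℝ (y + a * Complex.I : ℂ) (y + b * Complex.I) ∨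
      s ∈ segment ℝ (y + b * Complex.I : ℂ) (x + b * Complex.I)) :
    Complex.exp s ∈ starDomain S := by
  obtain ⟨h1, h2, h3, h4⟩ := h
  rcases hs with hs | hs | hs <;> have hm := re_im_of_mem_segment hs <;> simp at hm
  · exact exp_mem_starDomain h2 (by rcases hm.1.2 with h | h <;> simp <;> linarith)
      (by simpa using hm.2)
  · refine exp_mem_starDomain (h4 s.im hm.2) (by simpa using hm.1.2) (by simp)
  · exact exp_mem_starDomain h3 (by rcases hm.1.2 with h | h <;> simp <;> linarith)
      (by simpa using hm.2)

theorem le_re_of_mem_hook {x y a b : ℝ} (h : y ≤ x) {s : ℂ}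
    (hs : s ∈ segment ℝ (x + a * Complex.I : ℂ) (y + a * Complex.I) ∨
      s ∈ segment ℝ (y + a * Complex.I : ℂ) (y + b * Complex.I) ∨
      s ∈ segment ℝ (y + b * Complex.I : ℂ) (x + b * Complex.I)) :
    y ≤ s.re ∧ s.im ∈ Set.uIcc a b := by
  rcases hs with hs | hs | hs <;> have hm := re_im_of_mem_segment hs <;> simp [h] at hm
  · exact ⟨hm.1.1, by rw [hm.2]; exact Set.left_mem_uIcc⟩
  · exact ⟨hm.1.1, hm.2⟩
  · exact ⟨hm.1.1, by rw [hm.2]; exact Set.right_mem_uIcc⟩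

/-- Increasing `Re s` shrinks `p exp (w - s)` along its ray, so for the second factor the innermost
edge of the hook is decisive; for the first factor it is the outer ends of the radial sides and the
arc. -/
theorem HookCoIn.mul_exp_mem {x y a b : ℝ} (h : y ≤ x) {p w : ℂ} (hw : HookCoIn T p y a b w) {s : ℂ}
    (hs : s ∈ segment ℝ (x + a * Complex.I : ℂ) (y + a * Complex.I) ∨
      s ∈ segment ℝ (y + a * Complex.I : ℂ) (y + b * Complex.I) ∨
      s ∈ segment ℝ (y + b * Complex.I : ℂ) (x + b * Complex.I)) :
    p * Complex.exp (w - s) ∈ starDomain T := by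
  obtain ⟨h1, h2⟩ := le_re_of_mem_hook h hs
  exact mul_exp_mem_starDomain (hw s.im h2) (by simp; linarith) (by simp)

theorem differentiableOn_hook (hf : DifferentiableOn ℂ f (starDomain S))
    (hg : DifferentiableOn ℂ g (starDomain T)) {x y a b : ℝ} (h : HookIn S x y a b) {p : ℂ}
    {U : Set ℂ} (hU : IsOpen U) (hw : ∀ w ∈ U, HookCoIn T p y a b w) :
    DifferentiableOn ℂ (fun w => hook (fun s => convKernel f g p (w, s)) x y a b) U := by
  have hd := differentiableOn_convKernel hf hg p
  have hseg : ∀ {a b : ℂ} {t : ℝ}, t ∈ Set.Icc (0 : ℝ) 1 → a + t * (b - a) ∈ segment ℝ a b :=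
    fun ht => add_mul_sub_mem (convex_segment _ _) (left_mem_segment ℝ _ _)
      (right_mem_segment ℝ _ _) ht
  refine ((differentiableOn_segInt hU hd (by fun_prop) (by fun_prop) fun w hwU t ht => ?_).add
    (differentiableOn_segInt hU hd (by fun_prop) (by fun_prop) fun w hwU t ht => ?_)).add
    (differentiableOn_segInt hU hd (by fun_prop) (by fun_prop) fun w hwU t ht => ?_)
  · exact ⟨h.exp_mem (Or.inl (hseg ht)), (hw w hwU).mul_exp_mem h.1 (Or.inl (hseg ht))⟩
  · exact ⟨h.exp_mem (Or.inr (Or.inl (hseg ht))),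
      (hw w hwU).mul_exp_mem h.1 (Or.inr (Or.inl (hseg ht)))⟩
  · exact ⟨h.exp_mem (Or.inr (Or.inr (hseg ht))),
      (hw w hwU).mul_exp_mem h.1 (Or.inr (Or.inr (hseg ht)))⟩

/-- The integrand of the Taylor coefficients of `f`. -/
noncomputable def coeffKernel (f : ℂ → ℂ) (n : ℕ) (s : ℂ) : ℂ :=
  f (Complex.exp s) * Complex.exp (-s) ^ n

/-- On the hook the second factor stays inside its disc of convergence. Termwise integration
extracts `(p exp w) ^ n` and leaves the integrals of `coeffKernel`. -/
theorem hasSum_hook (hf : DifferentiableOn ℂ f (starDomain S)) {x y a b : ℝ}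
    (h : HookIn S x y a b) {C : ℕ → ℂ} {r : ℝ}
    (hg : ∀ z : ℂ, ‖z‖ < r → HasSum (fun n => C n * z ^ n) (g z)) {p w : ℂ}
    (hw : ‖p * Complex.exp w‖ < r * Real.exp y) :
    HasSum (fun n => hook (coeffKernel f n) x y a b * C n * (p * Complex.exp w) ^ n)
      (hook (fun s => convKernel f g p (w, s)) x y a b) := by
  set R : ℝ := ‖p * Complex.exp w‖ * Real.exp (-y) with hR
  have hRr : R < r := by
    rw [hR, Real.exp_neg, ← div_eq_mul_inv, div_lt_iff₀ (Real.exp_pos y)]; exact hw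
  have hR0 : 0 ≤ R := by positivity
  have key : ∀ a' b' : ℂ, (∀ s ∈ segment ℝ a' b', Complex.exp s ∈ starDomain S ∧ y ≤ s.re) →
      HasSum (fun n => segInt (coeffKernel f n) a' b' * C n * (p * Complex.exp w) ^ n)
        (segInt (fun s => convKernel f g p (w, s)) a' b') := fun a' b' hs => by
    have hn : ∀ s ∈ segment ℝ a' b', ‖p * Complex.exp (w - s)‖ ≤ R := fun s hs' => by
      rw [sub_eq_add_neg, Complex.exp_add, ← mul_assoc, norm_mul, Complex.norm_exp (-s)]
      refine mul_le_mul_of_nonneg_left (Real.exp_le_exp.2 ?_) (norm_nonneg _)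
      rw [Complex.neg_re]
      linarith [(hs s hs').2]
    have := hasSum_segInt (a := a') (b := b') (Φ := fun s => f (Complex.exp s))
      (u := fun s => p * Complex.exp (w - s)) (V := fun s => g (p * Complex.exp (w - s)))
      (hf.continuousOn.comp (by fun_prop) fun s hs' => (hs s hs').1) (by fun_prop) hn
      (summable_norm_mul_pow hg hR0 hRr) fun s hs' => hg _ ((hn s hs').trans_lt hRr)
    refine this.congr_fun fun n => ?_
    have e : (fun s => f (Complex.exp s) * (p * Complex.exp (w - s)) ^ n) =
        fun s => (p * Complex.exp w) ^ n * coeffKernel f n s := by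
      ext s
      rw [sub_eq_add_neg, Complex.exp_add, coeffKernel]
      ring
    rw [e, segInt_const_mul]
    ring
  have hk := ((key _ _ fun s hs => ⟨h.exp_mem (Or.inl hs),
    (le_re_of_mem_hook (a := a) (b := b) h.1 (Or.inl hs)).1⟩).add (key _ _ fun s hs =>
    ⟨h.exp_mem (Or.inr (Or.inl hs)), (le_re_of_mem_hook (a := a) (b := b) h.1 (Or.inr (Or.inl hs))).1⟩)).add
    (key _ _ fun s hs => ⟨h.exp_mem (Or.inr (Or.inr hs)),
      (le_re_of_mem_hook (a := a) (b := b) h.1 (Or.inr (Or.inr hs))).1⟩)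
  refine hk.congr_fun fun n => ?_
  simp only [hook]
  ring

theorem differentiableOn_coeffKernel (hf : DifferentiableOn ℂ f (starDomain S)) (n : ℕ) :
    DifferentiableOn ℂ (coeffKernel f n) {s | Complex.exp s ∈ starDomain S} :=
  (hf.comp (f := Complex.exp) (by fun_prop) fun _ hs => hs).mul (by fun_prop)

theorem convex_lt_re_im (X α β : ℝ) : Convex ℝ {s : ℂ | s.re < X ∧ α < s.im ∧ s.im < β} :=
  (convex_halfSpace_re_lt X).inter ((convex_halfSpace_im_gt α).inter (convex_halfSpace_im_lt β))

theorem isOpen_lt_re_im (X α β : ℝ) : IsOpen {s : ℂ | s.re < X ∧ α < s.im ∧ s.im < β} :=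
  (isOpen_lt Complex.continuous_re continuous_const).inter
    ((isOpen_lt continuous_const Complex.continuous_im).inter
      (isOpen_lt Complex.continuous_im continuous_const))

/-- A hook can be moved inside the star domain. -/
theorem hook_coeffKernel_eq (hS : ∀ R : ℝ, (S ∩ Metric.closedBall 0 R).Finite)
    (hf : DifferentiableOn ℂ f (starDomain S)) (n : ℕ) {x y x₀ a b : ℝ} (h : HookIn S x y a b)
    (h0 : x₀ ≤ y) : hook (coeffKernel f n) x y a b = hook (coeffKernel f n) x x₀ a b := by
  have hd := differentiableOn_coeffKernel hf n
  -- The rectangle between the levels `y` and `x₀` lies in a sector of the star domain, and each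
  -- radial side splits at the level `y`.
  have hside : ∀ c : ℝ, Complex.exp (x + c * Complex.I) ∈ starDomain S →
      ∀ x₁ x₂ x₃ : ℝ, x₁ ≤ x → x₂ ≤ x → x₃ ≤ x →
      segInt (coeffKernel f n) (x₁ + c * Complex.I) (x₂ + c * Complex.I) +
        segInt (coeffKernel f n) (x₂ + c * Complex.I) (x₃ + c * Complex.I) =
        segInt (coeffKernel f n) (x₁ + c * Complex.I) (x₃ + c * Complex.I) :=
    fun c hc x₁ x₂ x₃ h1 h2 h3 => by
      obtain ⟨κ, hκ, hsec⟩ := exists_sector hS 1 (a := c) (b := c) (y := x) (by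
        intro t ht
        rw [Set.uIcc_self, Set.mem_singleton_iff] at ht
        rwa [one_mul, ht])
      simp only [one_mul, min_self, max_self] at hsec
      refine segInt_add (convex_lt_re_im (x + κ) (c - κ) (c + κ)) (isOpen_lt_re_im _ _ _)
        (hd.mono fun s hs => hsec s hs.1 hs.2.1 hs.2.2) ?_ ?_ ?_ <;>
      · simp [hκ]; linarith
  obtain ⟨κ, hκ, hsec⟩ := exists_sector hS 1 (a := a) (b := b) (y := y) (by
    intro t ht
    rw [one_mul]
    exact h.2.2.2 t ht)
  simp only [one_mul] at hsec
  have hm : ∀ x' ≤ y, ∀ t ∈ Set.uIcc a b, (x' + t * Complex.I : ℂ) ∈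
      {s : ℂ | s.re < y + κ ∧ min a b - κ < s.im ∧ s.im < max a b + κ} := fun x' hx' t ht => by
    have h1 : min a b ≤ t := ht.1
    have h2 : t ≤ max a b := ht.2
    simp
    exact ⟨by linarith, by linarith, by linarith⟩
  have hadd := fun {u v z : ℂ} => segInt_add (a := u) (b := v) (c := z)
    (convex_lt_re_im (y + κ) (min a b - κ) (max a b + κ))
    (isOpen_lt_re_im _ _ _) (hd.mono fun s hs => hsec s hs.1 hs.2.1 hs.2.2)
  have la : a ∈ Set.uIcc a b := Set.left_mem_uIcc
  have lb : b ∈ Set.uIcc a b := Set.right_mem_uIcc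
  have e1 := hside a h.2.1 x y x₀ le_rfl h.1 (h0.trans h.1)
  have e2 := hside b h.2.2.1 x₀ y x (h0.trans h.1) h.1 le_rfl
  have e3 := hadd (hm y le_rfl a la) (hm x₀ h0 a la) (hm x₀ h0 b lb)
  have e4 := hadd (hm y le_rfl a la) (hm x₀ h0 b lb) (hm y le_rfl b lb)
  simp only [hook]
  rw [← e1, ← e2, ← e4, ← e3]
  ring

/-- Adjacent hooks run along their common radial side in opposite directions. -/
theorem hook_add {Φ : ℂ → ℂ} {X : ℝ} (hd : DifferentiableOn ℂ Φ {s | s.re < X}) {x x₀ : ℝ}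
    (h : x₀ < X) (a b c : ℝ) : hook Φ x x₀ a b + hook Φ x x₀ b c = hook Φ x x₀ a c := by
  have h1 := segInt_add (convex_re_lt X) (isOpen_re_lt X) hd
    (a := x₀ + a * Complex.I) (b := x₀ + b * Complex.I) (c := x₀ + c * Complex.I)
    (by simpa) (by simpa) (by simpa)
  simp only [hook]
  rw [← h1, segInt_symm Φ (x₀ + b * Complex.I) (x + b * Complex.I)]
  ring

theorem segInt_exp_int_mul {m : ℤ} (hm : m ≠ 0) (s₀ : ℂ) :
    segInt (fun s => Complex.exp (m * s)) s₀ (s₀ + 2 * Real.pi * Complex.I) = 0 := by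
  have hm' : (m : ℂ) ≠ 0 := by exact_mod_cast hm
  rw [segInt_eq_sub (D := Set.univ) convex_univ (F := fun s => Complex.exp (m * s) / m)
    (fun z _ => ?_) (by fun_prop) (Set.mem_univ _) (Set.mem_univ _)]
  · have : Complex.exp (m * (s₀ + 2 * Real.pi * Complex.I)) = Complex.exp (m * s₀) := by
      rw [mul_add, Complex.exp_add, Complex.exp_int_mul_two_pi_mul_I, mul_one]
    rw [this, sub_self]
  · have h := ((hasDerivAt_id z).const_mul (m : ℂ)).cexp.div_const (m : ℂ)
    simpa [hm'] using h

/-- Cauchy's formula for the Taylor coefficients. -/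
theorem hook_coeffKernel_two_pi {A : ℕ → ℂ} {r : ℝ}
    (hf : ∀ z : ℂ, ‖z‖ < r → HasSum (fun n => A n * z ^ n) (f z)) {x x₀ : ℝ}
    (hx₀ : Real.exp x₀ < r) (θ : ℝ) (n : ℕ) :
    hook (coeffKernel f n) x x₀ θ (θ + 2 * Real.pi) = 2 * Real.pi * Complex.I * A n := by
  have hper : ∀ s, coeffKernel f n (s + 2 * Real.pi * Complex.I) = coeffKernel f n s := fun s => by
    have : Complex.exp (-(s + 2 * Real.pi * Complex.I)) = Complex.exp (-s) := by
      rw [← exp_add_two_pi (-(s + 2 * Real.pi * Complex.I))]; congr 1; ring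
    rw [coeffKernel, coeffKernel, exp_add_two_pi, this]
  -- By periodicity the two radial sides cancel. The remaining circle lies inside the disc of
  -- convergence, where the orthogonality of the exponentials applies.
  have hside : segInt (coeffKernel f n) (x₀ + (θ + 2 * Real.pi : ℝ) * Complex.I)
      (x + (θ + 2 * Real.pi : ℝ) * Complex.I) =
      segInt (coeffKernel f n) (x₀ + θ * Complex.I) (x + θ * Complex.I) := by
    have := segInt_comp_add (coeffKernel f n) (x₀ + θ * Complex.I) (x + θ * Complex.I)
      (2 * Real.pi * Complex.I)
    simp only [hper] at this
    rw [show segInt (coeffKernel f n) (x₀ + θ * Complex.I) (x + θ * Complex.I) = _ from this]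
    push_cast
    congr 1 <;> ring
  rw [hook, hside, segInt_symm _ (x₀ + θ * Complex.I) (x + θ * Complex.I), neg_add_cancel_comm]
  have hend : (x₀ + (θ + 2 * Real.pi : ℝ) * Complex.I : ℂ) =
      (x₀ + θ * Complex.I) + 2 * Real.pi * Complex.I := by push_cast; ring
  rw [hend]
  set s₀ : ℂ := x₀ + θ * Complex.I with hs₀
  have hn : ∀ s ∈ segment ℝ s₀ (s₀ + 2 * Real.pi * Complex.I), ‖Complex.exp s‖ ≤ Real.exp x₀ :=
    fun s hs => by
      have := (re_im_of_mem_segment hs).1.2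
      rw [Complex.norm_exp]
      refine Real.exp_le_exp.2 ?_
      simpa [hs₀] using this
  have key := hasSum_segInt (a := s₀) (b := s₀ + 2 * Real.pi * Complex.I)
    (Φ := fun s => Complex.exp (-s) ^ n) (u := Complex.exp) (by fun_prop) (by fun_prop) hn
    (summable_norm_mul_pow hf (Real.exp_pos x₀).le hx₀) fun s hs => hf _ ((hn s hs).trans_lt hx₀)
  have hval : ∀ m : ℕ, A m * segInt (fun s => Complex.exp (-s) ^ n * Complex.exp s ^ m) s₀
      (s₀ + 2 * Real.pi * Complex.I) = if m = n then 2 * Real.pi * Complex.I * A n else 0 :=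
    fun m => by
      have e : (fun s => Complex.exp (-s) ^ n * Complex.exp s ^ m) =
          fun s => Complex.exp (((m - n : ℤ) : ℂ) * s) := by
        ext s
        rw [← Complex.exp_nat_mul, ← Complex.exp_nat_mul, ← Complex.exp_add]
        congr 1
        push_cast
        ring
      rw [e]
      split_ifs with h
      · subst h
        simp [segInt]
        ring
      · rw [segInt_exp_int_mul (by omega), mul_zero]
  simp only [hval] at key
  have := key.unique (hasSum_ite_eq n _)
  rw [← this]
  congr 1
  ext s
  rw [coeffKernel, mul_comm]

end Hook

/-! ### Contributions of intervals of angles; points of the star domain. -/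

/-- The angle `θ` carries no obstruction for a hook at `p`. -/
def GoodAngle (S T : Set ℂ) (p : ℂ) (x₀ x₁ θ : ℝ) : Prop :=
  Complex.exp (x₁ + θ * Complex.I) ∈ starDomain S ∧
    p * Complex.exp (-(x₀ + θ * Complex.I)) ∈ starDomain T

/-- Radii `exp x₀ ≤ exp x₁` between which the path of integration for points near `p` is chosen. -/
structure Levels (S T : Set ℂ) (p : ℂ) (x₀ x₁ : ℝ) : Prop where
  ne_zero : p ≠ 0
  le : x₀ ≤ x₁
  inner : ∀ z : ℂ, ‖z‖ < Real.exp (x₀ + 1) → z ∈ starDomain S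
  outer : ∀ z : ℂ, ‖z‖ < ‖p‖ * Real.exp (1 - x₁) → z ∈ starDomain T

section

variable {S T : Set ℂ} {f g : ℂ → ℂ} {p : ℂ} {x₀ x₁ : ℝ}

theorem Levels.exp_mem (h : Levels S T p x₀ x₁) {s : ℂ} (hs : s.re < x₀ + 1) :
    Complex.exp s ∈ starDomain S :=
  h.inner _ (by rw [Complex.norm_exp]; exact Real.exp_lt_exp.2 hs)

theorem Levels.mul_exp_mem (h : Levels S T p x₀ x₁) {s : ℂ} (hs : s.re < 1 - x₁) :
    p * Complex.exp s ∈ starDomain T :=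
  h.outer _ (by
    rw [norm_mul, Complex.norm_exp]
    exact mul_lt_mul_of_pos_left (Real.exp_lt_exp.2 hs) (norm_pos_iff.2 h.ne_zero))

theorem GoodAngle.add_two_pi {θ : ℝ} (h : GoodAngle S T p x₀ x₁ θ) :
    GoodAngle S T p x₀ x₁ (θ + 2 * Real.pi) := by
  constructor
  · have : Complex.exp (x₁ + (θ + 2 * Real.pi : ℝ) * Complex.I) =
        Complex.exp (x₁ + θ * Complex.I) := by
      rw [← exp_add_two_pi (x₁ + θ * Complex.I)]; push_cast; congr 1; ring
    rw [this]; exact h.1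
  · have : Complex.exp (-(x₀ + (θ + 2 * Real.pi : ℝ) * Complex.I)) =
        Complex.exp (-(x₀ + θ * Complex.I)) := by
      rw [← exp_add_two_pi (-(x₀ + (θ + 2 * Real.pi : ℝ) * Complex.I))]; push_cast; congr 1; ring
    rw [this]; exact h.2

theorem eventually_goodAngle (hS : ∀ R : ℝ, (S ∩ Metric.closedBall 0 R).Finite)
    (h0S : (0 : ℂ) ∉ S) (hT : ∀ R : ℝ, (T ∩ Metric.closedBall 0 R).Finite) (h0T : (0 : ℂ) ∉ T)
    (hp : p ≠ 0) (x₀ x₁ θ : ℝ) : ∀ᶠ t in 𝓝[≠] θ, GoodAngle S T p x₀ x₁ t := by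
  obtain ⟨κ, hκ, h1⟩ := exists_punctured_sector hS h0S θ x₁
  obtain ⟨κ', hκ', h2⟩ := exists_punctured_sector hT h0T ((Complex.log p).im - θ)
    ((Complex.log p).re - x₀)
  have hball : ∀ᶠ t in 𝓝[≠] θ, |t - θ| < min κ κ' :=
    nhdsWithin_le_nhds (Metric.ball_mem_nhds θ (lt_min hκ hκ'))
  filter_upwards [hball, self_mem_nhdsWithin] with t ht hne
  have hne' : 0 < |t - θ| := abs_pos.2 (sub_ne_zero.2 hne)
  refine ⟨h1 _ (by simp) (by simpa using hne') (by simpa using ht.trans_le (min_le_left _ _)), ?_⟩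
  have := h2 (Complex.log p + -(x₀ + t * Complex.I)) (by simp [sub_eq_add_neg]) ?_ ?_
  · rwa [Complex.exp_add, Complex.exp_log hp] at this
  · simp only [Complex.add_im, Complex.neg_im, Complex.ofReal_im, Complex.mul_I_im,
      Complex.ofReal_re, zero_add]
    rw [show (Complex.log p).im + -t - ((Complex.log p).im - θ) = -(t - θ) by ring, abs_neg]
    exact hne'
  · simp only [Complex.add_im, Complex.neg_im, Complex.ofReal_im, Complex.mul_I_im,
      Complex.ofReal_re, zero_add]
    rw [show (Complex.log p).im + -t - ((Complex.log p).im - θ) = -(t - θ) by ring, abs_neg]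
    exact ht.trans_le (min_le_right _ _)

/-- The part of the Hadamard product contributed by an interval of angles. -/
def PartialSum (f : ℂ → ℂ) (B : ℕ → ℂ) (p : ℂ) (x₀ x₁ a b : ℝ) (w k : ℂ) : Prop :=
  HasSum (fun n => hook (coeffKernel f n) x₁ x₀ a b * B n * (p * Complex.exp w) ^ n) k

theorem PartialSum.add (h : Levels S T p x₀ x₁) (hf : DifferentiableOn ℂ f (starDomain S))
    {B : ℕ → ℂ} {a b c : ℝ} {w k k' : ℂ} (h1 : PartialSum f B p x₀ x₁ a b w k)
    (h2 : PartialSum f B p x₀ x₁ b c w k') : PartialSum f B p x₀ x₁ a c w (k + k') := by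
  refine (HasSum.add h1 h2).congr_fun fun n => ?_
  rw [← hook_add ((differentiableOn_coeffKernel hf n).mono fun s hs => h.exp_mem hs)
    (lt_add_one x₀) a b c]
  ring

theorem PartialSum.symm {B : ℕ → ℂ} {a b : ℝ} {w k : ℂ} (h1 : PartialSum f B p x₀ x₁ a b w k) :
    PartialSum f B p x₀ x₁ b a w (-k) := by
  refine (HasSum.neg h1).congr_fun fun n => ?_
  rw [hook_symm]
  ring

theorem PartialSum.two_pi {A B : ℕ → ℂ} {r : ℝ}
    (hf : ∀ z : ℂ, ‖z‖ < r → HasSum (fun n => A n * z ^ n) (f z)) (hx₀ : Real.exp x₀ < r) {θ : ℝ}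
    {w k : ℂ} (h : PartialSum f B p x₀ x₁ θ (θ + 2 * Real.pi) w k) :
    HasSum (fun n => A n * B n * (p * Complex.exp w) ^ n) (k / (2 * Real.pi * Complex.I)) := by
  refine (HasSum.div_const h (2 * Real.pi * Complex.I)).congr_fun fun n => ?_
  rw [hook_coeffKernel_two_pi hf hx₀]
  field_simp [Complex.two_pi_I_ne_zero]

/-- Partial sums are represented by integrals over hooks. -/
theorem partialSum_hook
    (hS : ∀ R : ℝ, (S ∩ Metric.closedBall 0 R).Finite)
    (hf : DifferentiableOn ℂ f (starDomain S)) {y a b : ℝ} (hh : HookIn S x₁ y a b) (hy : x₀ ≤ y)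
    {B : ℕ → ℂ} {r : ℝ} (hg : ∀ z : ℂ, ‖z‖ < r → HasSum (fun n => B n * z ^ n) (g z)) (hr : 0 < r)
    {w : ℂ} (hw : ‖p * Complex.exp w‖ < r * Real.exp x₀) :
    PartialSum f B p x₀ x₁ a b w (hook (fun s => convKernel f g p (w, s)) x₁ y a b) := by
  have := hasSum_hook hf hh hg (p := p) (w := w) (hw.trans_le (by gcongr))
  -- The coefficients do not depend on the level `y`, so contributions computed at different levels
  -- can be added.
  simp only [hook_coeffKernel_eq hS hf _ hh hy] at this
  exact this

/-- Along a ray the levels admissible for `S` form an open set containing `x₀`, those admissible for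
`T` an open set containing `x₁`. A level admissible for neither would place a point `(t u) p` with
`t u ∈ [0, 1]` in `S * T`, so the two sets cover the interval, and by connectedness they meet. -/
theorem exists_level (h : Levels S T p x₀ x₁)
    (hS : ∀ R : ℝ, (S ∩ Metric.closedBall 0 R).Finite)
    (hT : ∀ R : ℝ, (T ∩ Metric.closedBall 0 R).Finite)
    (hp : p ∈ starDomain (S * T)) (θ : ℝ) : ∃ y ∈ Set.Icc x₀ x₁,
      Complex.exp (y + θ * Complex.I) ∈ starDomain S ∧
        p * Complex.exp (-(y + θ * Complex.I)) ∈ starDomain T := by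
  have hU : IsOpen {y : ℝ | Complex.exp (y + θ * Complex.I) ∈ starDomain S} :=
    (isOpen_starDomain hS).preimage (by fun_prop)
  have hV : IsOpen {y : ℝ | p * Complex.exp (-(y + θ * Complex.I)) ∈ starDomain T} :=
    (isOpen_starDomain hT).preimage (by fun_prop)
  have hcov : Set.Icc x₀ x₁ ⊆ {y : ℝ | Complex.exp (y + θ * Complex.I) ∈ starDomain S} ∪
      {y : ℝ | p * Complex.exp (-(y + θ * Complex.I)) ∈ starDomain T} := by
    intro y _
    by_contra hc
    simp only [Set.mem_union, Set.mem_ofPred_eq, not_or, starDomain, not_forall, not_not] at hc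
    obtain ⟨⟨t, ht, hα⟩, u, hu, hβ⟩ := hc
    refine hp (t * u) ⟨mul_nonneg ht.1 hu.1, mul_le_one₀ ht.2 hu.1 hu.2⟩ ?_
    convert Set.mul_mem_mul hα hβ using 1
    rw [Complex.exp_neg]
    push_cast
    field_simp [Complex.exp_ne_zero]
  obtain ⟨y, hy, hy'⟩ := isPreconnected_Icc (a := x₀) (b := x₁) _ _ hU hV hcov
    ⟨x₀, ⟨le_rfl, h.le⟩, h.exp_mem (by simp)⟩ ⟨x₁, ⟨h.le, le_rfl⟩, h.mul_exp_mem (by simp)⟩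
  exact ⟨y, hy, hy'⟩

/-- Continuation of the Hadamard product across a point of the star domain of `S * T`. -/
theorem exists_continuation_center (h : Levels S T p x₀ x₁)
    (hS : ∀ R : ℝ, (S ∩ Metric.closedBall 0 R).Finite) (h0S : (0 : ℂ) ∉ S)
    (hT : ∀ R : ℝ, (T ∩ Metric.closedBall 0 R).Finite) (h0T : (0 : ℂ) ∉ T)
    (hfd : DifferentiableOn ℂ f (starDomain S)) (hgd : DifferentiableOn ℂ g (starDomain T))
    {A B : ℕ → ℂ} {r r' : ℝ} (hf : ∀ z : ℂ, ‖z‖ < r' → HasSum (fun n => A n * z ^ n) (f z))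
    (hx₀ : Real.exp x₀ < r') (hg : ∀ z : ℂ, ‖z‖ < r → HasSum (fun n => B n * z ^ n) (g z))
    (hr : 0 < r) (hp : p ∈ starDomain (S * T)) :
    ∃ δ > 0, ∃ K : ℂ → ℂ, DifferentiableOn ℂ K {w | w.re < δ ∧ -δ < w.im ∧ w.im < δ} ∧
      ∀ w : ℂ, w.re < δ → -δ < w.im → w.im < δ → ‖p * Complex.exp w‖ < r * Real.exp x₀ →
        HasSum (fun n => A n * B n * (p * Complex.exp w) ^ n) (K w) := by
  obtain ⟨θ, hθ⟩ := (eventually_goodAngle hS h0S hT h0T h.ne_zero x₀ x₁ 0).exists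
  -- Cousin's lemma over one full turn of angles: near each angle a single level serves, and
  -- different angles may use different levels.
  obtain ⟨δ, hδ, K, hK, hKs⟩ := of_locally_of_trans (a := θ) (b := θ + 2 * Real.pi)
    (G := GoodAngle S T p x₀ x₁) (Q := fun a b => ∃ δ > 0, ∃ K : ℂ → ℂ,
      DifferentiableOn ℂ K {w | w.re < δ ∧ -δ < w.im ∧ w.im < δ} ∧
      ∀ w : ℂ, w.re < δ → -δ < w.im → w.im < δ → ‖p * Complex.exp w‖ < r * Real.exp x₀ →
        PartialSum f B p x₀ x₁ a b w (K w))
    (fun u v w _ _ _ _ _ _ _ h1 h2 => by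
      obtain ⟨δ, hδ, K, hK, hs⟩ := h1
      obtain ⟨δ', hδ', K', hK', hs'⟩ := h2
      have l1 := min_le_left δ δ'
      have l2 := min_le_right δ δ'
      exact ⟨min δ δ', lt_min hδ hδ', K + K',
        (hK.mono fun w hw => ⟨by linarith [hw.1], by linarith [hw.2.1], by linarith [hw.2.2]⟩).add
        (hK'.mono fun w hw => ⟨by linarith [hw.1], by linarith [hw.2.1], by linarith [hw.2.2]⟩),
        fun w h1 h2 h3 h4 => (hs w (by linarith) (by linarith) (by linarith) h4).add h hfd
          (hs' w (by linarith) (by linarith) (by linarith) h4)⟩)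
    (fun x _ => eventually_goodAngle hS h0S hT h0T h.ne_zero x₀ x₁ x)
    (fun x _ => by
      obtain ⟨y, hy, hy1, hy2⟩ := exists_level h hS hT hp x
      obtain ⟨κ, hκ, h1⟩ := exists_sector hS 1 (a := x) (b := x) (y := y) (by simpa using hy1)
      obtain ⟨κ', hκ', h2⟩ := exists_sector hT p (a := -x) (b := -x) (y := -y) (by
        simpa [add_comm] using hy2)
      simp only [one_mul, min_self, max_self] at h1 h2
      set δ := min κ κ' / 2 with hδ
      have hδ1 : 2 * δ ≤ κ := by linarith [min_le_left κ κ']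
      have hδ2 : 2 * δ ≤ κ' := by linarith [min_le_right κ κ']
      have hδ0 : 0 < δ := half_pos (lt_min hκ hκ')
      refine ⟨δ, hδ0, fun a b ha hb ha1 _ _ hb1 hab => ⟨δ, hδ0,
        fun w => hook (fun s => convKernel f g p (w, s)) x₁ y a b, ?_⟩⟩
      have hh : HookIn S x₁ y a b := by
        refine ⟨hy.2, ha.1, hb.1, fun t ht => ?_⟩
        rw [Set.uIcc_of_le hab.le] at ht
        exact h1 _ (by simpa) (by simp; linarith [ht.1]) (by simp; linarith [ht.2])
      refine ⟨differentiableOn_hook hfd hgd hh (isOpen_lt_re_im _ _ _) fun w hw t ht => ?_,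
        fun w _ _ _ h4 => partialSum_hook hS hfd hh hy.1 hg hr h4⟩
      rw [Set.uIcc_of_le hab.le] at ht
      obtain ⟨w1, w2, w3⟩ := hw
      exact h2 _ (by simp; linarith) (by simp; linarith [ht.2]) (by simp; linarith [ht.1]))
    hθ hθ.add_two_pi (by linarith [Real.pi_pos])
  exact ⟨δ, hδ, fun w => K w / (2 * Real.pi * Complex.I), hK.div_const _,
    fun w h1 h2 h3 h4 => (hKs w h1 h2 h3 h4).two_pi hf hx₀⟩

end

/-! ### The integral along an obstructed ray. -/

/-- `f` is holomorphic on the star domain of `S`, and its monodromy at `q`, seen from the side `s`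
in a logarithmic coordinate, is annihilated by `P q`. -/
structure HasMonodromy (f : ℂ → ℂ) (S : Set ℂ) (s : Side) (P : ℂ → ℂ[X]) : Prop where
  locallyFinite : ∀ R : ℝ, (S ∩ Metric.closedBall 0 R).Finite
  zero_notMem : (0 : ℂ) ∉ S
  differentiableOn : DifferentiableOn ℂ f (starDomain S)
  monic : ∀ q, (P q).Monic
  eq_one : ∀ q, q ∉ S → P q = 1
  monodromyClass : ∀ q, q ≠ 0 → MonodromyClass (fun w => f (q * Complex.exp w)) s (P q)

theorem eventually_notMem {S : Set ℂ} (hS : ∀ R : ℝ, (S ∩ Metric.closedBall 0 R).Finite)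
    {c : ℝ → ℂ} (hc : Continuous c) (hi : Function.Injective c) (x : ℝ) :
    ∀ᶠ y in 𝓝[≠] x, c y ∉ S := by
  have hcl : IsClosed (S \ {c x}) := isClosed_of_locallyFinite fun R =>
    (hS R).subset fun z hz => ⟨hz.1.1, hz.2⟩
  have h1 : ∀ᶠ y in 𝓝[≠] x, c y ∉ S \ {c x} := nhdsWithin_le_nhds
    ((hc.tendsto x).eventually (hcl.isOpen_compl.mem_nhds fun h => h.2 rfl))
  filter_upwards [h1, self_mem_nhdsWithin] with y hy hne hyS
  exact hy ⟨hyS, fun h => hne (hi h)⟩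

theorem detour_add {D : Set ℂ} (hD : Convex ℝ D) (ho : IsOpen D) {Φ : ℂ → ℂ}
    (hΦ : DifferentiableOn ℂ Φ D) {a b c h : ℂ} (ha : a + h ∈ D) (hb : b + h ∈ D)
    (hc : c + h ∈ D) : detour Φ a b h + detour Φ b c h = detour Φ a c h := by
  rw [detour, detour, detour, ← segInt_add hD ho hΦ ha hb hc, segInt_symm Φ b (b + h)]
  ring

theorem convex_box (u v α β : ℝ) :
    Convex ℝ {s : ℂ | (u < s.re ∧ s.re < v) ∧ α < s.im ∧ s.im < β} :=
  ((convex_halfSpace_re_gt u).inter (convex_halfSpace_re_lt v)).inter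
    ((convex_halfSpace_im_gt α).inter (convex_halfSpace_im_lt β))

theorem isOpen_box (u v α β : ℝ) :
    IsOpen {s : ℂ | (u < s.re ∧ s.re < v) ∧ α < s.im ∧ s.im < β} :=
  ((isOpen_lt continuous_const Complex.continuous_re).inter
    (isOpen_lt Complex.continuous_re continuous_const)).inter
    ((isOpen_lt continuous_const Complex.continuous_im).inter
      (isOpen_lt Complex.continuous_im continuous_const))

/-- The interval of imaginary parts at distance less than `m` from `θ` on the side. -/
def Side.interval (s : Side) (θ m : ℝ) : ℝ × ℝ :=
  match s with
  | .left => (θ, θ + m)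
  | .right => (θ - m, θ)

theorem Side.mem_interval {s : Side} {θ m x : ℝ} :
    ((s.interval θ m).1 < x ∧ x < (s.interval θ m).2) ↔
      (0 < s.sgn * (x - θ) ∧ s.sgn * (x - θ) < m) := by
  cases s <;> simp only [Side.interval, Side.sgn] <;> constructor <;> rintro ⟨h1, h2⟩ <;>
    constructor <;> linarith

theorem Side.sgn_mul_self (s : Side) : s.sgn * s.sgn = 1 := by
  cases s <;> simp [Side.sgn]

theorem Side.abs_sgn (s : Side) : |s.sgn| = 1 := by
  cases s <;> simp [Side.sgn]

theorem Side.sgn_mul_le_abs (s : Side) (x : ℝ) : s.sgn * x ≤ |x| := by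
  cases s <;> simp [Side.sgn, le_abs_self, neg_le_abs]

/-- The regular case of `MonodromyClass.exists_detour`. -/
theorem MonodromyClass.exists_detour_regular {kF kG : ℂ → ℂ} {s : Side}
    (hF : MonodromyClass kF s 1) (hG : MonodromyClass kG s 1) :
    ∃ ε > 0, ∀ l₁ l₂ : ℝ, 0 ≤ l₁ → l₁ < ε → 0 ≤ l₂ → l₂ < ε → ∃ δ > 0,
      ∃ k : ℂ → ℂ, MonodromyClass k s 1 ∧ ∀ w : ℂ, ‖w‖ < δ → ∀ η : ℝ, 0 < η →
        η < s.sgn * w.im →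
        detour (fun v => kF v * kG (w - v)) (-l₁) l₂ (s.sgn * η * Complex.I) = k w := by
  obtain ⟨r₁, hr₁, HF, hHF, hF'⟩ := hF.exists_differentiableOn
  obtain ⟨r₂, hr₂, HG, hHG, hG'⟩ := hG.exists_differentiableOn
  set r := min r₁ r₂ / 3 with hr
  have hr0 : 0 < r := by have := lt_min hr₁ hr₂; positivity
  have l1 : 3 * r ≤ r₁ := by linarith [min_le_left r₁ r₂]
  have l2 : 3 * r ≤ r₂ := by linarith [min_le_right r₁ r₂]
  refine ⟨r, hr0, fun l₁ l₂ h1 h1' h2 h2' => ⟨r, hr0,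
    fun w => segInt (fun v => HF v * HG (w - v)) (-l₁) l₂, ?_, fun w hw η hη hηw => ?_⟩⟩
  · refine .of_differentiableOn hr0 (H := fun w => segInt (fun v => HF v * HG (w - v)) (-l₁) l₂)
      ?_ s fun w _ _ => rfl
    refine differentiableOn_segInt Metric.isOpen_ball
      (Φ := fun q : ℂ × ℂ => HF q.2 * HG (q.1 - q.2))
      (D := {q : ℂ × ℂ | ‖q.1‖ < r ∧ ‖q.2‖ < 2 * r}) ?_ (by fun_prop) (by fun_prop)
      fun w hw t ht => ⟨by simpa using hw, ?_⟩
    · refine (hHF.comp (f := Prod.snd) (by fun_prop) fun q hq => ?_).mul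
        (hHG.comp (f := fun q : ℂ × ℂ => q.1 - q.2) (by fun_prop) fun q hq => ?_)
      · rw [mem_ball_zero_iff]; linarith [hq.2]
      · rw [mem_ball_zero_iff]; linarith [hq.1, hq.2, norm_sub_le q.1 q.2]
    · have := add_mul_sub_mem (convex_ball (0 : ℂ) (2 * r)) (a := -l₁) (b := l₂)
        (by simp [abs_of_nonneg h1]; linarith) (by simp [abs_of_nonneg h2]; linarith) ht
      simpa using this
  · have hηr : η < r := by
      linarith [s.sgn_mul_le_abs w.im, Complex.abs_im_le_norm w]
    have hhn : ‖(s.sgn * η * Complex.I : ℂ)‖ < r := by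
      rw [norm_mul, norm_mul, Complex.norm_I, Complex.norm_real, Complex.norm_real,
        Real.norm_eq_abs, Real.norm_eq_abs, s.abs_sgn, abs_of_pos hη]
      linarith
    have hd : DifferentiableOn ℂ (fun v => HF v * HG (w - v)) (Metric.ball 0 (2 * r)) := by
      refine (hHF.mono (Metric.ball_subset_ball (by linarith))).mul
        (hHG.comp (f := fun v : ℂ => w - v) (by fun_prop) fun v hv => ?_)
      rw [mem_ball_zero_iff] at hv ⊢
      linarith [norm_sub_le w v]
    have m1 : (-l₁ : ℂ) ∈ Metric.ball (0 : ℂ) (2 * r) := by simp [abs_of_nonneg h1]; linarith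
    have m2 : (l₂ : ℂ) ∈ Metric.ball (0 : ℂ) (2 * r) := by simp [abs_of_nonneg h2]; linarith
    have m3 : (-l₁ + s.sgn * η * Complex.I : ℂ) ∈ Metric.ball (0 : ℂ) (2 * r) := by
      rw [mem_ball_zero_iff]
      refine (norm_add_le _ _).trans_lt ?_
      simp only [norm_neg, Complex.norm_real, Real.norm_eq_abs, abs_of_nonneg h1]
      linarith
    have m4 : (l₂ + s.sgn * η * Complex.I : ℂ) ∈ Metric.ball (0 : ℂ) (2 * r) := by
      rw [mem_ball_zero_iff]
      refine (norm_add_le _ _).trans_lt ?_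
      simp only [Complex.norm_real, Real.norm_eq_abs, abs_of_nonneg h2]
      linarith
    have hfin : ∀ v ∈ Metric.ball (0 : ℂ) (2 * r), 0 < s.sgn * v.im → s.sgn * v.im ≤ η →
        kF v * kG (w - v) = HF v * HG (w - v) := fun v hv h0 h3 => by
      rw [mem_ball_zero_iff] at hv
      rw [hF' v (Side.mem_halfPlane.2 h0) (by linarith), hG' (w - v) (Side.mem_halfPlane.2 ?_) ?_]
      · rw [Complex.sub_im, mul_sub]; linarith
      · linarith [norm_sub_le w v]
    have hss := s.sgn_mul_self
    have hb := convex_ball (0 : ℂ) (2 * r)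
    have him : ∀ t : ℝ, s.sgn * (t * (s.sgn * η)) = t * η := fun t => by
      linear_combination t * η * hss
    rw [detour_congr (Ψ := fun v => HF v * HG (w - v)), detour,
      segInt_add hb Metric.isOpen_ball hd m1 m3 m4, segInt_add hb Metric.isOpen_ball hd m1 m4 m2]
    · intro t ht
      refine hfin _ ?_ ?_ ?_
      · have := add_mul_sub_mem hb m1 m3 (Set.Ioo_subset_Icc_self ht)
        rwa [add_sub_cancel_left] at this
      · simp [him]; exact mul_pos ht.1 hη
      · simp [him]; nlinarith [ht.2]
    · intro t ht
      refine hfin _ ?_ ?_ ?_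
      · have := add_mul_sub_mem hb m3 m4 (Set.Ioo_subset_Icc_self ht)
        rwa [add_sub_add_right_eq_sub] at this
      · have := him 1
        simp at this ⊢; rw [this]; exact hη
      · have := him 1
        simp at this ⊢; rw [this]
    · intro t ht
      refine hfin _ ?_ ?_ ?_
      · have := add_mul_sub_mem hb m2 m4 (Set.Ioo_subset_Icc_self ht)
        rwa [add_sub_cancel_left] at this
      · simp [him]; exact mul_pos ht.1 hη
      · simp [him]; nlinarith [ht.2]

section

variable {S T : Set ℂ} {f g : ℂ → ℂ} {s : Side} {P R : ℂ → ℂ[X]} {p : ℂ}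

/-- The contribution of a pinch at the logarithm `a` of a singularity of the first factor. -/
noncomputable def pinchPoly (P R : ℂ → ℂ[X]) (p a : ℂ) : ℂ[X] :=
  tensorPoly (P (Complex.exp a)) (R (p * Complex.exp (-a)))

/-- The singularities of the two factors lie on the lines `Im z = θ` and `Im z = θ + Im w`. Rays
being isolated at bounded distance, none lies strictly between. -/
theorem convKernel_mem_box (hF : HasMonodromy f S s P) (hG : HasMonodromy g T s R) (hp : p ≠ 0)
    (θ u v : ℝ) : ∃ κ > 0, ∀ w : ℂ, ‖w‖ < κ → DifferentiableOn ℂ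
      (fun z => convKernel f g p (w, z)) {z | (u - 1 < z.re ∧ z.re < v + 1) ∧
        (s.interval θ (s.sgn * w.im)).1 < z.im ∧ z.im < (s.interval θ (s.sgn * w.im)).2} := by
  obtain ⟨κ, hκ, h1⟩ := exists_punctured_sector_mul hF.locallyFinite hF.zero_notMem
    (Complex.exp_ne_zero (θ * Complex.I)) (v + 1)
  obtain ⟨κ', hκ', h2⟩ := exists_punctured_sector_mul hG.locallyFinite hG.zero_notMem
    (q := p * Complex.exp (-(θ * Complex.I))) (mul_ne_zero hp (Complex.exp_ne_zero _)) (2 - u)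
  refine ⟨min 1 (min κ κ'), lt_min one_pos (lt_min hκ hκ'), fun w hw => ?_⟩
  obtain ⟨w1, w2⟩ := lt_min_iff.1 hw
  obtain ⟨w2, w3⟩ := lt_min_iff.1 w2
  refine (differentiableOn_convKernel hF.differentiableOn hG.differentiableOn p).comp
    (f := fun z => (w, z)) (by fun_prop) fun z hz => ?_
  obtain ⟨⟨z1, z2⟩, z3⟩ := hz
  rw [Side.mem_interval] at z3
  have hσ := s.sgn_mul_le_abs w.im
  have hwn := Complex.abs_im_le_norm w
  have hwr := (abs_le.1 (Complex.abs_re_le_norm w)).2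
  have habs : ∀ x : ℝ, 0 < s.sgn * x → x ≠ 0 ∧ |x| = s.sgn * x := fun x hx => by
    refine ⟨by rintro rfl; simp at hx, ?_⟩
    rw [← abs_of_pos hx, abs_mul, s.abs_sgn, one_mul]
  constructor
  · have := habs (z.im - θ) z3.1
    have := h1 (z - θ * Complex.I) (by simp; linarith) (by simpa using this.1)
      (by simp only [Complex.sub_im, Complex.mul_I_im, Complex.ofReal_re]; linarith)
    rwa [← Complex.exp_add, add_sub_cancel] at this
  · have := habs (w.im - (z.im - θ)) (by linarith)
    have := h2 (w - (z - θ * Complex.I)) (by simp; linarith) (by simpa using this.1)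
      (by simp only [Complex.sub_im, Complex.mul_I_im, Complex.ofReal_re]; linarith)
    rw [mul_assoc, ← Complex.exp_add] at this
    simp only
    convert this using 3
    ring

/-- The integral along a ray, passing between the singularities of both factors on it. -/
theorem exists_detour_convKernel (hF : HasMonodromy f S s P) (hG : HasMonodromy g T s R)
    (hp : p ≠ 0) (θ : ℝ) {u v : ℝ} (huv : u < v)
    (hu : Complex.exp (u + θ * Complex.I) ∉ S ∧ p * Complex.exp (-(u + θ * Complex.I)) ∉ T)
    (hv : Complex.exp (v + θ * Complex.I) ∉ S ∧ p * Complex.exp (-(v + θ * Complex.I)) ∉ T) :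
    ∃ δ > 0, ∃ k : ℂ → ℂ, ∃ A : Finset ℂ, (∀ a ∈ A, (u < a.re ∧ a.re < v) ∧ a.im = θ ∧
        Complex.exp a ∈ S ∧ p * Complex.exp (-a) ∈ T) ∧
      MonodromyClass k s (∏ a ∈ A, pinchPoly P R p a) ∧
      ∀ w : ℂ, ‖w‖ < δ → ∀ η : ℝ, 0 < η → η < s.sgn * w.im →
        detour (fun z => convKernel f g p (w, z)) (u + θ * Complex.I) (v + θ * Complex.I)
          (s.sgn * η * Complex.I) = k w := by
  obtain ⟨κ, hκ, hbox⟩ := convKernel_mem_box hF hG hp θ u v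
  -- Cousin's lemma along the ray, with division points at which neither factor is singular.
  refine of_locally_of_trans (a := u) (b := v)
    (G := fun x => Complex.exp (x + θ * Complex.I) ∉ S ∧
      p * Complex.exp (-(x + θ * Complex.I)) ∉ T)
    (Q := fun u v => ∃ δ > 0, ∃ k : ℂ → ℂ, ∃ A : Finset ℂ, (∀ a ∈ A, (u < a.re ∧ a.re < v) ∧
        a.im = θ ∧ Complex.exp a ∈ S ∧ p * Complex.exp (-a) ∈ T) ∧
      MonodromyClass k s (∏ a ∈ A, pinchPoly P R p a) ∧
      ∀ w : ℂ, ‖w‖ < δ → ∀ η : ℝ, 0 < η → η < s.sgn * w.im →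
        detour (fun z => convKernel f g p (w, z)) (u + θ * Complex.I) (v + θ * Complex.I)
          (s.sgn * η * Complex.I) = k w) ?_ (fun x _ => ?_) (fun x _ => ?_) hu hv huv
  · rintro a b c ha hc hab hbc _ _ _ ⟨δ, hδ, k, A, hA, hk, hd⟩ ⟨δ', hδ', k', A', hA', hk', hd'⟩
    refine ⟨min κ (min δ δ'), lt_min hκ (lt_min hδ hδ'), fun w => k w + k' w, A ∪ A',
      fun x hx => ?_, ?_, fun w hw η hη hηw => ?_⟩
    · rcases Finset.mem_union.1 hx with h | h
      · exact ⟨⟨(hA x h).1.1, (hA x h).1.2.trans hbc⟩, (hA x h).2⟩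
      · exact ⟨⟨hab.trans (hA' x h).1.1, (hA' x h).1.2⟩, (hA' x h).2⟩
    -- The real parts lie in disjoint open intervals, so no pinch is counted twice.
    · rw [Finset.prod_union (Finset.disjoint_left.2 fun x h h' =>
        lt_asymm (hA x h).1.2 (hA' x h').1.1)]
      exact hk.add hk'
    · obtain ⟨w1, w2⟩ := lt_min_iff.1 hw
      obtain ⟨w2, w3⟩ := lt_min_iff.1 w2
      have hm : ∀ x : ℝ, u ≤ x → x ≤ v → (x + θ * Complex.I + s.sgn * η * Complex.I) ∈
          {z : ℂ | (u - 1 < z.re ∧ z.re < v + 1) ∧ (s.interval θ (s.sgn * w.im)).1 < z.im ∧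
            z.im < (s.interval θ (s.sgn * w.im)).2} := fun x h1 h2 => by
        refine ⟨⟨by simp; linarith, by simp; linarith⟩, ?_⟩
        rw [Side.mem_interval]
        have : s.sgn * (s.sgn * η) = η := by linear_combination η * s.sgn_mul_self
        simp [this, hη, hηw]
      beta_reduce
      rw [← hd w w2 η hη hηw, ← hd' w w3 η hη hηw, detour_add (convex_box _ _ _ _)
        (isOpen_box _ _ _ _) (hbox w w1) (hm a ha (by linarith)) (hm b (by linarith) (by linarith))
        (hm c (by linarith) hc)]
  · refine (eventually_notMem hF.locallyFinite (c := fun y => Complex.exp (y + θ * Complex.I))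
      (by fun_prop) (fun y y' h => ?_) x).and (eventually_notMem hG.locallyFinite
      (c := fun y => p * Complex.exp (-(y + θ * Complex.I))) (by fun_prop) (fun y y' h => ?_) x)
    · have := congrArg norm h
      simpa [Complex.norm_exp] using this
    · have := congrArg norm h
      simpa [Complex.norm_exp, hp] using this
  · set q := Complex.exp (x + θ * Complex.I) with hq
    set q' := p * Complex.exp (-(x + θ * Complex.I)) with hq'
    have cF := hF.monodromyClass q (Complex.exp_ne_zero _)
    have cG := hG.monodromyClass q' (mul_ne_zero hp (Complex.exp_ne_zero _))
    -- Translation of `x` to the origin turns the piece of the ray into a local convolution.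
    have htr : ∀ (a b : ℝ) (w h : ℂ), detour (fun z => convKernel f g p (w, z))
        (a + θ * Complex.I) (b + θ * Complex.I) h =
        detour (fun z => f (q * Complex.exp z) * g (q' * Complex.exp (w - z)))
          (-((x - a : ℝ) : ℂ)) ((b - x : ℝ) : ℂ) h := fun a b w h => by
      have e : (fun z => f (q * Complex.exp z) * g (q' * Complex.exp (w - z))) =
          fun z => (fun z => convKernel f g p (w, z)) (z + (x + θ * Complex.I)) := by
        ext z
        simp only [convKernel, hq, hq', mul_assoc, ← Complex.exp_add]
        congr 3 <;> ring_nf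
      rw [e, detour_comp_add (fun z => convKernel f g p (w, z))]
      congr 1 <;> push_cast <;> ring
    -- A good `x` may itself be an end point, so the regular case must allow length zero; at a bad
    -- `x` the ends are distinct from `x`.
    by_cases hgood : q ∉ S ∧ q' ∉ T
    · rw [hF.eq_one q hgood.1] at cF
      rw [hG.eq_one q' hgood.2] at cG
      obtain ⟨ε, hε, h⟩ := cF.exists_detour_regular cG
      refine ⟨ε, hε, fun a b _ _ h1 h2 h3 h4 _ => ?_⟩
      obtain ⟨δ, hδ, k, hk, hd⟩ := h (x - a) (b - x) (by linarith) (by linarith) (by linarith)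
        (by linarith)
      refine ⟨δ, hδ, k, ∅, by simp, by simpa using hk, fun w hw η hη hηw => ?_⟩
      rw [htr, hd w hw η hη hηw]
    · obtain ⟨ε, hε, h⟩ := cF.exists_detour cG (hF.monic q) (hG.monic q')
      refine ⟨ε, hε, fun a b ha hb h1 h2 h3 h4 _ => ?_⟩
      have hax : a ≠ x := by rintro rfl; exact hgood ha
      have hbx : b ≠ x := by rintro rfl; exact hgood hb
      replace h2 := lt_of_le_of_ne h2 hax
      replace h3 := lt_of_le_of_ne h3 hbx.symm
      obtain ⟨δ, hδ, k, hk, hd⟩ := h (x - a) (b - x) (by linarith) (by linarith) (by linarith)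
        (by linarith)
      by_cases hpinch : q ∈ S ∧ q' ∈ T
      · refine ⟨δ, hδ, k, {x + θ * Complex.I}, ?_, ?_, fun w hw η hη hηw => ?_⟩
        · intro y hy
          rw [Finset.mem_singleton] at hy
          subst hy
          exact ⟨by simp [h2, h3], by simp, hpinch⟩
        · rw [Finset.prod_singleton]; exact hk
        · rw [htr, hd w hw η hη hηw]
      -- Only one factor is singular at this point, so nothing is pinched.
      · rw [tensorPoly_eq_one] at hk
        · refine ⟨δ, hδ, k, ∅, by simp, by simpa using hk, fun w hw η hη hηw => ?_⟩
          rw [htr, hd w hw η hη hηw]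
        · by_cases hqS : q ∈ S
          · exact Or.inr (hG.eq_one q' fun h => hpinch ⟨hqS, h⟩)
          · exact Or.inl (hF.eq_one q hqS)

end

/-! ### Continuation of the contribution of an interval of angles to a side. -/

/-- The part `Re w < δ`, `η < |Im w| < δ` of the side. -/
def Side.sector (s : Side) (η δ : ℝ) : Set ℂ :=
  {w | w.re < δ ∧ (s.interval (s.sgn * η) (δ - η)).1 < w.im ∧
    w.im < (s.interval (s.sgn * η) (δ - η)).2}

theorem Side.mem_sector {s : Side} {η δ : ℝ} {w : ℂ} :
    w ∈ s.sector η δ ↔ w.re < δ ∧ η < s.sgn * w.im ∧ s.sgn * w.im < δ := by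
  rw [Side.sector, Set.mem_ofPred_eq, Side.mem_interval]
  have : s.sgn * (w.im - s.sgn * η) = s.sgn * w.im - η := by
    linear_combination (-η) * s.sgn_mul_self
  rw [this, sub_pos, sub_lt_sub_iff_right]

theorem Side.isOpen_sector (s : Side) (η δ : ℝ) : IsOpen (s.sector η δ) :=
  isOpen_lt_re_im _ _ _

theorem Side.sector_mono {s : Side} {η δ δ' : ℝ} (h : δ ≤ δ') :
    s.sector η δ ⊆ s.sector η δ' := fun w hw => by
  rw [Side.mem_sector] at hw ⊢
  exact ⟨by linarith, hw.2.1, by linarith⟩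

/-- The contribution of the angles between `a` and `b`, continued to the side. -/
def SideSum (f : ℂ → ℂ) (S T : Set ℂ) (s : Side) (P R : ℂ → ℂ[X]) (B : ℕ → ℂ) (p : ℂ)
    (x₀ x₁ ε a b : ℝ) : Prop :=
  ∃ δ > 0, ∃ k : ℂ → ℂ, ∃ A : Finset ℂ, (∀ α ∈ A, (min a b < α.im ∧ α.im < max a b) ∧
      Complex.exp α ∈ S ∧ p * Complex.exp (-α) ∈ T) ∧
    MonodromyClass k s (∏ α ∈ A, pinchPoly P R p α) ∧
    ∀ η : ℝ, 0 < η → η < δ → ∃ K : ℂ → ℂ, DifferentiableOn ℂ K (s.sector η δ) ∧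
      (∀ w ∈ s.sector η δ, ‖p * Complex.exp w‖ < ε → PartialSum f B p x₀ x₁ a b w (K w)) ∧
      ∀ w : ℂ, ‖w‖ < δ → η < s.sgn * w.im → K w = k w

section

variable {S T : Set ℂ} {f g : ℂ → ℂ} {s : Side} {P R : ℂ → ℂ[X]} {B : ℕ → ℂ} {p : ℂ}
  {x₀ x₁ r : ℝ}

theorem SideSum.symm {ε a b : ℝ} (h : SideSum f S T s P R B p x₀ x₁ ε a b) :
    SideSum f S T s P R B p x₀ x₁ ε b a := by
  obtain ⟨δ, hδ, k, A, hA, hk, h⟩ := h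
  refine ⟨δ, hδ, fun w => -1 * k w, A, by rwa [min_comm, max_comm], hk.const_mul (-1),
    fun η hη hηδ => ?_⟩
  obtain ⟨K, h1, h2, h3⟩ := h η hη hηδ
  exact ⟨fun w => -K w, h1.neg, fun w hw hs => (h2 w hw hs).symm,
    fun w hw hwη => by beta_reduce; rw [h3 w hw hwη, neg_one_mul]⟩

theorem SideSum.add (h : Levels S T p x₀ x₁) (hf : DifferentiableOn ℂ f (starDomain S))
    {ε a b c : ℝ} (hab : a < b) (hbc : b < c) (h1 : SideSum f S T s P R B p x₀ x₁ ε a b)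
    (h2 : SideSum f S T s P R B p x₀ x₁ ε b c) : SideSum f S T s P R B p x₀ x₁ ε a c := by
  obtain ⟨δ, hδ, k, A, hA, hk, h1⟩ := h1
  obtain ⟨δ', hδ', k', A', hA', hk', h2⟩ := h2
  rw [min_eq_left hab.le, max_eq_right hab.le] at hA
  rw [min_eq_left hbc.le, max_eq_right hbc.le] at hA'
  have l1 := min_le_left δ δ'
  have l2 := min_le_right δ δ'
  refine ⟨min δ δ', lt_min hδ hδ', fun w => k w + k' w, A ∪ A', fun x hx => ?_, ?_,
    fun η hη hηδ => ?_⟩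
  · rw [min_eq_left (hab.trans hbc).le, max_eq_right (hab.trans hbc).le]
    rcases Finset.mem_union.1 hx with h | h
    · exact ⟨⟨(hA x h).1.1, (hA x h).1.2.trans hbc⟩, (hA x h).2⟩
    · exact ⟨⟨hab.trans (hA' x h).1.1, (hA' x h).1.2⟩, (hA' x h).2⟩
  · rw [Finset.prod_union (Finset.disjoint_left.2 fun x h h' =>
      lt_asymm (hA x h).1.2 (hA' x h').1.1)]
    exact hk.add hk'
  · obtain ⟨K, d1, s1, e1⟩ := h1 η hη (by linarith)
    obtain ⟨K', d2, s2, e2⟩ := h2 η hη (by linarith)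
    exact ⟨K + K', (d1.mono (Side.sector_mono l1)).add (d2.mono (Side.sector_mono l2)),
      fun w hw hs => (s1 w (Side.sector_mono l1 hw) hs).add h hf
        (s2 w (Side.sector_mono l2 hw) hs), fun w hw hwη => by
        rw [Pi.add_apply, e1 w (by linarith) hwη, e2 w (by linarith) hwη]⟩

/-- Near an unobstructed angle. -/
theorem sideSum_of_goodAngle (hF : HasMonodromy f S s P) (hG : HasMonodromy g T s R)
    (h : Levels S T p x₀ x₁) (hg : ∀ z : ℂ, ‖z‖ < r → HasSum (fun n => B n * z ^ n) (g z))
    (hr : 0 < r) {θ : ℝ} (hθ : GoodAngle S T p x₀ x₁ θ) : ∃ κ > 0, ∀ a b : ℝ,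
      GoodAngle S T p x₀ x₁ a → GoodAngle S T p x₀ x₁ b → θ - κ < a → a ≤ b → b < θ + κ →
        SideSum f S T s P R B p x₀ x₁ (r * Real.exp x₀) a b := by
  obtain ⟨κ, hκ, h2⟩ := exists_sector hG.locallyFinite p (a := -θ) (b := -θ) (y := -x₀) (by
    simpa [add_comm] using hθ.2)
  simp only [min_self, max_self] at h2
  set δ := κ / 2 with hδ
  have hδ0 : 0 < δ := half_pos hκ
  refine ⟨δ, hδ0, fun a b ha hb ha1 hab hb1 => ?_⟩
  set K : ℂ → ℂ := fun w => hook (fun s => convKernel f g p (w, s)) x₁ x₀ a b with hK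
  have hh : HookIn S x₁ x₀ a b := ⟨h.le, ha.1, hb.1, fun t _ => h.exp_mem (by simp)⟩
  have hd : DifferentiableOn ℂ K {w | w.re < δ ∧ -δ < w.im ∧ w.im < δ} := by
    refine differentiableOn_hook hF.differentiableOn hG.differentiableOn hh (isOpen_lt_re_im _ _ _)
      fun w hw t ht => ?_
    rw [Set.uIcc_of_le hab] at ht
    obtain ⟨w1, w2, w3⟩ := hw
    exact h2 _ (by simp; linarith) (by simp; linarith [ht.2]) (by simp; linarith [ht.1])
  refine ⟨δ, hδ0, K, ∅, by simp, ?_, fun η hη hηδ => ⟨K, hd.mono fun w hw => ?_, fun w hw h4 =>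
    partialSum_hook hF.locallyFinite hF.differentiableOn hh le_rfl hg hr h4, fun _ _ _ => rfl⟩⟩
  · rw [Finset.prod_empty]
    refine .of_differentiableOn hδ0 (hd.mono fun w hw => ?_) s fun _ _ _ => rfl
    rw [mem_ball_zero_iff] at hw
    have h1 := abs_le.1 (Complex.abs_re_le_norm w)
    have h2 := abs_le.1 (Complex.abs_im_le_norm w)
    exact ⟨by linarith, by linarith, by linarith⟩
  · rw [Side.mem_sector] at hw
    cases s <;> simp only [Side.sgn] at hw <;>
      exact ⟨hw.1, by linarith [hw.2.1, hw.2.2], by linarith [hw.2.1, hw.2.2]⟩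

set_option maxHeartbeats 1600000 in
/-- Near an obstructed angle: the path passes between the singularities of both factors. -/
theorem sideSum_of_obstructed (hF : HasMonodromy f S s P) (hG : HasMonodromy g T s R)
    (h : Levels S T p x₀ x₁) (hlt : x₀ < x₁)
    (hg : ∀ z : ℂ, ‖z‖ < r → HasSum (fun n => B n * z ^ n) (g z)) (hr : 0 < r) {θ : ℝ}
    (h1 : Complex.exp (x₁ + θ * Complex.I) ∉ S) (h0 : p * Complex.exp (-(x₀ + θ * Complex.I)) ∉ T) :
    ∃ κ > 0, ∀ a b : ℝ, 0 < s.sgn * (θ - a) → s.sgn * (θ - a) < κ → 0 < s.sgn * (b - θ) →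
      s.sgn * (b - θ) < κ → SideSum f S T s P R B p x₀ x₁ (r * Real.exp x₀) a b := by
  set c₀ : ℂ := x₀ + θ * Complex.I with hc₀
  set c₁ : ℂ := x₁ + θ * Complex.I with hc₁
  set σ := s.sgn with hσ
  have hσσ : σ * σ = 1 := s.sgn_mul_self
  have hσle : ∀ x, σ * x ≤ |x| := s.sgn_mul_le_abs
  have habs : ∀ x : ℝ, 0 < σ * x → x ≠ 0 ∧ |x| = σ * x := fun x hx => by
    refine ⟨by rintro rfl; simp at hx, ?_⟩
    rw [← abs_of_pos hx, abs_mul, s.abs_sgn, one_mul]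
  -- local extensions at the two radii
  have cF := hF.monodromyClass (Complex.exp c₁) (Complex.exp_ne_zero _)
  rw [hF.eq_one _ h1] at cF
  have cG := hG.monodromyClass (p * Complex.exp (-c₀)) (mul_ne_zero h.ne_zero (Complex.exp_ne_zero _))
  rw [hG.eq_one _ h0] at cG
  obtain ⟨ρ₁, hρ₁, HF, hHF, hHF'⟩ := cF.exists_differentiableOn
  obtain ⟨ρ₂, hρ₂, HG, hHG, hHG'⟩ := cG.exists_differentiableOn
  obtain ⟨κ₁, hκ₁, sF⟩ := exists_punctured_sector hF.locallyFinite hF.zero_notMem θ x₁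
  obtain ⟨κ₂, hκ₂, sG⟩ := exists_punctured_sector_mul hG.locallyFinite hG.zero_notMem
    (q := p * Complex.exp (-(θ * Complex.I))) (mul_ne_zero h.ne_zero (Complex.exp_ne_zero _))
    (1 - x₀)
  -- Division by `3` leaves room for `‖w‖ < κ` together with points at distance less than `2 κ` from
  -- `c₀` or `c₁`.
  set κ : ℝ := min (min 1 (min ρ₁ ρ₂)) (min κ₁ κ₂) / 3 with hκ
  have hm0 : 0 < min (min 1 (min ρ₁ ρ₂)) (min κ₁ κ₂) :=
    lt_min (lt_min one_pos (lt_min hρ₁ hρ₂)) (lt_min hκ₁ hκ₂)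
  have hκ0 : 0 < κ := by positivity
  have m1 : 3 * κ ≤ min 1 (min ρ₁ ρ₂) := by
    linarith [min_le_left (min 1 (min ρ₁ ρ₂)) (min κ₁ κ₂)]
  have m2 : 3 * κ ≤ min κ₁ κ₂ := by
    linarith [min_le_right (min 1 (min ρ₁ ρ₂)) (min κ₁ κ₂)]
  have b1 : 3 * κ ≤ 1 := m1.trans (min_le_left _ _)
  have b2 : 3 * κ ≤ ρ₁ := m1.trans ((min_le_right _ _).trans (min_le_left _ _))
  have b3 : 3 * κ ≤ ρ₂ := m1.trans ((min_le_right _ _).trans (min_le_right _ _))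
  have b4 : 3 * κ ≤ κ₁ := m2.trans (min_le_left _ _)
  have b5 : 3 * κ ≤ κ₂ := m2.trans (min_le_right _ _)
  refine ⟨κ, hκ0, fun a b ha ha' hb hb' => ?_⟩
  obtain ⟨δ₀, hδ₀, k, A, hA, hk, hd⟩ := exists_detour_convKernel hF hG h.ne_zero θ hlt
    ⟨notMem_of_mem_starDomain (h.exp_mem (by simp)), h0⟩
    ⟨h1, notMem_of_mem_starDomain (h.mul_exp_mem (by simp))⟩
  -- The last bound keeps the moved singularities of the second factor away from the angle `a`, for
  -- `w` on either side.
  set δ : ℝ := min (min δ₀ κ) (σ * (θ - a)) with hδ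
  have hδ0 : 0 < δ := lt_min (lt_min hδ₀ hκ0) ha
  have d1 : δ ≤ δ₀ := (min_le_left _ _).trans (min_le_left _ _)
  have d2 : δ ≤ κ := (min_le_left _ _).trans (min_le_right _ _)
  have d3 : δ ≤ σ * (θ - a) := min_le_right _ _
  have memF : ∀ z : ℂ, z.re ≤ x₁ → 0 < |z.im - θ| → |z.im - θ| < κ₁ →
      Complex.exp z ∈ starDomain S := sF
  have memG : ∀ w z : ℂ, w.re - z.re ≤ 1 - x₀ → 0 < σ * (w.im - (z.im - θ)) →
      σ * (w.im - (z.im - θ)) < κ₂ → p * Complex.exp (w - z) ∈ starDomain T := fun w z h1 h2 h3 => by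
    have := habs _ h2
    have := sG (w - z + θ * Complex.I) (by simpa using h1)
      (by simpa [sub_add] using this.1) (by simpa [sub_add, this.2] using h3)
    rw [mul_assoc, ← Complex.exp_add] at this
    convert this using 3
    ring
  have hD := differentiableOn_convKernel hF.differentiableOn hG.differentiableOn p
  have wre : ∀ w : ℂ, ‖w‖ < δ → w.re < δ := fun w hw => (Complex.re_le_norm w).trans_lt hw
  have wim : ∀ w : ℂ, ‖w‖ < δ → |σ * w.im| < δ := fun w hw => by
    rw [abs_mul, s.abs_sgn, one_mul]; exact (Complex.abs_im_le_norm w).trans_lt hw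
  have haθ := habs (θ - a) ha
  have hbθ := habs (b - θ) hb
  -- the three fixed parts of the path
  set M : ℂ → ℂ := fun w => segInt (fun z => convKernel f g p (w, z)) (x₁ + a * Complex.I)
    (x₀ + a * Complex.I) with hM
  set Ψ₀ : ℂ → ℂ → ℂ := fun w z => f (Complex.exp z) * HG (w - (z - c₀)) with hΨ₀
  set Ψ₁ : ℂ → ℂ → ℂ := fun w z => HF (z - c₁) * g (p * Complex.exp (w - z)) with hΨ₁
  have hMd : DifferentiableOn ℂ M (Metric.ball 0 δ) := by
    refine differentiableOn_segInt Metric.isOpen_ball hD (by fun_prop) (by fun_prop)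
      fun w hw t ht => ?_
    rw [mem_ball_zero_iff] at hw
    have := wre w hw
    have := abs_lt.1 (wim w hw)
    constructor
    · refine memF _ ?_ ?_ ?_
      · simp; nlinarith [ht.1]
      · simpa [abs_sub_comm] using abs_pos.2 haθ.1
      · simp [abs_sub_comm a θ, haθ.2]; linarith
    · refine memG _ _ ?_ ?_ ?_
      · simp; nlinarith [ht.2]
      · simp; linarith
      · simp; linarith
  have hΨ₀d : ∀ w : ℂ, ‖w‖ < δ → DifferentiableOn ℂ (Ψ₀ w) (Metric.ball c₀ (2 * κ)) :=
    fun w hw => by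
    refine (hF.differentiableOn.comp (f := Complex.exp) (by fun_prop) fun z hz => ?_).mul
      (hHG.comp (f := fun z => w - (z - c₀)) (by fun_prop) fun z hz => ?_)
    · rw [Metric.mem_ball, dist_eq_norm] at hz
      have := (Complex.re_le_norm _).trans_lt hz
      refine h.exp_mem ?_
      simp [hc₀] at this
      linarith
    · rw [Metric.mem_ball, dist_eq_norm] at hz
      rw [mem_ball_zero_iff]
      linarith [norm_sub_le w (z - c₀)]
  have hΨ₁d : ∀ w : ℂ, ‖w‖ < δ → DifferentiableOn ℂ (Ψ₁ w) (Metric.ball c₁ (2 * κ)) :=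
    fun w hw => by
    refine (hHF.comp (f := fun z => z - c₁) (by fun_prop) fun z hz => ?_).mul
      (hG.differentiableOn.comp (f := fun z => p * Complex.exp (w - z)) (by fun_prop)
      fun z hz => ?_)
    · rw [Metric.mem_ball, dist_eq_norm] at hz
      rw [mem_ball_zero_iff]
      linarith
    · rw [Metric.mem_ball, dist_eq_norm] at hz
      have := abs_lt.1 ((Complex.abs_re_le_norm _).trans_lt hz)
      refine h.mul_exp_mem ?_
      simp [hc₁] at this
      rw [Complex.sub_re]
      linarith [wre w hw]
  have na : ‖(x₀ + a * Complex.I : ℂ) - c₀‖ < 2 * κ := by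
    rw [hc₀, show (x₀ + a * Complex.I - (x₀ + θ * Complex.I) : ℂ) =
      ((a - θ : ℝ) : ℂ) * Complex.I by push_cast; ring, norm_mul, Complex.norm_I, mul_one,
      Complex.norm_real, Real.norm_eq_abs, abs_sub_comm, haθ.2]
    linarith
  have nb : ‖(x₁ + b * Complex.I : ℂ) - c₁‖ < 2 * κ := by
    rw [hc₁, show (x₁ + b * Complex.I - (x₁ + θ * Complex.I) : ℂ) =
      ((b - θ : ℝ) : ℂ) * Complex.I by push_cast; ring, norm_mul, Complex.norm_I, mul_one,
      Complex.norm_real, Real.norm_eq_abs, hbθ.2]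
    linarith
  have hball : ∀ c : ℂ, c ∈ Metric.ball c (2 * κ) := fun c => Metric.mem_ball_self (by linarith)
  have hN₀ : DifferentiableOn ℂ (fun w => segInt (Ψ₀ w) (x₀ + a * Complex.I) c₀)
      (Metric.ball 0 δ) := by
    refine differentiableOn_segInt Metric.isOpen_ball (Φ := fun q => Ψ₀ q.1 q.2)
      (D := {q | ‖q.1‖ < δ ∧ q.2 ∈ Metric.ball c₀ (2 * κ)}) ?_ (by fun_prop) (by fun_prop)
      fun w hw t ht => ⟨by simpa using hw, ?_⟩
    · refine (hF.differentiableOn.comp (f := fun q : ℂ × ℂ => Complex.exp q.2) (by fun_prop)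
        fun q hq => ?_).mul (hHG.comp (f := fun q : ℂ × ℂ => q.1 - (q.2 - c₀)) (by fun_prop)
        fun q hq => ?_)
      · have hz := hq.2
        rw [Metric.mem_ball, dist_eq_norm] at hz
        have := (Complex.re_le_norm _).trans_lt hz
        refine h.exp_mem ?_
        simp [hc₀] at this
        linarith
      · have hz := hq.2
        rw [Metric.mem_ball, dist_eq_norm] at hz
        rw [mem_ball_zero_iff]
        linarith [norm_sub_le q.1 (q.2 - c₀), hq.1]
    · exact add_mul_sub_mem (convex_ball _ _) (by rwa [Metric.mem_ball, dist_eq_norm])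
        (hball c₀) ht
  have hN₁ : DifferentiableOn ℂ (fun w => segInt (Ψ₁ w) c₁ (x₁ + b * Complex.I))
      (Metric.ball 0 δ) := by
    refine differentiableOn_segInt Metric.isOpen_ball (Φ := fun q => Ψ₁ q.1 q.2)
      (D := {q | ‖q.1‖ < δ ∧ q.2 ∈ Metric.ball c₁ (2 * κ)}) ?_ (by fun_prop) (by fun_prop)
      fun w hw t ht => ⟨by simpa using hw, ?_⟩
    · refine (hHF.comp (f := fun q : ℂ × ℂ => q.2 - c₁) (by fun_prop) fun q hq => ?_).mul
        (hG.differentiableOn.comp (f := fun q : ℂ × ℂ => p * Complex.exp (q.1 - q.2))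
        (by fun_prop) fun q hq => ?_)
      · have hz := hq.2
        rw [Metric.mem_ball, dist_eq_norm] at hz
        rw [mem_ball_zero_iff]
        linarith
      · have hz := hq.2
        rw [Metric.mem_ball, dist_eq_norm] at hz
        have := abs_lt.1 ((Complex.abs_re_le_norm _).trans_lt hz)
        refine h.mul_exp_mem ?_
        simp [hc₁] at this
        rw [Complex.sub_re]
        linarith [wre q.1 hq.1]
    · exact add_mul_sub_mem (convex_ball _ _) (hball c₁)
        (by rwa [Metric.mem_ball, dist_eq_norm]) ht
  -- The first three terms are holomorphic at `w = 0`; all pinches are contained in `k`.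
  refine ⟨δ, hδ0, fun w => (M w + segInt (Ψ₀ w) (x₀ + a * Complex.I) c₀ +
    segInt (Ψ₁ w) c₁ (x₁ + b * Complex.I)) + k w, A, fun α hα => ?_, ?_, fun η hη hηδ => ?_⟩
  · obtain ⟨-, e1, e2⟩ := hA α hα
    refine ⟨?_, e2⟩
    rw [e1]
    rcases lt_or_gt_of_ne haθ.1 with h' | h' <;>
      rcases lt_or_gt_of_ne hbθ.1 with h'' | h''
    · exact ⟨(min_le_right _ _).trans_lt (by linarith), lt_of_lt_of_le (by linarith)
        (le_max_left a b)⟩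
    · nlinarith
    · nlinarith
    · exact ⟨(min_le_left _ _).trans_lt (by linarith), lt_of_lt_of_le (by linarith)
        (le_max_right a b)⟩
  · rw [← one_mul (∏ α ∈ A, pinchPoly P R p α)]
    exact (MonodromyClass.of_differentiableOn hδ0 ((hMd.add hN₀).add hN₁) s
      fun _ _ _ => rfl).add hk
  -- the path for `w` at distance more than `η` from the ray
  set b' : ℝ := θ + σ * η with hb'
  have hσb' : σ * (b' - θ) = η := by rw [hb']; linear_combination η * hσσ
  have hb'θ := habs (b' - θ) (by rw [hσb']; exact hη)
  rw [hσb'] at hb'θ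
  have hcase : ∀ {u v t : ℝ}, t ∈ Set.uIcc u v → min (σ * (u - θ)) (σ * (v - θ)) ≤ σ * (t - θ) ∧
      σ * (t - θ) ≤ max (σ * (u - θ)) (σ * (v - θ)) := fun {u v t} ht => by
    have h2 : σ * (t - θ) ∈ Set.uIcc (σ * (u - θ)) (σ * (v - θ)) := by
      have := Set.mem_image_of_mem (fun x => σ * (x - θ)) ht
      rwa [← Set.image_image (fun x => σ * x) (fun x => x - θ), Set.image_sub_const_uIcc,
        Set.image_const_mul_uIcc] at this
    exact h2
  have hh1 : HookIn S x₁ x₀ a b' := by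
    refine ⟨h.le, memF _ (by simp) ?_ ?_, memF _ (by simp) ?_ ?_, fun t _ => h.exp_mem (by simp)⟩
    · simpa [abs_sub_comm] using abs_pos.2 haθ.1
    · simp [abs_sub_comm a θ, haθ.2]; linarith
    · simpa using abs_pos.2 hb'θ.1
    · simp [hb'θ.2]; linarith
  have hh2 : HookIn S x₁ x₁ b' b := by
    have hmem : ∀ t ∈ Set.uIcc b' b, Complex.exp (x₁ + t * Complex.I) ∈ starDomain S :=
      fun t ht => by
        have h2 := hcase ht
        rw [hσb'] at h2
        have h3 := habs (t - θ) ((lt_min hη hb).trans_le h2.1)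
        refine memF _ (by simp) (by simpa using abs_pos.2 h3.1) ?_
        have := max_lt (show η < 3 * κ by linarith) (show σ * (b - θ) < 3 * κ by linarith)
        simp [h3.2]
        linarith
    exact ⟨le_rfl, hmem b' Set.left_mem_uIcc, hmem b Set.right_mem_uIcc, hmem⟩
  have hco1 : ∀ w ∈ s.sector η δ, HookCoIn T p x₀ a b' w := fun w hw t ht => by
    rw [Side.mem_sector] at hw
    have h2 := hcase ht
    rw [hσb'] at h2
    have h3 : -κ < min (σ * (a - θ)) η := lt_min (by linarith) (by linarith)
    have h4 : max (σ * (a - θ)) η ≤ η := max_le (by linarith) le_rfl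
    refine memG _ _ (by simp; linarith) ?_ ?_
    · simp; rw [mul_sub]; linarith
    · simp; rw [mul_sub]; linarith
  have hco2 : ∀ w ∈ s.sector η δ, HookCoIn T p x₁ b' b w := fun w hw t _ => by
    rw [Side.mem_sector] at hw
    exact h.mul_exp_mem (by simp; linarith)
  -- The path crosses the ray of the first factor at radius `exp x₀`, runs outwards between the two
  -- rows at angle `b'`, and goes on at radius `exp x₁`.
  refine ⟨fun w => hook (fun z => convKernel f g p (w, z)) x₁ x₀ a b' +
    hook (fun z => convKernel f g p (w, z)) x₁ x₁ b' b,
    (differentiableOn_hook hF.differentiableOn hG.differentiableOn hh1 (s.isOpen_sector _ _)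
      hco1).add (differentiableOn_hook hF.differentiableOn hG.differentiableOn hh2
      (s.isOpen_sector _ _) hco2), fun w _ hε =>
    (partialSum_hook hF.locallyFinite hF.differentiableOn hh1 le_rfl hg hr hε).add h
      hF.differentiableOn (partialSum_hook hF.locallyFinite hF.differentiableOn hh2 h.le hg hr hε),
    fun w hw hηw => ?_⟩
  have hkd := hd w (hw.trans_le d1) η hη hηw
  beta_reduce
  rw [← hkd]
  set hv : ℂ := σ * η * Complex.I with hhv
  have hvn : ‖hv‖ < 2 * κ := by
    rw [hhv, norm_mul, norm_mul, Complex.norm_I, Complex.norm_real, Complex.norm_real,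
      Real.norm_eq_abs, Real.norm_eq_abs, s.abs_sgn, abs_of_pos hη]
    linarith
  have e0 : (x₀ + b' * Complex.I : ℂ) = c₀ + hv := by
    rw [hb', hc₀, hhv]; push_cast; ring
  have e1 : (x₁ + b' * Complex.I : ℂ) = c₁ + hv := by
    rw [hb', hc₁, hhv]; push_cast; ring
  have hc₀im : ∀ t : ℝ, σ * ((c₀ + t * hv).im - θ) = t * η := fun t => by
    simp [hc₀, hhv]; linear_combination t * η * hσσ
  have hc₁im : ∀ t : ℝ, σ * ((c₁ + t * hv).im - θ) = t * η := fun t => by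
    simp [hc₁, hhv]; linear_combination t * η * hσσ
  have hk0 : ∀ z ∈ Metric.ball c₀ (2 * κ), σ * (z.im - θ) < σ * w.im →
      convKernel f g p (w, z) = Ψ₀ w z := fun z hz hzim => by
    rw [Metric.mem_ball, dist_eq_norm] at hz
    simp only [convKernel, hΨ₀]
    rw [← hHG' (w - (z - c₀)) (Side.mem_halfPlane.2 ?_) ?_]
    · rw [mul_assoc, ← Complex.exp_add]
      congr 4
      ring
    · simp [hc₀]; linarith
    · linarith [norm_sub_le w (z - c₀)]
  have hk1 : ∀ z ∈ Metric.ball c₁ (2 * κ), 0 < σ * (z.im - θ) →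
      convKernel f g p (w, z) = Ψ₁ w z := fun z hz hzim => by
    rw [Metric.mem_ball, dist_eq_norm] at hz
    simp only [convKernel, hΨ₁]
    rw [← hHF' (z - c₁) (Side.mem_halfPlane.2 ?_) ?_]
    · rw [← Complex.exp_add]
      congr 3
      ring
    · simpa [hc₁] using hzim
    · linarith
  have p1 : (x₀ + a * Complex.I : ℂ) ∈ Metric.ball c₀ (2 * κ) := by
    rwa [Metric.mem_ball, dist_eq_norm]
  have p2 : c₀ + hv ∈ Metric.ball c₀ (2 * κ) := by
    rwa [Metric.mem_ball, dist_eq_norm, add_sub_cancel_left]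
  have p3 : (x₁ + b * Complex.I : ℂ) ∈ Metric.ball c₁ (2 * κ) := by
    rwa [Metric.mem_ball, dist_eq_norm]
  have p4 : c₁ + hv ∈ Metric.ball c₁ (2 * κ) := by
    rwa [Metric.mem_ball, dist_eq_norm, add_sub_cancel_left]
  have q1 : segInt (fun z => convKernel f g p (w, z)) (x₀ + a * Complex.I) (c₀ + hv) =
      segInt (Ψ₀ w) (x₀ + a * Complex.I) (c₀ + hv) := segInt_congr fun t ht => by
    refine hk0 _ (add_mul_sub_mem (convex_ball _ _) p1 p2 (Set.Ioo_subset_Icc_self ht)) ?_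
    have : (x₀ + a * Complex.I + t * (c₀ + hv - (x₀ + a * Complex.I)) : ℂ).im - θ =
        (1 - t) * (a - θ) + t * (σ * η) := by
      simp [hc₀, hhv]; ring
    rw [this]
    have h5 : σ * ((1 - t) * (a - θ) + t * (σ * η)) = (1 - t) * (σ * (a - θ)) + t * η := by
      linear_combination t * η * hσσ
    rw [h5]
    nlinarith [ht.1, ht.2]
  have q2 : segInt (fun z => convKernel f g p (w, z)) c₀ (c₀ + hv) =
      segInt (Ψ₀ w) c₀ (c₀ + hv) := segInt_congr fun t ht => by
    refine hk0 _ (add_mul_sub_mem (convex_ball _ _) (hball c₀) p2 (Set.Ioo_subset_Icc_self ht)) ?_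
    rw [add_sub_cancel_left, hc₀im]
    nlinarith [ht.1, ht.2]
  have q3 : segInt (fun z => convKernel f g p (w, z)) (c₁ + hv) (x₁ + b * Complex.I) =
      segInt (Ψ₁ w) (c₁ + hv) (x₁ + b * Complex.I) := segInt_congr fun t ht => by
    refine hk1 _ (add_mul_sub_mem (convex_ball _ _) p4 p3 (Set.Ioo_subset_Icc_self ht)) ?_
    have : (c₁ + hv + t * (x₁ + b * Complex.I - (c₁ + hv)) : ℂ).im - θ =
        t * (b - θ) + (1 - t) * (σ * η) := by
      simp [hc₁, hhv]; ring
    rw [this]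
    have h5 : σ * (t * (b - θ) + (1 - t) * (σ * η)) = t * (σ * (b - θ)) + (1 - t) * η := by
      linear_combination (1 - t) * η * hσσ
    rw [h5]
    nlinarith [ht.1, ht.2, mul_pos ht.1 hb]
  have q4 : segInt (fun z => convKernel f g p (w, z)) c₁ (c₁ + hv) =
      segInt (Ψ₁ w) c₁ (c₁ + hv) := segInt_congr fun t ht => by
    refine hk1 _ (add_mul_sub_mem (convex_ball _ _) (hball c₁) p4 (Set.Ioo_subset_Icc_self ht)) ?_
    rw [add_sub_cancel_left, hc₁im]
    exact mul_pos ht.1 hη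
  have r1 := segInt_add (convex_ball c₀ (2 * κ)) Metric.isOpen_ball (hΨ₀d w hw) p1 (hball c₀) p2
  have r2 := segInt_add (convex_ball c₁ (2 * κ)) Metric.isOpen_ball (hΨ₁d w hw) (hball c₁) p4 p3
  -- The hooks equal the three fixed parts plus the detour from `c₀` to `c₁`. The connecting pieces
  -- at both ends are exchanged inside the discs where the extended kernels `Ψ₀` and `Ψ₁` are
  -- holomorphic.
  rw [hook, hook, detour, e0, e1, segInt_self, segInt_self, q1, q2, q3,
    segInt_symm _ c₁ (c₁ + hv), q4, ← r1, ← r2]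
  simp only [hM]
  ring

end

/-! ### Choice of radii and continuation over a full turn. -/

theorem exists_norm_ne {S : Set ℂ} (hS : ∀ R : ℝ, (S ∩ Metric.closedBall 0 R).Finite) {c : ℝ → ℝ}
    (hc : Continuous c) (hi : Function.Injective c) {a b : ℝ} (hab : a < b) :
    ∃ x, a < x ∧ x < b ∧ ∀ z : ℂ, ‖z‖ = c x → z ∉ S := by
  -- The norms of the points of `S` again form a locally finite set, so a generic circle avoids `S`.
  set N : Set ℂ := (fun z : ℂ => (‖z‖ : ℂ)) '' S with hN
  have hNf : ∀ R : ℝ, (N ∩ Metric.closedBall 0 R).Finite := fun R => by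
    refine ((hS R).image fun z : ℂ => (‖z‖ : ℂ)).subset ?_
    rintro _ ⟨⟨z, hz, rfl⟩, h⟩
    exact ⟨z, ⟨hz, by simpa using h⟩, rfl⟩
  have h1 := eventually_notMem hNf (c := fun y => (c y : ℂ)) (by fun_prop)
    (Complex.ofReal_injective.comp hi) ((a + b) / 2)
  have h2 : ∀ᶠ y in 𝓝[≠] ((a + b) / 2), y ∈ Set.Ioo a b :=
    nhdsWithin_le_nhds (Ioo_mem_nhds (by linarith) (by linarith))
  obtain ⟨x, hx, hx2⟩ := (h1.and h2).exists
  exact ⟨x, hx2.1, hx2.2, fun z hz hzS => hx ⟨z, hzS, by simp [hz]⟩⟩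

/-- The inner radius is chosen small for `f` and the outer one large for the reflected `g`, with a
margin of `1` in the logarithm. Genericity makes each factor regular on the circle where the path
crosses its row of singularities. -/
theorem exists_levels {S T : Set ℂ} (hS : ∀ R : ℝ, (S ∩ Metric.closedBall 0 R).Finite)
    (h0S : (0 : ℂ) ∉ S) (hT : ∀ R : ℝ, (T ∩ Metric.closedBall 0 R).Finite) (h0T : (0 : ℂ) ∉ T)
    {p : ℂ} (hp : p ≠ 0) {r : ℝ} (hr : 0 < r) : ∃ x₀ x₁ : ℝ, x₀ < x₁ ∧ Levels S T p x₀ x₁ ∧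
      Real.exp x₀ < r ∧ (∀ θ : ℝ, Complex.exp (x₁ + θ * Complex.I) ∉ S) ∧
      ∀ θ : ℝ, p * Complex.exp (-(x₀ + θ * Complex.I)) ∉ T := by
  have hp' : 0 < ‖p‖ := norm_pos_iff.2 hp
  obtain ⟨r₁, hr₁, h1⟩ := exists_ball_subset_starDomain hS h0S
  obtain ⟨r₂, hr₂, h2⟩ := exists_ball_subset_starDomain hT h0T
  obtain ⟨x₀, -, hx₀, h3⟩ := exists_norm_ne hT (c := fun x => ‖p‖ * Real.exp (-x)) (by fun_prop)
    (fun x y h => by simpa [hp] using h)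
    (sub_one_lt (min (Real.log r₁ - 1) (Real.log r)))
  obtain ⟨x₁, hx₁, -, h4⟩ := exists_norm_ne hS (c := Real.exp) (by fun_prop) Real.exp_injective
    (lt_add_one (max x₀ (1 - Real.log (r₂ / ‖p‖))))
  obtain ⟨a1, a2⟩ := lt_min_iff.1 hx₀
  obtain ⟨a3, a4⟩ := max_lt_iff.1 hx₁
  refine ⟨x₀, x₁, a3, ⟨hp, a3.le, fun z hz => h1 z (hz.trans_le ?_), fun z hz =>
    h2 z (hz.trans_le ?_)⟩, ?_, fun θ => h4 _ (by simp [Complex.norm_exp]), fun θ => h3 _ (by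
      simp [Complex.norm_exp])⟩
  · rw [← Real.le_log_iff_exp_le hr₁]; linarith
  · rw [mul_comm, ← le_div_iff₀ hp', ← Real.le_log_iff_exp_le (by positivity)]; linarith
  · rwa [← Real.lt_log_iff_exp_lt hr]

section

variable {S T : Set ℂ} {f g : ℂ → ℂ} {s : Side} {P R : ℂ → ℂ[X]} {A B : ℕ → ℂ} {p : ℂ}

/-- Continuation of the Hadamard product to a side of an arbitrary point. -/
theorem exists_continuation_side (hF : HasMonodromy f S s P) (hG : HasMonodromy g T s R)
    {r' r : ℝ} (hr' : 0 < r') (hr : 0 < r)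
    (hf : ∀ z : ℂ, ‖z‖ < r' → HasSum (fun n => A n * z ^ n) (f z))
    (hg : ∀ z : ℂ, ‖z‖ < r → HasSum (fun n => B n * z ^ n) (g z)) (hp : p ≠ 0) :
    ∃ δ > 0, ∃ ε > 0, ∃ k : ℂ → ℂ, ∃ Λ : Finset ℂ, (∀ a ∈ Λ, a ∈ S ∧ p / a ∈ T) ∧
      MonodromyClass k s (∏ a ∈ Λ, tensorPoly (P a) (R (p / a))) ∧
      ∀ η : ℝ, 0 < η → η < δ → ∃ K : ℂ → ℂ, DifferentiableOn ℂ K (s.sector η δ) ∧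
        (∀ w ∈ s.sector η δ, ‖p * Complex.exp w‖ < ε →
          HasSum (fun n => A n * B n * (p * Complex.exp w) ^ n) (K w)) ∧
        ∀ w : ℂ, ‖w‖ < δ → η < s.sgn * w.im → K w = k w := by
  obtain ⟨x₀, x₁, hlt, h, hx₀, h1, h0⟩ := exists_levels hF.locallyFinite hF.zero_notMem
    hG.locallyFinite hG.zero_notMem hp hr'
  have hgood := eventually_goodAngle hF.locallyFinite hF.zero_notMem hG.locallyFinite
    hG.zero_notMem hp x₀ x₁
  obtain ⟨θ, hθ⟩ := (hgood 0).exists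
  have hpi := Real.two_pi_pos
  obtain ⟨δ, hδ, k, Λ, hΛ, hk, hK⟩ := of_locally_of_trans (a := θ) (b := θ + 2 * Real.pi)
    (G := GoodAngle S T p x₀ x₁) (Q := SideSum f S T s P R B p x₀ x₁ (r * Real.exp x₀))
    (fun u v w _ _ huv hvw _ _ _ h1 h2 => h1.add h hF.differentiableOn huv hvw h2)
    (fun x _ => hgood x)
    (fun x _ => by
      by_cases hx : GoodAngle S T p x₀ x₁ x
      · obtain ⟨κ, hκ, hs⟩ := sideSum_of_goodAngle hF hG h hg hr hx
        exact ⟨κ, hκ, fun u v hu hv h1 _ _ h4 h5 => hs u v hu hv h1 h5.le h4⟩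
      · obtain ⟨κ, hκ, hs⟩ := sideSum_of_obstructed hF hG h hlt hg hr (h1 x) (h0 x)
        refine ⟨κ, hκ, fun u v hu hv h1 h2 h3 h4 _ => ?_⟩
        have hux : u < x := lt_of_le_of_ne h2 (by rintro rfl; exact hx hu)
        have hxv : x < v := lt_of_le_of_ne h3 (by rintro rfl; exact hx hv)
        -- On the right side the two rows are interchanged, so the interval is traversed backwards.
        cases s with
        | left =>
          refine hs u v ?_ ?_ ?_ ?_ <;> simp only [Side.sgn] <;> linarith
        | right =>
          refine (hs v u ?_ ?_ ?_ ?_).symm <;> simp only [Side.sgn] <;> linarith)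
    hθ hθ.add_two_pi (by linarith)
  rw [min_eq_left (by linarith), max_eq_right (by linarith)] at hΛ
  -- The pinches have angles in an open interval of length `2π`, so distinct logarithms give
  -- distinct `α`.
  have hinj : Set.InjOn Complex.exp (Λ : Set ℂ) := fun x hx y hy hxy => by
    obtain ⟨n, hn⟩ := Complex.exp_eq_exp_iff_exists_int.1 hxy
    have him := congrArg Complex.im hn
    simp at him
    have h1 := (hΛ x hx).1
    have h2 := (hΛ y hy).1
    have hn1 : (n : ℝ) < 1 := by nlinarith
    have hn2 : (-1 : ℝ) < n := by nlinarith
    have hn0 : n = 0 := by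
      have : n < 1 := by exact_mod_cast hn1
      have : -1 < n := by exact_mod_cast hn2
      omega
    simpa [hn0] using hn
  have hdiv : ∀ α : ℂ, p * Complex.exp (-α) = p / Complex.exp α := fun α => by
    rw [Complex.exp_neg, div_eq_mul_inv]
  refine ⟨δ, hδ, r * Real.exp x₀, by positivity, fun w => (2 * Real.pi * Complex.I)⁻¹ * k w,
    Λ.image Complex.exp, fun a ha => ?_, ?_, fun η hη hηδ => ?_⟩
  · obtain ⟨α, hα, rfl⟩ := Finset.mem_image.1 ha
    rw [← hdiv]
    exact (hΛ α hα).2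
  · rw [Finset.prod_image hinj]
    simp only [← hdiv]
    exact hk.const_mul _
  · obtain ⟨K, d1, d2, d3⟩ := hK η hη hηδ
    refine ⟨fun w => K w / (2 * Real.pi * Complex.I), d1.div_const _, fun w hw hε =>
      (d2 w hw hε).two_pi hf hx₀, fun w hw hwη => ?_⟩
    beta_reduce
    rw [d3 w hw hwη, div_eq_inv_mul]

/-- Two continuations of the same power series agree. -/
theorem continuation_unique {C : ℕ → ℂ} {p p' w' : ℂ} {δ α β δ' α' β' ε ε' : ℝ} {K K' : ℂ → ℂ}
    (hε : 0 < ε) (hε' : 0 < ε')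
    (hK : DifferentiableOn ℂ K {w | w.re < δ ∧ α < w.im ∧ w.im < β})
    (hs : ∀ w : ℂ, w.re < δ → α < w.im → w.im < β → ‖p * Complex.exp w‖ < ε →
      HasSum (fun n => C n * (p * Complex.exp w) ^ n) (K w))
    (hK' : DifferentiableOn ℂ K' {w | w.re < δ' ∧ α' < w.im ∧ w.im < β'})
    (hs' : ∀ w : ℂ, w.re < δ' → α' < w.im → w.im < β' → ‖p' * Complex.exp w‖ < ε' →
      HasSum (fun n => C n * (p' * Complex.exp w) ^ n) (K' w))
    (hw1 : w'.re < δ) (hw2 : α < w'.im) (hw3 : w'.im < β) (h1 : 0 < δ') (h2 : α' < 0)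
    (h3 : 0 < β') (hp : p' = p * Complex.exp w') : K w' = K' 0 := by
  set D : Set ℂ := {v | v.re < min (δ - w'.re) δ' ∧ max (α - w'.im) α' < v.im ∧
    v.im < min (β - w'.im) β'} with hD
  have hD1 : ∀ v ∈ D, (w' + v).re < δ ∧ α < (w' + v).im ∧ (w' + v).im < β := fun v hv => by
    have a1 := (lt_min_iff.1 hv.1).1
    have a2 := (max_lt_iff.1 hv.2.1).1
    have a3 := (lt_min_iff.1 hv.2.2).1
    rw [Complex.add_re, Complex.add_im]
    exact ⟨by linarith, by linarith, by linarith⟩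
  have hD2 : ∀ v ∈ D, v.re < δ' ∧ α' < v.im ∧ v.im < β' := fun v hv =>
    ⟨(lt_min_iff.1 hv.1).2, (max_lt_iff.1 hv.2.1).2, (lt_min_iff.1 hv.2.2).2⟩
  have h0D : (0 : ℂ) ∈ D := by
    refine ⟨lt_min ?_ ?_, max_lt ?_ ?_, lt_min ?_ ?_⟩ <;> simp <;> assumption
  have hpe : ∀ v : ℂ, p * Complex.exp (w' + v) = p' * Complex.exp v := fun v => by
    rw [hp, Complex.exp_add, mul_assoc]
  -- Far to the left both functions sum the same power series; equality then spreads over the convex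
  -- domain to `0`.
  obtain ⟨x, hx0, hx⟩ : ∃ x : ℝ, x < 0 ∧ ‖p'‖ * Real.exp x < min ε ε' := by
    have : Tendsto (fun x : ℝ => ‖p'‖ * Real.exp x) atBot (𝓝 (‖p'‖ * 0)) :=
      Real.tendsto_exp_atBot.const_mul _
    rw [mul_zero] at this
    exact ((eventually_lt_atBot 0).and (this.eventually (gt_mem_nhds (lt_min hε hε')))).exists
  have hxD : (x : ℂ) ∈ D := by
    refine ⟨?_, by simpa using h0D.2.1, by simpa using h0D.2.2⟩
    have := h0D.1
    rw [Complex.zero_re] at this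
    rw [Complex.ofReal_re]
    linarith
  have hDo : IsOpen D := isOpen_lt_re_im _ _ _
  have hnear : (fun v => K (w' + v)) =ᶠ[𝓝 (x : ℂ)] K' := by
    have hc : Continuous fun v : ℂ => ‖p' * Complex.exp v‖ := by fun_prop
    filter_upwards [hDo.mem_nhds hxD, (isOpen_lt hc continuous_const).mem_nhds
      (show ‖p' * Complex.exp (x : ℂ)‖ < min ε ε' by simpa [Complex.norm_exp] using hx)] with v hv hn
    obtain ⟨n1, n2⟩ := lt_min_iff.1 hn
    obtain ⟨a1, a2, a3⟩ := hD1 v hv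
    obtain ⟨b1, b2, b3⟩ := hD2 v hv
    have e1 := hs _ a1 a2 a3 (by rwa [hpe])
    rw [hpe] at e1
    exact e1.unique (hs' v b1 b2 b3 n2)
  have := eqOn_of_convex (convex_lt_re_im _ _ _) hDo (f := fun v => K (w' + v)) (g := K')
    (hK.comp (f := fun v => w' + v) (by fun_prop) hD1) (hK'.mono hD2) hxD hnear h0D
  simpa using this

end

/-! ### Construction of the principal branch of the Hadamard product. -/

/-- The Hadamard product of convergent power series is holomorphic near `0`. -/
theorem exists_hasSum_mul {A B : ℕ → ℂ} {f g : ℂ → ℂ} {r' r : ℝ} (hr' : 0 < r') (hr : 0 < r)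
    (hf : ∀ z : ℂ, ‖z‖ < r' → HasSum (fun n => A n * z ^ n) (f z))
    (hg : ∀ z : ℂ, ‖z‖ < r → HasSum (fun n => B n * z ^ n) (g z)) :
    ∃ R > 0, ∃ H : ℂ → ℂ, DifferentiableOn ℂ H (Metric.ball 0 R) ∧
      ∀ z : ℂ, ‖z‖ < R → HasSum (fun n => A n * B n * z ^ n) (H z) := by
  have sA := summable_norm_mul_pow hf (half_pos hr').le (half_lt_self hr')
  have sB := summable_norm_mul_pow hg (half_pos hr).le (half_lt_self hr)
  have hs : Summable fun n => (‖A n‖ * (r' / 2) ^ n) * (‖B n‖ * (r / 2) ^ n) := by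
    refine (Summable.mul_of_nonneg sA sB (fun n => ?_) (fun n => ?_)).comp_injective
      (i := fun n : ℕ => (n, n)) fun m n h => (Prod.ext_iff.1 h).1 <;>
      simp only [Pi.zero_apply] <;> positivity
  have hb : ∀ n (z : ℂ), z ∈ Metric.ball (0 : ℂ) (r' / 2 * (r / 2)) → ‖A n * B n * z ^ n‖ ≤
      (‖A n‖ * (r' / 2) ^ n) * (‖B n‖ * (r / 2) ^ n) := fun n z hz => by
    rw [mem_ball_zero_iff] at hz
    rw [norm_mul, norm_mul, norm_pow]
    calc ‖A n‖ * ‖B n‖ * ‖z‖ ^ n ≤ ‖A n‖ * ‖B n‖ * (r' / 2 * (r / 2)) ^ n := by gcongr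
      _ = _ := by rw [mul_pow]; ring
  refine ⟨r' / 2 * (r / 2), by positivity, fun z => ∑' n, A n * B n * z ^ n,
    Complex.differentiableOn_tsum_of_summable_norm hs (fun n => by fun_prop) Metric.isOpen_ball hb,
    fun z hz => ?_⟩
  exact (Summable.of_norm_bounded hs fun n => hb n z (by simpa using hz)).hasSum

theorem exists_forall_hasSum {A : PowerSeries ℂ} {f : ℂ → ℂ}
    (h : ∀ᶠ z in 𝓝 (0 : ℂ), HasSum (fun n => PowerSeries.coeff n A * z ^ n) (f z)) :
    ∃ r > 0, ∀ z : ℂ, ‖z‖ < r → HasSum (fun n => PowerSeries.coeff n A * z ^ n) (f z) := by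
  obtain ⟨r, hr, h⟩ := Metric.eventually_nhds_iff.1 h
  exact ⟨r, hr, fun z hz => h (by rwa [dist_zero_right])⟩

/-- Both sets stay away from `0`, so a bound on `|αβ|` bounds both factors. -/
theorem locallyFinite_mul {S T : Set ℂ} (hS : ∀ R : ℝ, (S ∩ Metric.closedBall 0 R).Finite)
    (h0S : (0 : ℂ) ∉ S) (hT : ∀ R : ℝ, (T ∩ Metric.closedBall 0 R).Finite) (h0T : (0 : ℂ) ∉ T)
    (R : ℝ) : ((S * T) ∩ Metric.closedBall 0 R).Finite := by
  obtain ⟨r₁, hr₁, h1⟩ := exists_ball_subset_starDomain hS h0S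
  obtain ⟨r₂, hr₂, h2⟩ := exists_ball_subset_starDomain hT h0T
  refine ((hS (R / r₂)).mul (hT (R / r₁))).subset ?_
  rintro _ ⟨⟨α, hα, β, hβ, rfl⟩, hR⟩
  have hα' : r₁ ≤ ‖α‖ := not_lt.1 fun h => notMem_of_mem_starDomain (h1 α h) hα
  have hβ' : r₂ ≤ ‖β‖ := not_lt.1 fun h => notMem_of_mem_starDomain (h2 β h) hβ
  rw [mem_closedBall_zero_iff, norm_mul] at hR
  refine Set.mul_mem_mul ⟨hα, ?_⟩ ⟨hβ, ?_⟩ <;> rw [mem_closedBall_zero_iff, le_div_iff₀ (by assumption)]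
  · exact (mul_le_mul_of_nonneg_left hβ' (norm_nonneg _)).trans hR
  · rw [mul_comm]
    exact (mul_le_mul_of_nonneg_right hα' (norm_nonneg _)).trans hR

theorem zero_notMem_mul {S T : Set ℂ} (h0S : (0 : ℂ) ∉ S) (h0T : (0 : ℂ) ∉ T) :
    (0 : ℂ) ∉ S * T := by
  rintro ⟨α, hα, β, hβ, h⟩
  rcases mul_eq_zero.1 h with rfl | rfl
  · exact h0S hα
  · exact h0T hβ

/-- The Hadamard product of `f` and `g` on the star domain of `S * T`, with its monodromy. -/
theorem exists_hadamard {A B : ℕ → ℂ} {S T : Set ℂ} {f g : ℂ → ℂ}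
    (hS : ∀ R : ℝ, (S ∩ Metric.closedBall 0 R).Finite) (h0S : (0 : ℂ) ∉ S)
    (hT : ∀ R : ℝ, (T ∩ Metric.closedBall 0 R).Finite) (h0T : (0 : ℂ) ∉ T)
    (hfd : DifferentiableOn ℂ f (starDomain S)) (hgd : DifferentiableOn ℂ g (starDomain T))
    {r' r : ℝ} (hr' : 0 < r') (hr : 0 < r)
    (hf : ∀ z : ℂ, ‖z‖ < r' → HasSum (fun n => A n * z ^ n) (f z))
    (hg : ∀ z : ℂ, ‖z‖ < r → HasSum (fun n => B n * z ^ n) (g z)) :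
    ∃ h : ℂ → ℂ, DifferentiableOn ℂ h (starDomain (S * T)) ∧
      (∀ᶠ z in 𝓝 (0 : ℂ), HasSum (fun n => A n * B n * z ^ n) (h z)) ∧
      ∀ (s : Side) (P R : ℂ → ℂ[X]), HasMonodromy f S s P → HasMonodromy g T s R →
        ∀ p : ℂ, p ≠ 0 → ∃ Λ : Finset ℂ, (∀ a ∈ Λ, a ∈ S ∧ p / a ∈ T) ∧
          MonodromyClass (fun w => h (p + p * w)) s (∏ a ∈ Λ, tensorPoly (P a) (R (p / a))) := by
  have hST := locallyFinite_mul hS h0S hT h0T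
  have h0ST := zero_notMem_mul h0S h0T
  obtain ⟨R₀, hR₀, H, hH, hHs⟩ := exists_hasSum_mul hr' hr hf hg
  obtain ⟨R₁, hR₁, hball⟩ := exists_ball_subset_starDomain hST h0ST
  -- The hypotheses on `p` stand behind the existential, so that choice provides functions on all of
  -- `ℂ`, with junk value `0` elsewhere.
  have key : ∀ p : ℂ, ∃ (δ ε : ℝ) (K : ℂ → ℂ), p ≠ 0 → p ∈ starDomain (S * T) →
      0 < δ ∧ 0 < ε ∧ DifferentiableOn ℂ K {w | w.re < δ ∧ -δ < w.im ∧ w.im < δ} ∧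
      ∀ w : ℂ, w.re < δ → -δ < w.im → w.im < δ → ‖p * Complex.exp w‖ < ε →
        HasSum (fun n => A n * B n * (p * Complex.exp w) ^ n) (K w) := fun p => by
    by_cases hp : p ≠ 0 ∧ p ∈ starDomain (S * T)
    · obtain ⟨x₀, x₁, -, hl, hx₀, -⟩ := exists_levels hS h0S hT h0T hp.1 hr'
      obtain ⟨δ, hδ, K, h1, h2⟩ := exists_continuation_center hl hS h0S hT h0T hfd hgd hf hx₀ hg hr
        hp.2
      exact ⟨δ, r * Real.exp x₀, K, fun _ _ => ⟨hδ, by positivity, h1, h2⟩⟩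
    · exact ⟨0, 0, 0, fun h1 h2 => absurd ⟨h1, h2⟩ hp⟩
  choose δ ε K key using key
  set h : ℂ → ℂ := fun z => if z = 0 then A 0 * B 0 else K z 0 with hh
  -- `h` is defined pointwise from unrelated continuations; by uniqueness, every continuation of the
  -- series computes it.
  have hval : ∀ {p w' : ℂ} {d α β e : ℝ} {L : ℂ → ℂ}, p ≠ 0 → 0 < e →
      DifferentiableOn ℂ L {w | w.re < d ∧ α < w.im ∧ w.im < β} →
      (∀ w : ℂ, w.re < d → α < w.im → w.im < β → ‖p * Complex.exp w‖ < e →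
        HasSum (fun n => A n * B n * (p * Complex.exp w) ^ n) (L w)) →
      w'.re < d → α < w'.im → w'.im < β → p * Complex.exp w' ∈ starDomain (S * T) →
      h (p * Complex.exp w') = L w' := fun {p w' d α β e L} hp he hL hLs a1 a2 a3 hst => by
    have hne : p * Complex.exp w' ≠ 0 := mul_ne_zero hp (Complex.exp_ne_zero _)
    obtain ⟨k1, k2, k3, k4⟩ := key _ hne hst
    simp only [hh, if_neg hne]
    exact (continuation_unique he k2 hL hLs k3 k4 a1 a2 a3 k1 (neg_lt_zero.2 k1) k1 rfl).symm
  have hzero : ∀ z : ℂ, ‖z‖ < min R₀ R₁ → h z = H z := fun z hz => by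
    obtain ⟨z1, z2⟩ := lt_min_iff.1 hz
    by_cases hz0 : z = 0
    · subst hz0
      have e1 := hHs 0 (by simpa using hR₀)
      have e2 : HasSum (fun n => A n * B n * (0 : ℂ) ^ n) (A 0 * B 0) := by
        simpa using hasSum_single (f := fun n => A n * B n * (0 : ℂ) ^ n) 0
          (fun n hn => by simp [hn])
      simp only [hh, if_true]
      exact e2.unique e1
    · have hzn : 0 < ‖z‖ := norm_pos_iff.2 hz0
      have hsm : ∀ w : ℂ, w.re < Real.log (R₀ / ‖z‖) → ‖z * Complex.exp w‖ < R₀ := fun w hw => by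
        rw [norm_mul, Complex.norm_exp, mul_comm, ← lt_div_iff₀ hzn,
          ← Real.lt_log_iff_exp_lt (by positivity)]
        exact hw
      have := hval (p := z) (w' := 0) (d := Real.log (R₀ / ‖z‖)) (α := -1) (β := 1) (e := 1)
        (L := fun w => H (z * Complex.exp w)) hz0 one_pos
        (hH.comp (f := fun w => z * Complex.exp w) (by fun_prop) fun w hw => by
          rw [mem_ball_zero_iff]; exact hsm w hw.1) (fun w h1 _ _ _ => hHs _ (hsm w h1))
        (by rw [Complex.zero_re]; exact Real.log_pos (by rwa [one_lt_div hzn])) (by simp) (by simp)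
        (by simpa using hball z z2)
      simpa using this
  have hmin : 0 < min R₀ R₁ := lt_min hR₀ hR₁
  refine ⟨h, fun p hp => ?_, ?_, fun s P R hF hG p hp => ?_⟩
  · refine DifferentiableAt.differentiableWithinAt ?_
    by_cases hp0 : p = 0
    · subst hp0
      refine (hH.differentiableAt (Metric.ball_mem_nhds 0 hR₀)).congr_of_eventuallyEq ?_
      filter_upwards [Metric.ball_mem_nhds (0 : ℂ) hmin] with z hz
      exact hzero z (by simpa using hz)
    · obtain ⟨k1, k2, k3, k4⟩ := key p hp0 hp
      have hlog : DifferentiableAt ℂ (fun z => Complex.log (z / p)) p :=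
        (differentiableAt_id.div_const p).clog (by simp [hp0])
      have hU : {w : ℂ | w.re < δ p ∧ -δ p < w.im ∧ w.im < δ p} ∈ 𝓝 (Complex.log (p / p)) :=
        (isOpen_lt_re_im _ _ _).mem_nhds (by simp [hp0, k1])
      have hcomp : DifferentiableAt ℂ (fun z => K p (Complex.log (z / p))) p :=
        DifferentiableAt.comp p (k3.differentiableAt hU) hlog
      refine hcomp.congr_of_eventuallyEq ?_
      filter_upwards [(isOpen_starDomain hST).mem_nhds hp, hlog.continuousAt hU,
        isOpen_ne.mem_nhds hp0] with z hz hzU hz0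
      have hez : p * Complex.exp (Complex.log (z / p)) = z := by
        rw [Complex.exp_log (div_ne_zero hz0 hp0), mul_div_cancel₀ _ hp0]
      have := hval hp0 k2 k3 k4 hzU.1 hzU.2.1 hzU.2.2 (by rwa [hez])
      rwa [hez] at this
  · filter_upwards [Metric.ball_mem_nhds (0 : ℂ) hmin] with z hz
    have hz' : ‖z‖ < min R₀ R₁ := by simpa using hz
    rw [hzero z hz']
    exact hHs z (hz'.trans_le (min_le_left _ _))
  · obtain ⟨δ, hδ, ε, hε, k, Λ, hΛ, hk, hK⟩ := exists_continuation_side hF hG hr' hr hf hg hp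
    obtain ⟨κ, hκ, hsec⟩ := exists_punctured_sector_mul hST h0ST hp 1
    refine ⟨Λ, hΛ, MonodromyClass.of_exp (hk.congr (lt_min hδ (lt_min hκ one_pos))
      fun w hw hwn => ?_)⟩
    obtain ⟨n1, n2⟩ := lt_min_iff.1 hwn
    obtain ⟨n2, n3⟩ := lt_min_iff.1 n2
    rw [Side.mem_halfPlane] at hw
    have him := Complex.abs_im_le_norm w
    have hre := Complex.re_le_norm w
    have hle := s.sgn_mul_le_abs w.im
    -- The representation depends on `η`, the side germ `k` does not; for a given `w`, half of its
    -- distance to the ray will do.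
    obtain ⟨L, d1, d2, d3⟩ := hK (s.sgn * w.im / 2) (by linarith) (by linarith)
    have hmem : w ∈ s.sector (s.sgn * w.im / 2) δ :=
      Side.mem_sector.2 ⟨by linarith, by linarith, by linarith⟩
    rw [← d3 w n1 (by linarith)]
    exact hval hp hε d1 (fun w a1 a2 a3 => d2 w ⟨a1, a2, a3⟩) hmem.1 hmem.2.1 hmem.2.2
      (hsec w (by linarith) (by rintro h0; simp [h0] at hw) (by linarith))

/-! ### Orders of the recurrences and conclusion. -/

theorem HasMonodromy.update {f : ℂ → ℂ} {S : Set ℂ} {s : Side} {P : ℂ → ℂ[X]}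
    (h : HasMonodromy f S s P) {α : ℂ} (hα : α ∈ S) {Q : ℂ[X]} (hQ : Q.Monic)
    (hc : MonodromyClass (fun w => f (α + α * w)) s Q) :
    HasMonodromy f S s (Function.update P α Q) where
  locallyFinite := h.locallyFinite
  zero_notMem := h.zero_notMem
  differentiableOn := h.differentiableOn
  monic q := by
    by_cases hq : q = α
    · subst hq; simpa using hQ
    · simpa [hq] using h.monic q
  eq_one q hq := by
    have : q ≠ α := by rintro rfl; exact hq hα
    simpa [this] using h.eq_one q hq
  monodromyClass q hq := by
    by_cases hqα : q = α
    · subst hqα; simpa using hc.to_exp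
    · simpa [hqα] using h.monodromyClass q hq

theorem IsPrincipalBranch.exists_hasMonodromy {A : PowerSeries ℂ} {S : Set ℂ} {f : ℂ → ℂ}
    (hf : IsPrincipalBranch A S f) {s : Side} {d : ℂ → ℕ}
    (h : ∀ α ∈ S, IntegrableAt f s α ∧ RecurrentOfOrder f s α (d α)) :
    ∃ P, HasMonodromy f S s P ∧ ∀ α ∈ S, (P α).natDegree = d α := by
  have key : ∀ q : ℂ, ∃ Q : ℂ[X], Q.Monic ∧ (q ∉ S → Q = 1) ∧ (q ∈ S → Q.natDegree = d q) ∧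
      (q ≠ 0 → MonodromyClass (fun w => f (q * Complex.exp w)) s Q) := fun q => by
    by_cases hq : q ∈ S
    · obtain ⟨hi, -, a, ha⟩ := h q hq
      have hq0 : q ≠ 0 := by rintro rfl; exact hf.zero_notMem hq
      exact ⟨recPoly a, recPoly_monic a, fun h => absurd hq h, fun _ => recPoly_natDegree a,
        fun _ => (monodromyClass_of_recurrence hq0 hi ha).to_exp⟩
    · exact ⟨1, monic_one, fun _ => rfl, fun h => absurd h hq,
        fun hq0 => (monodromyClass_of_regularAt (hf.regularAt q hq0 hq s)).to_exp⟩
  choose P h1 h2 h3 h4 using key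
  exact ⟨P, ⟨hf.locallyFinite, hf.zero_notMem, hf.differentiableOn, h1, h2, h4⟩, h3⟩

/-- `|β|` is bounded below on `T`, which bounds `|α|`; and `α` determines `β`. -/
theorem factorPairs_finite {S T : Set ℂ} (hS : ∀ R : ℝ, (S ∩ Metric.closedBall 0 R).Finite)
    (h0S : (0 : ℂ) ∉ S) (hT : ∀ R : ℝ, (T ∩ Metric.closedBall 0 R).Finite) (h0T : (0 : ℂ) ∉ T)
    (γ : ℂ) : (factorPairs S T γ).Finite := by
  obtain ⟨r, hr, h2⟩ := exists_ball_subset_starDomain hT h0T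
  refine ((hS (‖γ‖ / r)).image fun α => (α, γ / α)).subset ?_
  rintro ⟨α, β⟩ ⟨hα, hβ, rfl⟩
  have hβ' : r ≤ ‖β‖ := not_lt.1 fun h => notMem_of_mem_starDomain (h2 β h) hβ
  have hα0 : α ≠ 0 := fun h => h0S (h ▸ hα)
  refine ⟨α, ⟨hα, ?_⟩, by simp [hα0]⟩
  rw [mem_closedBall_zero_iff, le_div_iff₀ hr, norm_mul]
  gcongr

/-- The pinches inject into the factor pairs by `a ↦ (a, γ / a)`. An inequality suffices, because
orders can be padded. -/
theorem natDegree_prod_le {S T : Set ℂ} {γ : ℂ} (hfin : (factorPairs S T γ).Finite)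
    (h0S : (0 : ℂ) ∉ S) (P R : ℂ → ℂ[X]) {Λ : Finset ℂ} (hΛ : ∀ a ∈ Λ, a ∈ S ∧ γ / a ∈ T) :
    (∏ a ∈ Λ, tensorPoly (P a) (R (γ / a))).natDegree ≤
      ∑ q ∈ hfin.toFinset, (P q.1).natDegree * (R q.2).natDegree := by
  rw [natDegree_prod_of_monic _ _ fun a _ => tensorPoly_monic _ _]
  have hsub : Λ.image (fun a => (a, γ / a)) ⊆ hfin.toFinset := fun q hq => by
    obtain ⟨a, ha, rfl⟩ := Finset.mem_image.1 hq
    have ha0 : a ≠ 0 := by rintro rfl; exact h0S (hΛ _ ha).1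
    exact hfin.mem_toFinset.2 ⟨(hΛ a ha).1, (hΛ a ha).2, mul_div_cancel₀ _ ha0⟩
  refine le_trans (le_of_eq ?_) (Finset.sum_le_sum_of_subset hsub)
  rw [Finset.sum_image fun a _ b _ hab => (Prod.ext_iff.1 hab).1]
  exact Finset.sum_congr rfl fun a _ => tensorPoly_natDegree _ _

/-- The orders at `γ` for the Hadamard product, given polynomials for the monodromies of the
factors. -/
theorem recurrentOfOrder_of_natDegree_sum_lt {S T : Set ℂ} {h : ℂ → ℂ} {s : Side} {γ : ℂ}
    (hfin : (factorPairs S T γ).Finite) (h0S : (0 : ℂ) ∉ S) {P R : ℂ → ℂ[X]}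
    (hh : ∃ Λ : Finset ℂ, (∀ a ∈ Λ, a ∈ S ∧ γ / a ∈ T) ∧
      MonodromyClass (fun w => h (γ + γ * w)) s (∏ a ∈ Λ, tensorPoly (P a) (R (γ / a))))
    {n : ℕ} (hn : ∑ q ∈ hfin.toFinset, (P q.1).natDegree * (R q.2).natDegree < n) :
    RecurrentOfOrder h s γ n := by
  obtain ⟨Λ, hΛ, hc⟩ := hh
  exact hc.recurrentOfOrder (monic_prod_of_monic _ _ fun a _ => tensorPoly_monic _ _)
    ((natDegree_prod_le hfin h0S P R hΛ).trans_lt hn)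

/-- The quantitative form of the theorem. -/
theorem exists_isPrincipalBranch_hadamard {A B : PowerSeries ℂ} {S T : Set ℂ} {f g : ℂ → ℂ}
    {d e : Side → ℂ → ℕ} (hf : IsPrincipalBranch A S f) (hg : IsPrincipalBranch B T g)
    (hd : ∀ α ∈ S, ∀ s, IntegrableAt f s α ∧ RecurrentOfOrder f s α (d s α))
    (he : ∀ β ∈ T, ∀ s, IntegrableAt g s β ∧ RecurrentOfOrder g s β (e s β)) :
    ∃ h : ℂ → ℂ, IsPrincipalBranch (hadamard A B) (S * T) h ∧
      ∀ γ ∈ S * T, (factorPairs S T γ).Finite ∧ ∀ s,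
        IntegrableAt h s γ ∧
        RecurrentOfOrder h s γ (1 + ∑ᶠ p ∈ factorPairs S T γ, d s p.1 * e s p.2) ∧
        ((∃ p ∈ factorPairs S T γ,
            (∃ a : Fin (d s p.1) → ℂ, SatisfiesRecurrence f s p.1 a ∧ ∑ k, a k = 1) ∨
            (∃ b : Fin (e s p.2) → ℂ, SatisfiesRecurrence g s p.2 b ∧ ∑ k, b k = 1)) →
          RecurrentOfOrder h s γ (∑ᶠ p ∈ factorPairs S T γ, d s p.1 * e s p.2)) := by
  obtain ⟨r', hr', hf'⟩ := exists_forall_hasSum hf.hasSum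
  obtain ⟨r, hr, hg'⟩ := exists_forall_hasSum hg.hasSum
  obtain ⟨h, hhd, hhs, hh⟩ := exists_hadamard hf.locallyFinite hf.zero_notMem hg.locallyFinite
    hg.zero_notMem hf.differentiableOn hg.differentiableOn hr' hr hf' hg'
  choose P hP hPd using fun s => hf.exists_hasMonodromy (s := s) fun α hα => hd α hα s
  choose R hR hRd using fun s => hg.exists_hasMonodromy (s := s) fun β hβ => he β hβ s
  have h0 := zero_notMem_mul hf.zero_notMem hg.zero_notMem
  have hne : ∀ γ ∈ S * T, γ ≠ 0 := fun γ hγ h => h0 (h ▸ hγ)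
  refine ⟨h, ⟨locallyFinite_mul hf.locallyFinite hf.zero_notMem hg.locallyFinite hg.zero_notMem, h0,
    by simpa only [hadamard, PowerSeries.coeff_mk] using hhs, hhd, fun p hp hpST s => ?_,
    fun γ hγ s => ?_⟩, fun γ hγ => ?_⟩
  · obtain ⟨Λ, hΛ, hc⟩ := hh s (P s) (R s) (hP s) (hR s) p hp
    -- Outside `S * T` there are no pinches, so the annihilator is `1` and the side germ is regular.
    have hΛ0 : Λ = ∅ := Finset.eq_empty_of_forall_notMem fun a ha => by
      have ha0 : a ≠ 0 := by rintro rfl; exact hf.zero_notMem (hΛ _ ha).1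
      exact hpST ⟨a, (hΛ a ha).1, p / a, (hΛ a ha).2, mul_div_cancel₀ _ ha0⟩
    rw [hΛ0, Finset.prod_empty] at hc
    exact hc.regularAt
  · obtain ⟨Λ, -, hc⟩ := hh s (P s) (R s) (hP s) (hR s) γ (hne γ hγ)
    exact hc.exists_continuation
  have hfin := factorPairs_finite hf.locallyFinite hf.zero_notMem hg.locallyFinite hg.zero_notMem γ
  refine ⟨hfin, fun s => ?_⟩
  rw [finsum_mem_eq_finite_toFinset_sum _ hfin]
  have hsum : ∑ q ∈ hfin.toFinset, (P s q.1).natDegree * (R s q.2).natDegree =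
      ∑ q ∈ hfin.toFinset, d s q.1 * e s q.2 := Finset.sum_congr rfl fun q hq => by
    obtain ⟨h1, h2, -⟩ := hfin.mem_toFinset.1 hq
    rw [hPd s _ h1, hRd s _ h2]
  refine ⟨?_, recurrentOfOrder_of_natDegree_sum_lt hfin hf.zero_notMem
    (hh s (P s) (R s) (hP s) (hR s) γ (hne γ hγ)) (by rw [hsum]; omega), ?_⟩
  · obtain ⟨Λ, -, hc⟩ := hh s (P s) (R s) (hP s) (hR s) γ (hne γ hγ)
    exact hc.integrableAt
  rintro ⟨⟨α, β⟩, hαβ, ⟨a, ha, ha1⟩ | ⟨b, hb, hb1⟩⟩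
  · have hα : α ∈ S := hαβ.1
    have hβ : β ∈ T := hαβ.2.1
    obtain ⟨Q, hQ, hQd, hQc⟩ := monodromyClass_of_recurrence_sum_eq_one
      (fun h => hf.zero_notMem (h ▸ hα)) (hd α hα s).1 ha ha1
    -- The smaller annihilator `Q` replaces the characteristic polynomial at `α` alone.
    refine recurrentOfOrder_of_natDegree_sum_lt hfin hf.zero_notMem
      (hh s _ (R s) ((hP s).update hα hQ hQc) (hR s) γ (hne γ hγ)) ?_
    rw [← hsum]
    have hlt : Q.natDegree < (P s α).natDegree := by rw [hPd s α hα]; exact Nat.lt_of_succ_le hQd.le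
    -- Orders are at least `1`, so lowering one degree strictly lowers the sum and pays for the
    -- factor `X - 1`.
    have hpos : 0 < (R s β).natDegree := by rw [hRd s β hβ]; exact (he β hβ s).2.1
    refine Finset.sum_lt_sum (fun q _ => Nat.mul_le_mul_right _ ?_)
      ⟨(α, β), hfin.mem_toFinset.2 hαβ, by simpa using Nat.mul_lt_mul_of_pos_right hlt hpos⟩
    by_cases hq : q.1 = α
    · rw [hq, Function.update_self]; exact hlt.le
    · rw [Function.update_of_ne hq]
  · have hα : α ∈ S := hαβ.1
    have hβ : β ∈ T := hαβ.2.1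
    obtain ⟨Q, hQ, hQd, hQc⟩ := monodromyClass_of_recurrence_sum_eq_one
      (fun h => hg.zero_notMem (h ▸ hβ)) (he β hβ s).1 hb hb1
    refine recurrentOfOrder_of_natDegree_sum_lt hfin hf.zero_notMem
      (hh s (P s) _ (hP s) ((hR s).update hβ hQ hQc) γ (hne γ hγ)) ?_
    rw [← hsum]
    have hlt : Q.natDegree < (R s β).natDegree := by rw [hRd s β hβ]; exact Nat.lt_of_succ_le hQd.le
    have hpos : 0 < (P s α).natDegree := by rw [hPd s α hα]; exact (hd α hα s).2.1
    refine Finset.sum_lt_sum (fun q _ => Nat.mul_le_mul_left _ ?_)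
      ⟨(α, β), hfin.mem_toFinset.2 hαβ, by simpa using Nat.mul_lt_mul_of_pos_left hlt hpos⟩
    by_cases hq : q.2 = β
    · rw [hq, Function.update_self]; exact hlt.le
    · rw [Function.update_of_ne hq]

end HadamardMonodromy

open HadamardMonodromy in
theorem mainTheorem9 (A B : PowerSeries ℂ) :
    (A ∈ IntegrableRecurrentClass → B ∈ IntegrableRecurrentClass →
      hadamard A B ∈ IntegrableRecurrentClass) ∧
    ∀ (S T : Set ℂ) (f g : ℂ → ℂ) (d e : Side → ℂ → ℕ),
      IsPrincipalBranch A S f → IsPrincipalBranch B T g →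
      (∀ α ∈ S, ∀ s, IntegrableAt f s α ∧ RecurrentOfOrder f s α (d s α)) →
      (∀ β ∈ T, ∀ s, IntegrableAt g s β ∧ RecurrentOfOrder g s β (e s β)) →
      ∃ h : ℂ → ℂ, IsPrincipalBranch (hadamard A B) (S * T) h ∧
        ∀ γ ∈ S * T, (factorPairs S T γ).Finite ∧ ∀ s,
          IntegrableAt h s γ ∧
          RecurrentOfOrder h s γ (1 + ∑ᶠ p ∈ factorPairs S T γ, d s p.1 * e s p.2) ∧
          ((∃ p ∈ factorPairs S T γ,
              (∃ a : Fin (d s p.1) → ℂ, SatisfiesRecurrence f s p.1 a ∧ ∑ k, a k = 1) ∨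
              (∃ b : Fin (e s p.2) → ℂ, SatisfiesRecurrence g s p.2 b ∧ ∑ k, b k = 1)) →
            RecurrentOfOrder h s γ (∑ᶠ p ∈ factorPairs S T γ, d s p.1 * e s p.2)) := by
  refine ⟨?_, fun S T f g d e hf hg hd he => exists_isPrincipalBranch_hadamard hf hg hd he⟩
  -- Orders chosen as functions of side and point, with the irrelevant value `0` off the singular
  -- set.
  have orders : ∀ {f : ℂ → ℂ} {S : Set ℂ},
      (∀ α ∈ S, ∀ s, IntegrableAt f s α ∧ ∃ d, RecurrentOfOrder f s α d) →
      ∃ d : Side → ℂ → ℕ, ∀ α ∈ S, ∀ s, IntegrableAt f s α ∧ RecurrentOfOrder f s α (d s α) := by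
    intro f S h
    have : ∀ s α, ∃ d, α ∈ S → RecurrentOfOrder f s α d := fun s α => by
      by_cases hα : α ∈ S
      · obtain ⟨d, hd⟩ := (h α hα s).2
        exact ⟨d, fun _ => hd⟩
      · exact ⟨0, fun h => absurd h hα⟩
    choose d hd using this
    exact ⟨d, fun α hα s => ⟨(h α hα s).1, hd s α hα⟩⟩
  rintro ⟨S, f, hf, hfs⟩ ⟨T, g, hg, hgs⟩
  obtain ⟨d, hd⟩ := orders hfs
  obtain ⟨e, he⟩ := orders hgs
  obtain ⟨h, hh, hγ⟩ := exists_isPrincipalBranch_hadamard hf hg hd he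
  exact ⟨S * T, h, hh, fun γ hγ' s =>
    ⟨((hγ γ hγ').2 s).1, _, ((hγ γ hγ').2 s).2.1⟩⟩
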